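/- Let $(V,w,d)$ be a weighted metric space with $n=|V|$ points, weights $w:V\to\mathbb R_{\ge 0}$ and metric $d$. For nonempty $S\subseteq V$ put $\mathrm{cost}(S)=\sum_{x\in V}w(x)\min_{y\in S}d(x,y)$, for an integer $1\le k\le n$ put $\mathrm{OPT}_k=\min\{\mathrm{cost}(S): S\subseteq V,\ |S|=k\}$, and, for $n\ge 2$, let $\Delta$ be the aspect ratio, i.e. the largest distance divided by the smallest nonzero distance. **Theorem.** There are absolute constants $\alpha\ge 1$, $C_1,C_2>0$, $c_1,c_2\in\mathbb N$ and a single deterministic algorithm (a real-RAM program that accesses $d$ only through distance queries, where real operations and queries take unit time and operations on integers are charged by the bit lengths of their operands) such that the following holds. For every weighted metric space $(V,w,d)$ of size $n$, every integer $k\ge 1$ and every real $\delta$ with $2\le\delta\le n/k$, the algorithm, given $n$, $k$, $\delta$, $w$ and query access to $d$, halts and returns a nonempty set $S\subseteq V$ with $|S|\le k$, such that $$\mathrm{cost}(S)\ \le\ (9\alpha)^{\ell+1}\cdot \mathrm{OPT}_k,\qquad \ell=\left\lceil \log_2\frac{\log(n/k)}{\log\delta}\right\rceil,$$ $$\mathrm{cost}(S)\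 \le\ C_1\left(\frac{\log(n/k)}{\log\delta}\right)^{c_1}\cdot \mathrm{OPT}_k,$$ and its running time is at most $C_2\, nk\delta\,\bigl(\log(n\Delta)\bigr)^{c_2}$. In other words, the algorithm computes a $\mathrm{poly}(\log(n/k)/\log\delta)$-approximation to $k$-median in $\tilde O(nk\delta)$ time, where $\tilde O$ hides factors polylogarithmic in $n$ and $\Delta$. -/

import Mathlib

/-! ## The machine model: a real RAM

Programs are structured (assignments, sequencing, conditionals, loops) and work on finitely many
named arrays, each with cells `0, 1, 2, …`: integer arrays, holding natural numbers, and real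
arrays, holding real numbers.  The metric is accessible only through distance queries.

Cost: an operation on real numbers, a comparison of real numbers and a distance query take unit
time; an operation on natural numbers, including every use of a number as an address, takes time
one plus the total number of bits of its operands (logarithmic cost).  There is no rounding
operation: real numbers influence the control flow only through comparisons. -/

namespace RealRAM

/-- The memory: `nats a i` is cell `i` of the integer array `a`, and `reals a i` is cell `i` of the
real array `a`. -/
structure State where
  nats : ℕ → ℕ → ℕ
  reals : ℕ → ℕ → ℝ

/-- Integer expressions. The name of an array is a constant of the program. -/
inductive NatExpr : Type
  | lit (c : ℕ)
  | get (a : ℕ) (i : NatExpr)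
  | add (e f : NatExpr)
  | sub (e f : NatExpr)
  | mul (e f : NatExpr)
  | div (e f : NatExpr)

/-- Real expressions; `query x y` asks for the distance of the points with labels `x` and `y`. -/
inductive RealExpr : Type
  | cast (e : NatExpr)
  | get (a : ℕ) (i : NatExpr)
  | query (x y : NatExpr)
  | add (e f : RealExpr)
  | sub (e f : RealExpr)
  | mul (e f : RealExpr)
  | div (e f : RealExpr)

/-- Tests. -/
inductive Test : Type
  | natLE (e f : NatExpr)
  | realLE (e f : RealExpr)
  | neg (b : Test)
  | conj (b b' : Test)

/-- Programs. -/
inductive Prog : Type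
  | skip
  | setNat (a : ℕ) (i : NatExpr) (e : NatExpr)
  | setReal (a : ℕ) (i : NatExpr) (e : RealExpr)
  | seq (P Q : Prog)
  | ite (b : Test) (P Q : Prog)
  | loop (b : Test) (P : Prog)

/-- The value of an integer expression (subtraction is truncated and division rounds down). -/
def NatExpr.val (s : State) : NatExpr → ℕ
  | .lit c => c
  | .get a i => s.nats a (i.val s)
  | .add e f => e.val s + f.val s
  | .sub e f => e.val s - f.val s
  | .mul e f => e.val s * f.val s
  | .div e f => e.val s / f.val s

/-- The time to evaluate an integer expression; `Nat.size m` is the number of bits of `m`. -/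
def NatExpr.time (s : State) : NatExpr → ℕ
  | .lit c => 1 + c.size
  | .get a i => i.time s + (1 + (i.val s).size + (s.nats a (i.val s)).size)
  | .add e f => e.time s + f.time s + (1 + (e.val s).size + (f.val s).size)
  | .sub e f => e.time s + f.time s + (1 + (e.val s).size + (f.val s).size)
  | .mul e f => e.time s + f.time s + (1 + (e.val s).size + (f.val s).size)
  | .div e f => e.time s + f.time s + (1 + (e.val s).size + (f.val s).size)

/-- The value of a real expression, where distance queries are answered by `q`. -/
noncomputable def RealExpr.val (q : ℕ → ℕ → ℝ) (s : State) : RealExpr → ℝ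
  | .cast e => (e.val s : ℝ)
  | .get a i => s.reals a (i.val s)
  | .query x y => q (x.val s) (y.val s)
  | .add e f => e.val q s + f.val q s
  | .sub e f => e.val q s - f.val q s
  | .mul e f => e.val q s * f.val q s
  | .div e f => e.val q s / f.val q s

/-- The time to evaluate a real expression. -/
def RealExpr.time (s : State) : RealExpr → ℕ
  | .cast e => e.time s + (1 + (e.val s).size)
  | .get _ i => i.time s + (1 + (i.val s).size)
  | .query x y => x.time s + y.time s + (1 + (x.val s).size + (y.val s).size)
  | .add e f => e.time s + f.time s + 1
  | .sub e f => e.time s + f.time s + 1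
  | .mul e f => e.time s + f.time s + 1
  | .div e f => e.time s + f.time s + 1

/-- The truth of a test. -/
def Test.Holds (q : ℕ → ℕ → ℝ) (s : State) : Test → Prop
  | .natLE e f => e.val s ≤ f.val s
  | .realLE e f => e.val q s ≤ f.val q s
  | .neg b => ¬ b.Holds q s
  | .conj b b' => b.Holds q s ∧ b'.Holds q s

/-- The time to evaluate a test. -/
def Test.time (s : State) : Test → ℕ
  | .natLE e f => e.time s + f.time s + (1 + (e.val s).size + (f.val s).size)
  | .realLE e f => e.time s + f.time s + 1
  | .neg b => b.time s + 1
  | .conj b b' => b.time s + b'.time s + 1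

/-- Writing the value `m` into cell `i` of the integer array `a`. -/
def State.writeNat (s : State) (a i m : ℕ) : State :=
  { s with nats := Function.update s.nats a (Function.update (s.nats a) i m) }

/-- Writing the value `r` into cell `i` of the real array `a`. -/
noncomputable def State.writeReal (s : State) (a i : ℕ) (r : ℝ) : State :=
  { s with reals := Function.update s.reals a (Function.update (s.reals a) i r) }

/-- `Runs q P s t s'`: started in the memory state `s`, with distance queries answered by `q`, the
program `P` halts after exactly `t` time units, and it halts in the memory state `s'`. -/
inductive Runs (q : ℕ → ℕ → ℝ) : Prog → State → ℕ → State → Prop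
  | skip (s : State) : Runs q .skip s 1 s
  | setNat (s : State) (a : ℕ) (i e : NatExpr) :
      Runs q (.setNat a i e) s (i.time s + e.time s + (1 + (i.val s).size + (e.val s).size))
        (s.writeNat a (i.val s) (e.val s))
  | setReal (s : State) (a : ℕ) (i : NatExpr) (e : RealExpr) :
      Runs q (.setReal a i e) s (i.time s + e.time s + (1 + (i.val s).size))
        (s.writeReal a (i.val s) (e.val q s))
  | seq {P Q : Prog} {s s' s'' : State} {t t' : ℕ} :
      Runs q P s t s' → Runs q Q s' t' s'' → Runs q (.seq P Q) s (t + t') s''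
  | iteTrue {b : Test} {P Q : Prog} {s s' : State} {t : ℕ} :
      b.Holds q s → Runs q P s t s' → Runs q (.ite b P Q) s (b.time s + 1 + t) s'
  | iteFalse {b : Test} {P Q : Prog} {s s' : State} {t : ℕ} :
      ¬ b.Holds q s → Runs q Q s t s' → Runs q (.ite b P Q) s (b.time s + 1 + t) s'
  | loopDone {b : Test} {P : Prog} {s : State} :
      ¬ b.Holds q s → Runs q (.loop b P) s (b.time s + 1) s
  | loopStep {b : Test} {P : Prog} {s s' s'' : State} {t t' : ℕ} :
      b.Holds q s → Runs q P s t s' → Runs q (.loop b P) s' t' s'' →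
        Runs q (.loop b P) s (b.time s + 1 + t + t') s''

/-- Programs are deterministic: the running time and the final state are determined by the initial
state and the answers to the queries. -/
theorem Runs.deterministic {q : ℕ → ℕ → ℝ} {P : Prog} {s s₁ s₂ : State} {t₁ t₂ : ℕ}
    (h₁ : Runs q P s t₁ s₁) (h₂ : Runs q P s t₂ s₂) : t₁ = t₂ ∧ s₁ = s₂ := by
  induction h₁ generalizing t₂ s₂ with
  | skip s => cases h₂; exact ⟨rfl, rfl⟩
  | setNat s a i e => cases h₂; exact ⟨rfl, rfl⟩
  | setReal s a i e => cases h₂; exact ⟨rfl, rfl⟩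
  | seq _ _ ih ih' =>
    cases h₂ with
    | seq g g' =>
      obtain ⟨rfl, rfl⟩ := ih g
      obtain ⟨rfl, rfl⟩ := ih' g'
      exact ⟨rfl, rfl⟩
  | iteTrue hb _ ih =>
    cases h₂ with
    | iteTrue _ g => obtain ⟨rfl, rfl⟩ := ih g; exact ⟨rfl, rfl⟩
    | iteFalse hn _ => exact absurd hb hn
  | iteFalse hb _ ih =>
    cases h₂ with
    | iteTrue hn _ => exact absurd hn hb
    | iteFalse _ g => obtain ⟨rfl, rfl⟩ := ih g; exact ⟨rfl, rfl⟩
  | loopDone hb =>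
    cases h₂ with
    | loopDone _ => exact ⟨rfl, rfl⟩
    | loopStep hn _ _ => exact absurd hn hb
  | loopStep hb _ _ ih ih' =>
    cases h₂ with
    | loopDone hn => exact absurd hb hn
    | loopStep _ g g' =>
      obtain ⟨rfl, rfl⟩ := ih g
      obtain ⟨rfl, rfl⟩ := ih' g'
      exact ⟨rfl, rfl⟩

end RealRAM

/-! ## The `k`-median problem -/

namespace KMedian

/-- The cost `∑ x, w x * d(x, S)` of a solution `S`. It is used for nonempty `S` only, where
`Metric.infDist x S` is the distance of `x` to a nearest point of `S`. -/
noncomputable def cost {V : Type*} [Fintype V] [MetricSpace V] (w : V → ℝ) (S : Finset V) : ℝ :=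
  ∑ x, w x * Metric.infDist x (S : Set V)

/-- The optimal cost of a set of `k` centers. -/
noncomputable def opt {V : Type*} [Fintype V] [MetricSpace V] (w : V → ℝ) (k : ℕ) : ℝ :=
  sInf {c : ℝ | ∃ S : Finset V, S.card = k ∧ c = cost w S}

/-- The aspect ratio: the largest distance divided by the smallest distance of distinct points. -/
noncomputable def aspectRatio (V : Type*) [MetricSpace V] : ℝ :=
  Metric.diam (Set.univ : Set V) / Set.infsep (Set.univ : Set V)

/-- The answers to distance queries, for a space whose points carry the labels `0, …, n - 1`. -/
noncomputable def answer {V : Type*} [MetricSpace V] {n : ℕ} (label : Fin n ≃ V) (x y : ℕ) : ℝ :=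
  if h : x < n ∧ y < n then dist (label ⟨x, h.1⟩) (label ⟨y, h.2⟩) else 0

/-- The memory at the start: cells `0` and `1` of the integer array `0` hold `n` and `k`, the first
`n` cells of the real array `0` hold the weights, cell `0` of the real array `1` holds `δ`, and all
other cells hold `0`. -/
noncomputable def input {V : Type*} {n : ℕ} (label : Fin n ≃ V) (w : V → ℝ) (k : ℕ) (δ : ℝ) :
    RealRAM.State where
  nats a i := if a = 0 ∧ i = 0 then n else if a = 0 ∧ i = 1 then k else 0
  reals a i :=
    if a = 0 then (if h : i < n then w (label ⟨i, h⟩) else 0)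
    else if a = 1 ∧ i = 0 then δ else 0

/-- The set of labels that a final state presents as the output: the first `m` cells of the integer
array `2`, where `m` is the content of cell `0` of the integer array `1`. -/
def output (s : RealRAM.State) : Finset ℕ :=
  (Finset.range (s.nats 1 0)).image (s.nats 2)

/-- On the weighted metric space `(V, w, d)`, presented through the labelling `label`, and the
parameters `k` and `δ`, the program `P` halts after `t` time units and returns the set `S`. -/
def Returns {V : Type*} [MetricSpace V] (P : RealRAM.Prog) {n : ℕ} (label : Fin n ≃ V)
    (w : V → ℝ) (k : ℕ) (δ : ℝ) (t : ℕ) (S : Finset V) : Prop :=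
  ∃ s : RealRAM.State, RealRAM.Runs (answer label) P (input label w k δ) t s ∧
    output s = S.image (fun v => (label.symm v : ℕ))

end KMedian

/-! ## Step counting

For programs whose integers grow only by bounded increments, the running time is bounded by the
number of elementary steps up to a logarithmic factor. -/

namespace RealRAM

/-! The algorithm compresses a weighted list of points in rounds. A list of length `N` is cut into
blocks of size about `Q / N`, where `Q = 2nk⌈δ⌉`. Each block is replaced by `k` of its points,
carrying the weights of the points assigned to them, and the rounds stop when one block holds the
whole list. A block of size `m ≥ k` takes about `m ^ 2` steps up to the number of distance scales,
so every round takes about `Q` steps. About `N ^ 2 / Q` blocks leave `k` points each, so `n / N` is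
squared and multiplied by `⌈δ⌉`. After `t` rounds it is at least `⌈δ⌉ ^ (2 ^ t - 1)`, hence `ℓ + 1`
rounds suffice (`roundsProg_spec`).

Inside a block the centers come from a hierarchically greedy algorithm of Mettu–Plaxton type. It
repeatedly picks the most valuable ball that is isolated from the previous centers and descends
through children of half the radius to a single point. In `sum_ballValue_le`, the isolated balls
around any `k` competing centers are charged to pairwise disjoint balls on the greedy chains that
contain no competing center. The value of such balls is a lower bound for the competitor's cost,
which gives the factor 121 in `greedyCenters_cost_le`.

The error is measured against all 1-Lipschitz functions (`Approximates`). Moving the points of a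
block to their centers changes the integral of such a function by at most the moving cost, which is
at most 242 times the cost of any solution, a factor 2 being paid because centers must lie in the
block. The distance to a solution is itself 1-Lipschitz, so rounds compose multiplicatively
(`Approximates.trans`) and `ℓ + 1` rounds cost a factor `243 ^ (ℓ + 1)`. Finally the distance to the
output set vanishes on the last list, so the bound applies to the whole cost of the output.

For the running time, stored integers only grow by constant increments. A run of `N` steps therefore
handles numbers of `O(log (n + N))` bits, and `Steps.exists_runs` turns a step count into a time
bound. -/

@[simp] theorem State.writeNat_nats_apply (s : State) (a i m b j : ℕ) :
    (s.writeNat a i m).nats b j = if b = a ∧ j = i then m else s.nats b j := by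
  by_cases hb : b = a
  · subst hb
    by_cases hj : j = i <;> simp [State.writeNat, hj]
  · simp [State.writeNat, hb]

@[simp] theorem State.writeNat_nats_of_ne (s : State) (a i m : ℕ) {b : ℕ} (h : b ≠ a) :
    (s.writeNat a i m).nats b = s.nats b := by
  simp [State.writeNat, h]

@[simp] theorem State.writeNat_reals (s : State) (a i m : ℕ) :
    (s.writeNat a i m).reals = s.reals := rfl

@[simp] theorem State.writeReal_reals_apply (s : State) (a i : ℕ) (r : ℝ) (b j : ℕ) :
    (s.writeReal a i r).reals b j = if b = a ∧ j = i then r else s.reals b j := by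
  by_cases hb : b = a
  · subst hb
    by_cases hj : j = i <;> simp [State.writeReal, hj]
  · simp [State.writeReal, hb]

@[simp] theorem State.writeReal_reals_of_ne (s : State) (a i : ℕ) (r : ℝ) {b : ℕ} (h : b ≠ a) :
    (s.writeReal a i r).reals b = s.reals b := by
  simp [State.writeReal, h]

@[simp] theorem State.writeReal_nats (s : State) (a i : ℕ) (r : ℝ) :
    (s.writeReal a i r).nats = s.nats := rfl

/-- A bound for the degree of an integer expression as a polynomial in the memory contents. -/
def NatExpr.deg : NatExpr → ℕ
  | .lit c => c + 1
  | .get _ _ => 1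
  | .add e f => e.deg + f.deg
  | .sub e _ => e.deg
  | .mul e f => e.deg + f.deg
  | .div e _ => e.deg

/-- The time of an integer expression is at most `rate` times the bit length of the memory. -/
def NatExpr.rate : NatExpr → ℕ
  | .lit c => 1 + c.size
  | .get _ i => i.rate + (1 + i.deg + 1)
  | .add e f => e.rate + f.rate + (1 + e.deg + f.deg)
  | .sub e f => e.rate + f.rate + (1 + e.deg + f.deg)
  | .mul e f => e.rate + f.rate + (1 + e.deg + f.deg)
  | .div e f => e.rate + f.rate + (1 + e.deg + f.deg)

/-- The analogue of `NatExpr.rate` for real expressions. -/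
def RealExpr.rate : RealExpr → ℕ
  | .cast e => e.rate + (1 + e.deg)
  | .get _ i => i.rate + (1 + i.deg)
  | .query x y => x.rate + y.rate + (1 + x.deg + y.deg)
  | .add e f => e.rate + f.rate + 1
  | .sub e f => e.rate + f.rate + 1
  | .mul e f => e.rate + f.rate + 1
  | .div e f => e.rate + f.rate + 1

/-- The analogue of `NatExpr.rate` for tests. -/
def Test.rate : Test → ℕ
  | .natLE e f => e.rate + f.rate + (1 + e.deg + f.deg)
  | .realLE e f => e.rate + f.rate + 1
  | .neg b => b.rate + 1
  | .conj b b' => b.rate + b'.rate + 1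

/-- The time of one elementary step of a program is at most `rate` times the bit length of the
memory. -/
def Prog.rate : Prog → ℕ
  | .skip => 1
  | .setNat _ i e => i.rate + e.rate + (1 + i.deg + e.deg)
  | .setReal _ i e => i.rate + e.rate + (1 + i.deg)
  | .seq P Q => P.rate + Q.rate
  | .ite b P Q => b.rate + 1 + P.rate + Q.rate
  | .loop b P => b.rate + 1 + P.rate

theorem NatExpr.one_le_deg (e : NatExpr) : 1 ≤ e.deg := by
  induction e <;> simp only [NatExpr.deg] <;> omega

/-- Sums are absorbed into products: `A + B ≤ A * B` once both are at least 2. This needs `2 ≤ M`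
and positive degrees, which is why a literal `c` has degree `c + 1`: its bound is `c < M ^ c`, and
the literal 0 must not get degree 0. -/
theorem NatExpr.val_le_pow {s : State} {M : ℕ} (hM : 2 ≤ M) (h : ∀ a i, s.nats a i ≤ M)
    (e : NatExpr) : e.val s ≤ M ^ e.deg := by
  have h1 : 1 ≤ M := by omega
  induction e with
  | lit c =>
    simp only [NatExpr.val, NatExpr.deg]
    exact (Nat.lt_pow_self (by omega)).le.trans (Nat.pow_le_pow_right h1 (Nat.le_succ c))
  | get a i ih => simpa [NatExpr.val, NatExpr.deg] using h a _
  | add e f ihe ihf =>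
    simp only [NatExpr.val, NatExpr.deg]
    have he : 2 ≤ M ^ e.deg :=
      hM.trans (Nat.le_self_pow (by have := e.one_le_deg; omega) M)
    have hf : 2 ≤ M ^ f.deg :=
      hM.trans (Nat.le_self_pow (by have := f.one_le_deg; omega) M)
    rw [pow_add]
    nlinarith
  | sub e f ihe ihf => exact (Nat.sub_le _ _).trans ihe
  | mul e f ihe ihf =>
    simp only [NatExpr.val, NatExpr.deg, pow_add]
    exact Nat.mul_le_mul ihe ihf
  | div e f ihe ihf => exact (Nat.div_le_self _ _).trans ihe

theorem NatExpr.size_val_le {s : State} {M : ℕ} (hM : 2 ≤ M) (h : ∀ a i, s.nats a i ≤ M)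
    (e : NatExpr) : (e.val s).size ≤ e.deg * M.size := by
  rw [Nat.size_le, mul_comm, pow_mul]
  exact (e.val_le_pow hM h).trans_lt
    (Nat.pow_lt_pow_left (Nat.lt_size_self M) (by have := e.one_le_deg; omega))

theorem one_le_size {M : ℕ} (hM : 2 ≤ M) : 1 ≤ M.size :=
  Nat.size_pos.2 (by omega)

theorem NatExpr.time_le {s : State} {M : ℕ} (hM : 2 ≤ M) (h : ∀ a i, s.nats a i ≤ M)
    (e : NatExpr) : e.time s ≤ e.rate * M.size := by
  have h1 := one_le_size hM
  induction e with
  | lit c => simp only [NatExpr.time, NatExpr.rate]; nlinarith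
  | get a i ih =>
    have := i.size_val_le hM h
    have h2 : (s.nats a (i.val s)).size ≤ M.size := Nat.size_le_size (h _ _)
    simp only [NatExpr.time, NatExpr.rate]
    nlinarith
  | add e f ihe ihf | sub e f ihe ihf | mul e f ihe ihf | div e f ihe ihf =>
    have := e.size_val_le hM h
    have := f.size_val_le hM h
    simp only [NatExpr.time, NatExpr.rate]
    nlinarith

theorem RealExpr.time_le {s : State} {M : ℕ} (hM : 2 ≤ M) (h : ∀ a i, s.nats a i ≤ M)
    (e : RealExpr) : e.time s ≤ e.rate * M.size := by
  have h1 := one_le_size hM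
  induction e with
  | cast e =>
    have := e.size_val_le hM h
    have := e.time_le hM h
    simp only [RealExpr.time, RealExpr.rate]
    nlinarith
  | get a e =>
    have := e.size_val_le hM h
    have := e.time_le hM h
    simp only [RealExpr.time, RealExpr.rate]
    nlinarith
  | query x y =>
    have := x.size_val_le hM h
    have := x.time_le hM h
    have := y.size_val_le hM h
    have := y.time_le hM h
    simp only [RealExpr.time, RealExpr.rate]
    nlinarith
  | add e f ihe ihf | sub e f ihe ihf | mul e f ihe ihf | div e f ihe ihf =>
    simp only [RealExpr.time, RealExpr.rate]
    nlinarith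

theorem Test.time_le {s : State} {M : ℕ} (hM : 2 ≤ M) (h : ∀ a i, s.nats a i ≤ M)
    (b : Test) : b.time s ≤ b.rate * M.size := by
  have h1 := one_le_size hM
  induction b with
  | natLE x y =>
    have := x.size_val_le hM h
    have := x.time_le hM h
    have := y.size_val_le hM h
    have := y.time_le hM h
    simp only [Test.time, Test.rate]
    nlinarith
  | realLE x y =>
    have := x.time_le hM h
    have := y.time_le hM h
    simp only [Test.time, Test.rate]
    nlinarith
  | neg b ih =>
    simp only [Test.time, Test.rate]
    nlinarith
  | conj b b' ih ih' =>
    simp only [Test.time, Test.rate]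
    nlinarith

/-- The value of the expression exceeds the memory contents by a bounded amount only. -/
def NatExpr.Tame : NatExpr → Prop
  | .lit _ => True
  | .get _ _ => True
  | .add e (.lit _) => e.Tame
  | .sub e _ => e.Tame
  | .div e _ => e.Tame
  | _ => False

/-- By how much the value of a tame expression can exceed the memory contents. -/
def NatExpr.incr : NatExpr → ℕ
  | .lit c => c
  | .get _ _ => 0
  | .add e f => e.incr + f.incr
  | .sub e _ => e.incr
  | .mul _ _ => 0
  | .div e _ => e.incr

theorem NatExpr.val_le_add {s : State} {M : ℕ} (h : ∀ a i, s.nats a i ≤ M) :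
    ∀ e : NatExpr, e.Tame → e.val s ≤ M + e.incr
  | .lit c, _ => by simp [NatExpr.val, NatExpr.incr]
  | .get a i, _ => by simpa [NatExpr.val, NatExpr.incr] using h _ _
  | .add e (.lit c), he => by
    have := NatExpr.val_le_add h e he
    simp only [NatExpr.val, NatExpr.incr]
    omega
  | .sub e _, he => (Nat.sub_le _ _).trans (NatExpr.val_le_add h e he)
  | .div e _, he => (Nat.div_le_self _ _).trans (NatExpr.val_le_add h e he)

/-- All integer assignments of the program are tame. -/
def Prog.Tame : Prog → Prop
  | .skip => True
  | .setNat _ _ e => e.Tame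
  | .setReal _ _ _ => True
  | .seq P Q => P.Tame ∧ Q.Tame
  | .ite _ P Q => P.Tame ∧ Q.Tame
  | .loop _ P => P.Tame

/-- One step of a tame program increases the largest integer in the memory by at most `incr`. -/
def Prog.incr : Prog → ℕ
  | .skip => 0
  | .setNat _ _ e => e.incr
  | .setReal _ _ _ => 0
  | .seq P Q => P.incr + Q.incr
  | .ite _ P Q => P.incr + Q.incr
  | .loop _ P => P.incr

/-- Execution in a given number of elementary steps. -/
inductive Steps (q : ℕ → ℕ → ℝ) : Prog → State → ℕ → State → Prop
  | skip (s : State) : Steps q .skip s 1 s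
  | setNat (s : State) (a : ℕ) (i e : NatExpr) :
      Steps q (.setNat a i e) s 1 (s.writeNat a (i.val s) (e.val s))
  | setReal (s : State) (a : ℕ) (i : NatExpr) (e : RealExpr) :
      Steps q (.setReal a i e) s 1 (s.writeReal a (i.val s) (e.val q s))
  | seq {P Q : Prog} {s s' s'' : State} {t t' : ℕ} :
      Steps q P s t s' → Steps q Q s' t' s'' → Steps q (.seq P Q) s (t + t') s''
  | iteTrue {b : Test} {P Q : Prog} {s s' : State} {t : ℕ} :
      b.Holds q s → Steps q P s t s' → Steps q (.ite b P Q) s (1 + t) s'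
  | iteFalse {b : Test} {P Q : Prog} {s s' : State} {t : ℕ} :
      ¬ b.Holds q s → Steps q Q s t s' → Steps q (.ite b P Q) s (1 + t) s'
  | loopDone {b : Test} {P : Prog} {s : State} :
      ¬ b.Holds q s → Steps q (.loop b P) s 1 s
  | loopStep {b : Test} {P : Prog} {s s' s'' : State} {t t' : ℕ} :
      b.Holds q s → Steps q P s t s' → Steps q (.loop b P) s' t' s'' →
        Steps q (.loop b P) s (1 + t + t') s''

/-- Each step raises the largest stored integer by at most `incr`, so all integers of the run stay
below `M + P.incr * N`, and each step costs at most `rate` times the bit length of that bound. The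
bound on the final memory belongs to the induction because the second part of a sequence starts from
a larger `M`. -/
theorem Steps.exists_runs {q : ℕ → ℕ → ℝ} {P : Prog} {s s' : State} {N : ℕ}
    (h : Steps q P s N s') (hP : P.Tame) {M : ℕ} (hM : 2 ≤ M) (hs : ∀ a i, s.nats a i ≤ M) :
    ∃ t, Runs q P s t s' ∧ t ≤ P.rate * N * (M + P.incr * N).size ∧
      ∀ a i, s'.nats a i ≤ M + P.incr * N := by
  induction h generalizing M with
  | skip s =>
    refine ⟨1, .skip s, ?_, fun a i => by simpa [Prog.incr] using hs a i⟩
    have := one_le_size hM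
    simpa [Prog.rate, Prog.incr] using this
  | setNat s a i e =>
    have hv := e.val_le_add hs hP
    refine ⟨_, .setNat s a i e, ?_, fun b j => ?_⟩
    · have h1 := one_le_size hM
      have := i.time_le hM hs
      have := e.time_le hM hs
      have := i.size_val_le hM hs
      have := e.size_val_le hM hs
      have h2 : M.size ≤ (M + e.incr * 1).size := Nat.size_le_size (by omega)
      simp only [Prog.rate, Prog.incr]
      refine le_trans ?_ (Nat.mul_le_mul_left _ h2)
      nlinarith
    · simp only [State.writeNat_nats_apply, Prog.incr]
      split_ifs
      · omega
      · have := hs b j; omega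
  | setReal s a i e =>
    refine ⟨_, .setReal s a i e, ?_, fun b j => by simpa [Prog.incr] using hs b j⟩
    have h1 := one_le_size hM
    have := i.time_le hM hs
    have := e.time_le hM hs
    have := i.size_val_le hM hs
    simp only [Prog.rate, Prog.incr, mul_one, add_zero]
    nlinarith
  | @seq P Q s s' s'' n n' _ _ ih ih' =>
    obtain ⟨t, ht, hle, hm⟩ := ih hP.1 hM hs
    obtain ⟨t', ht', hle', hm'⟩ := ih' hP.2 (M := M + P.incr * n) (by omega) hm
    have e1 : M + P.incr * n ≤ M + (P.incr + Q.incr) * (n + n') := by nlinarith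
    have e2 : M + P.incr * n + Q.incr * n' ≤ M + (P.incr + Q.incr) * (n + n') := by nlinarith
    refine ⟨_, .seq ht ht', ?_, fun a i => (hm' a i).trans e2⟩
    have s1 := Nat.size_le_size e1
    have s2 := Nat.size_le_size e2
    simp only [Prog.rate, Prog.incr]
    set U := (M + (P.incr + Q.incr) * (n + n')).size
    calc t + t' ≤ P.rate * n * U + Q.rate * n' * U := by
          gcongr
          · exact hle.trans (Nat.mul_le_mul_left _ s1)
          · exact hle'.trans (Nat.mul_le_mul_left _ s2)
      _ = (P.rate * n + Q.rate * n') * U := by ring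
      _ ≤ (P.rate + Q.rate) * (n + n') * U := by
          gcongr
          nlinarith
  | @iteTrue b P Q s s' n hb _ ih =>
    obtain ⟨t, ht, hle, hm⟩ := ih hP.1 hM hs
    have e1 : M + P.incr * n ≤ M + (P.incr + Q.incr) * (1 + n) := by nlinarith
    refine ⟨_, .iteTrue hb ht, ?_, fun a i => (hm a i).trans e1⟩
    have s1 := Nat.size_le_size e1
    have h1 := one_le_size hM
    have h2 := b.time_le hM hs
    have s2 : M.size ≤ (M + (P.incr + Q.incr) * (1 + n)).size := Nat.size_le_size (by omega)
    simp only [Prog.rate, Prog.incr]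
    set U := (M + (P.incr + Q.incr) * (1 + n)).size
    calc b.time s + 1 + t ≤ b.rate * U + 1 * U + P.rate * n * U := by
          gcongr
          · exact h2.trans (Nat.mul_le_mul_left _ s2)
          · omega
          · exact hle.trans (Nat.mul_le_mul_left _ s1)
      _ = (b.rate + 1 + P.rate * n) * U := by ring
      _ ≤ (b.rate + 1 + P.rate + Q.rate) * (1 + n) * U := by
          gcongr
          nlinarith
  | @iteFalse b P Q s s' n hb _ ih =>
    obtain ⟨t, ht, hle, hm⟩ := ih hP.2 hM hs
    have e1 : M + Q.incr * n ≤ M + (P.incr + Q.incr) * (1 + n) := by nlinarith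
    refine ⟨_, .iteFalse hb ht, ?_, fun a i => (hm a i).trans e1⟩
    have s1 := Nat.size_le_size e1
    have h1 := one_le_size hM
    have h2 := b.time_le hM hs
    have s2 : M.size ≤ (M + (P.incr + Q.incr) * (1 + n)).size := Nat.size_le_size (by omega)
    simp only [Prog.rate, Prog.incr]
    set U := (M + (P.incr + Q.incr) * (1 + n)).size
    calc b.time s + 1 + t ≤ b.rate * U + 1 * U + Q.rate * n * U := by
          gcongr
          · exact h2.trans (Nat.mul_le_mul_left _ s2)
          · omega
          · exact hle.trans (Nat.mul_le_mul_left _ s1)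
      _ = (b.rate + 1 + Q.rate * n) * U := by ring
      _ ≤ (b.rate + 1 + P.rate + Q.rate) * (1 + n) * U := by
          gcongr
          nlinarith
  | @loopDone b P s hb =>
    refine ⟨_, .loopDone hb, ?_, fun a i => (hs a i).trans (by omega)⟩
    have h1 := one_le_size hM
    have h2 := b.time_le hM hs
    have s2 : M.size ≤ (M + P.incr * 1).size := Nat.size_le_size (by omega)
    simp only [Prog.rate, Prog.incr]
    refine le_trans ?_ (Nat.mul_le_mul_left _ s2)
    nlinarith
  | @loopStep b P s s' s'' n n' hb _ _ ih ih' =>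
    obtain ⟨t, ht, hle, hm⟩ := ih hP hM hs
    obtain ⟨t', ht', hle', hm'⟩ := ih' hP (M := M + P.incr * n) (by omega) hm
    simp only [Prog.rate, Prog.incr] at hle' hm' ⊢
    have e1 : M + P.incr * n ≤ M + P.incr * (1 + n + n') := by nlinarith
    have e2 : M + P.incr * n + P.incr * n' ≤ M + P.incr * (1 + n + n') := by nlinarith
    refine ⟨_, .loopStep hb ht ht', ?_, fun a i => (hm' a i).trans e2⟩
    have s1 := Nat.size_le_size e1
    have s2 := Nat.size_le_size e2
    have h1 := one_le_size hM
    have h2 := b.time_le hM hs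
    have s3 : M.size ≤ (M + P.incr * (1 + n + n')).size := Nat.size_le_size (by omega)
    set U := (M + P.incr * (1 + n + n')).size
    calc b.time s + 1 + t + t'
        ≤ b.rate * U + 1 * U + P.rate * n * U + (b.rate + 1 + P.rate) * n' * U := by
          gcongr
          · exact h2.trans (Nat.mul_le_mul_left _ s3)
          · omega
          · exact hle.trans (Nat.mul_le_mul_left _ s1)
          · exact hle'.trans (Nat.mul_le_mul_left _ s2)
      _ = (b.rate + 1 + P.rate * n + (b.rate + 1 + P.rate) * n') * U := by ring
      _ ≤ (b.rate + 1 + P.rate) * (1 + n + n') * U := by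
          gcongr
          nlinarith

/-! ## Triples -/

/-- The integer arrays a program may write to. -/
def Prog.natArrays : Prog → List ℕ
  | .skip => []
  | .setNat a _ _ => [a]
  | .setReal _ _ _ => []
  | .seq P Q => P.natArrays ++ Q.natArrays
  | .ite _ P Q => P.natArrays ++ Q.natArrays
  | .loop _ P => P.natArrays

/-- The real arrays a program may write to. -/
def Prog.realArrays : Prog → List ℕ
  | .skip => []
  | .setNat _ _ _ => []
  | .setReal a _ _ => [a]
  | .seq P Q => P.realArrays ++ Q.realArrays
  | .ite _ P Q => P.realArrays ++ Q.realArrays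
  | .loop _ P => P.realArrays

/-- The two states differ at most in the arrays the program may write to. -/
structure Prog.Frame (P : Prog) (s s' : State) : Prop where
  nats : ∀ a, a ∉ P.natArrays → s'.nats a = s.nats a
  reals : ∀ a, a ∉ P.realArrays → s'.reals a = s.reals a

theorem Prog.Frame.refl (P : Prog) (s : State) : P.Frame s s :=
  ⟨fun _ _ => rfl, fun _ _ => rfl⟩

theorem Prog.Frame.trans {P : Prog} {s s' s'' : State} (h : P.Frame s s') (h' : P.Frame s' s'') :
    P.Frame s s'' :=
  ⟨fun a ha => (h'.nats a ha).trans (h.nats a ha),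
    fun a ha => (h'.reals a ha).trans (h.reals a ha)⟩

theorem Prog.Frame.mono {P Q : Prog} {s s' : State} (h : P.Frame s s')
    (hn : P.natArrays ⊆ Q.natArrays) (hr : P.realArrays ⊆ Q.realArrays) : Q.Frame s s' :=
  ⟨fun a ha => h.nats a fun h' => ha (hn h'), fun a ha => h.reals a fun h' => ha (hr h')⟩

/-- Array names are constants of the program, so the arrays that can change are read off the syntax.
The specifications below discharge these side conditions with `decide`. -/
theorem Steps.frame {q : ℕ → ℕ → ℝ} {P : Prog} {s s' : State} {N : ℕ}
    (h : Steps q P s N s') : P.Frame s s' := by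
  induction h with
  | skip s => exact .refl _ _
  | setNat s a i e =>
    refine ⟨fun b hb => ?_, fun b hb => rfl⟩
    exact State.writeNat_nats_of_ne _ _ _ _ (by simpa [Prog.natArrays] using hb)
  | setReal s a i e =>
    refine ⟨fun b hb => rfl, fun b hb => ?_⟩
    exact State.writeReal_reals_of_ne _ _ _ _ (by simpa [Prog.realArrays] using hb)
  | seq _ _ ih ih' =>
    exact (ih.mono (by simp [Prog.natArrays]) (by simp [Prog.realArrays])).trans
      (ih'.mono (by simp [Prog.natArrays]) (by simp [Prog.realArrays]))
  | iteTrue _ _ ih => exact ih.mono (by simp [Prog.natArrays]) (by simp [Prog.realArrays])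
  | iteFalse _ _ ih => exact ih.mono (by simp [Prog.natArrays]) (by simp [Prog.realArrays])
  | loopDone _ => exact .refl _ _
  | loopStep _ _ _ ih ih' => exact .trans ⟨ih.nats, ih.reals⟩ ih'

/-- Started in `s`, the program halts within `N` steps in a state that satisfies `Q`. -/
def Tri (q : ℕ → ℕ → ℝ) (P : Prog) (s : State) (N : ℕ) (Q : State → Prop) : Prop :=
  ∃ n s', Steps q P s n s' ∧ n ≤ N ∧ Q s'

namespace Tri

variable {q : ℕ → ℕ → ℝ} {P P' : Prog} {s : State} {N N' : ℕ} {Q Q' : State → Prop} {b : Test}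

/-- The frame is available when postconditions are weakened or programs are sequenced, so a
specification has to mention only what a program computes, not what it leaves alone. -/
theorem mono (h : Tri q P s N Q) (hN : N ≤ N') (hQ : ∀ s', P.Frame s s' → Q s' → Q' s') :
    Tri q P s N' Q' := by
  obtain ⟨n, s', h, hn, hs⟩ := h
  exact ⟨n, s', h, hn.trans hN, hQ s' h.frame hs⟩

theorem skip (h : Q s) : Tri q .skip s 1 Q := ⟨1, s, .skip s, le_rfl, h⟩

theorem setNat {a : ℕ} {i e : NatExpr} (h : Q (s.writeNat a (i.val s) (e.val s))) :
    Tri q (.setNat a i e) s 1 Q := ⟨1, _, .setNat s a i e, le_rfl, h⟩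

theorem setReal {a : ℕ} {i : NatExpr} {e : RealExpr}
    (h : Q (s.writeReal a (i.val s) (e.val q s))) :
    Tri q (.setReal a i e) s 1 Q := ⟨1, _, .setReal s a i e, le_rfl, h⟩

theorem seq (h : Tri q P s N Q) (h' : ∀ s', P.Frame s s' → Q s' → Tri q P' s' N' Q') :
    Tri q (.seq P P') s (N + N') Q' := by
  obtain ⟨n, s', h, hn, hs⟩ := h
  obtain ⟨n', s'', h2, hn', hs'⟩ := h' s' h.frame hs
  exact ⟨n + n', s'', .seq h h2, by omega, hs'⟩

theorem ite (h : b.Holds q s → Tri q P s N Q) (h' : ¬ b.Holds q s → Tri q P' s N Q) :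
    Tri q (.ite b P P') s (1 + N) Q := by
  by_cases hb : b.Holds q s
  · obtain ⟨n, s', h, hn, hs⟩ := h hb
    exact ⟨1 + n, s', .iteTrue hb h, by omega, hs⟩
  · obtain ⟨n, s', h, hn, hs⟩ := h' hb
    exact ⟨1 + n, s', .iteFalse hb h, by omega, hs⟩

/-- The index of the invariant counts iterations. Having to show `i < R` whenever the test still
holds is the termination argument. -/
theorem loop {I : ℕ → State → Prop} {T : ℕ} (R : ℕ) (h0 : I 0 s)
    (h : ∀ i s', P.Frame s s' → I i s' → b.Holds q s' → i < R ∧ Tri q P s' T (I (i + 1))) :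
    Tri q (.loop b P) s (R * (T + 1) + 1) (fun s' => ¬ b.Holds q s' ∧ ∃ i ≤ R, I i s') := by
  suffices H : ∀ j i s', i + j = R → P.Frame s s' → I i s' →
      Tri q (.loop b P) s' (j * (T + 1) + 1) (fun s' => ¬ b.Holds q s' ∧ ∃ i ≤ R, I i s') from
    H R 0 s (by omega) (.refl _ _) h0
  intro j
  induction j with
  | zero =>
    intro i s' hi hf hI
    by_cases hb : b.Holds q s'
    · have := (h i s' hf hI hb).1; omega
    · exact ⟨1, s', .loopDone hb, by omega, hb, i, by omega, hI⟩
  | succ j ih =>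
    intro i s' hi hf hI
    by_cases hb : b.Holds q s'
    · obtain ⟨n, s'', h1, hn, hs⟩ := (h i s' hf hI hb).2
      obtain ⟨n', s3, h2, hn', hs'⟩ := ih (i + 1) s'' (by omega) (hf.trans h1.frame) hs
      refine ⟨1 + n + n', s3, .loopStep hb h1 h2, ?_, hs'⟩
      rw [Nat.succ_mul]
      omega
    · exact ⟨1, s', .loopDone hb, by omega, hb, i, by omega, hI⟩

end Tri

/-- The integer variable stored in cell `0` of array `a`. -/
abbrev nvar (a : ℕ) : NatExpr := .get a (.lit 0)

/-- The real variable stored in cell `0` of array `a`. -/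
abbrev rvar (a : ℕ) : RealExpr := .get a (.lit 0)

/-- The strict comparison of integers. -/
abbrev natLT (e f : NatExpr) : Test := .neg (.natLE f e)

/-- The strict comparison of reals. -/
abbrev realLT (e f : RealExpr) : Test := .neg (.realLE f e)

/-- Increase the variable `v`. -/
abbrev incrVar (v : ℕ) : Prog := .setNat v (.lit 0) (.add (nvar v) (.lit 1))

/-- The loop `for v = 0, …, e - 1`. -/
abbrev forLoop (v : ℕ) (e : NatExpr) (P : Prog) : Prog :=
  .seq (.setNat v (.lit 0) (.lit 0)) (.loop (natLT (nvar v) e) (.seq P (incrVar v)))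

/-- The bound `e` is evaluated again at each test, so `he` asks for its value in every state that
differs from `s` only in the arrays written by the loop. The invariant is established after the
counter has been advanced. An iteration pays 2 extra steps, for the test and the increment. -/
theorem Tri.forLoop {q : ℕ → ℕ → ℝ} {P : Prog} {s : State} {v : ℕ} {e : NatExpr}
    {I : ℕ → State → Prop} {T : ℕ} (R : ℕ) (hv : v ∉ P.natArrays)
    (h0 : I 0 (s.writeNat v 0 0))
    (he : ∀ s', (RealRAM.forLoop v e P).Frame s s' → e.val s' = R)
    (h : ∀ i < R, ∀ s', (RealRAM.forLoop v e P).Frame s s' → s'.nats v 0 = i → I i s' →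
      Tri q P s' T (fun s'' => I (i + 1) (s''.writeNat v 0 (i + 1)))) :
    Tri q (RealRAM.forLoop v e P) s (R * (T + 2) + 2) (fun s' => I R s') := by
  have hf1 : (RealRAM.forLoop v e P).Frame s (s.writeNat v 0 0) :=
    ⟨fun a ha => by
      rw [State.writeNat_nats_of_ne]
      simp [Prog.natArrays] at ha
      tauto, fun a ha => rfl⟩
  have key : Tri q (.loop (natLT (nvar v) e) (.seq P (incrVar v))) (s.writeNat v 0 0)
      (R * ((T + 1) + 1) + 1) _ :=
    Tri.loop (I := fun i s' => s'.nats v 0 = i ∧ i ≤ R ∧ I i s') R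
      ⟨by simp, by omega, h0⟩ (by
        intro i s' hf hI hb
        have hf' : (RealRAM.forLoop v e P).Frame s s' :=
          hf1.trans (hf.mono (by simp [Prog.natArrays]) (by simp [Prog.realArrays]))
        obtain ⟨hvi, hiR, hI⟩ := hI
        have hi : i < R := by
          simpa [Test.Holds, NatExpr.val, he s' hf', hvi] using hb
        refine ⟨hi, Tri.seq (h i hi s' hf' hvi hI) fun s'' hf'' hs'' => Tri.setNat ?_⟩
        have : s''.nats v 0 = i := by rw [hf''.nats v hv, hvi]
        simp only [NatExpr.val, this]
        exact ⟨by simp, by omega, hs''⟩)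
  have := Tri.seq (N := 1) (P := .setNat v (.lit 0) (.lit 0)) (q := q) (s := s)
    (Q := fun s' => s' = s.writeNat v 0 0) (Tri.setNat rfl) (fun s' _ hs' => hs' ▸ key)
  refine this.mono (le_of_eq (by ring)) ?_
  rintro s' hf ⟨hb, i, hi, hvi, hiR, hI⟩
  have : R ≤ i := by
    simpa [Test.Holds, NatExpr.val, he s' hf, hvi] using hb
  obtain rfl : i = R := by omega
  exact hI

end RealRAM

/-! ## The hierarchically greedy algorithm for `k`-median -/

namespace KMedian

/-- `d` is a pseudometric on the points `0, …, b - 1`. -/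
structure PseudoMetricOn (b : ℕ) (d : ℕ → ℕ → ℝ) : Prop where
  nonneg : ∀ x < b, ∀ y < b, 0 ≤ d x y
  self : ∀ x < b, d x x = 0
  symm : ∀ x < b, ∀ y < b, d x y = d y x
  tri : ∀ x < b, ∀ y < b, ∀ z < b, d x z ≤ d x y + d y z

/-- `R` is a sequence of radii, halved at each of the levels `1, …, L`, from the diameter down to
the minimum distance, followed by the radius `0` at the level `L + 1`. -/
structure Scales (b L : ℕ) (d : ℕ → ℕ → ℝ) (R : ℕ → ℝ) : Prop where
  nonneg : ∀ s ≤ L, 0 ≤ R s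
  half : ∀ s < L, R s = 2 * R (s + 1)
  last : R (L + 1) = 0
  diam : ∀ x < b, ∀ y < b, d x y ≤ R 0
  sep : ∀ x < b, ∀ y < b, d x y < 30 * R L → d x y = 0

/-- The value of the ball with center `x` and radius `r`. -/
noncomputable def ballValue (b : ℕ) (d : ℕ → ℕ → ℝ) (W : ℕ → ℝ) (r : ℝ) (x : ℕ) : ℝ :=
  ∑ y ∈ Finset.range b, W y * max (r - d x y) 0

/-- `lev x` is the level of the largest ball around `x` that is isolated from the centers
`z 0, …, z (i - 1)`. -/
def IsolationLevel (b L : ℕ) (d : ℕ → ℕ → ℝ) (R : ℕ → ℝ) (z : ℕ → ℕ) (i : ℕ) (lev : ℕ → ℕ) :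
    Prop :=
  ∀ x < b, lev x ≤ L + 1 ∧ (∀ h < i, 30 * R (lev x) ≤ d x (z h)) ∧
    (lev x = 0 ∨ ∃ h < i, d x (z h) < 30 * R (lev x - 1))

/-- `c` is the sequence of centers, from the level `lev x₀` down to the level `j`, that the greedy
algorithm visits: it starts with the isolated ball of largest value and continues with children of
largest value. -/
structure GreedyChain (b L : ℕ) (d : ℕ → ℕ → ℝ) (R W : ℕ → ℝ) (lev : ℕ → ℕ) (x₀ j : ℕ)
    (c : ℕ → ℕ) : Prop where
  start_lt : x₀ < b
  start : c (lev x₀) = x₀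
  start_max : ∀ x < b, ballValue b d W (R (lev x)) x ≤ ballValue b d W (R (lev x₀)) x₀
  lt : ∀ h, lev x₀ ≤ h → h < j → c (h + 1) < b
  dist_le : ∀ h, lev x₀ ≤ h → h < j → d (c h) (c (h + 1)) ≤ 2 * R h
  child_max : ∀ h, lev x₀ ≤ h → h < j → ∀ y < b, d (c h) y < 2 * R h →
    ballValue b d W (R (h + 1)) y ≤ ballValue b d W (R (h + 1)) (c (h + 1))

/-- `z` is a sequence of centers chosen by the greedy algorithm in its first `k` rounds. -/
def GreedyCenters (b L : ℕ) (d : ℕ → ℕ → ℝ) (R W : ℕ → ℝ) (z : ℕ → ℕ) (k : ℕ) : Prop :=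
  ∀ i < k, ∃ lev x₀ c, IsolationLevel b L d R z i lev ∧
    GreedyChain b L d R W lev x₀ (L + 1) c ∧ c (L + 1) = z i

variable {b L k : ℕ} {d : ℕ → ℕ → ℝ} {R W : ℕ → ℝ}

theorem ballValue_mono (hW : ∀ x < b, 0 ≤ W x) {r r' : ℝ} (h : r ≤ r') (x : ℕ) :
    ballValue b d W r x ≤ ballValue b d W r' x :=
  Finset.sum_le_sum fun y hy => mul_le_mul_of_nonneg_left
    (max_le_max (by linarith) le_rfl) (hW y (Finset.mem_range.1 hy))

namespace Scales

theorem nonneg' (hR : Scales b L d R) {s : ℕ} (hs : s ≤ L + 1) : 0 ≤ R s := by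
  rcases Nat.lt_or_ge L s with h | h
  · obtain rfl : s = L + 1 := by omega
    exact hR.last.ge
  · exact hR.nonneg s h

theorem two_mul_succ_le (hR : Scales b L d R) {s : ℕ} (hs : s ≤ L) : 2 * R (s + 1) ≤ R s := by
  rcases Nat.lt_or_ge s L with h | h
  · exact (hR.half s h).ge
  · obtain rfl : s = L := by omega
    simpa [hR.last] using hR.nonneg s hs

theorem anti (hR : Scales b L d R) {s s' : ℕ} (h : s ≤ s') (hs' : s' ≤ L + 1) : R s' ≤ R s := by
  induction s', h using Nat.le_induction with
  | base => exact le_rfl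
  | succ j hj ih =>
    have h1 := hR.two_mul_succ_le (s := j) (by omega)
    have h2 := hR.nonneg' (s := j + 1) hs'
    linarith [ih (by omega)]

end Scales

theorem GreedyChain.lt' {lev : ℕ → ℕ} {x₀ j : ℕ} {c : ℕ → ℕ}
    (h : GreedyChain b L d R W lev x₀ j c) {i : ℕ} (hi : lev x₀ ≤ i) (hij : i ≤ j) : c i < b := by
  rcases eq_or_lt_of_le hi with rfl | hi
  · rw [h.start]; exact h.start_lt
  · obtain ⟨i, rfl⟩ : ∃ i', i = i' + 1 := ⟨i - 1, by omega⟩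
    exact h.lt i (by omega) (by omega)

/-- Since radii at least halve, a step of length at most `2 * R h` is at most `4 * (R h - R (h +
1))`, and the path telescopes. -/
theorem GreedyChain.dist_le_four_mul (hd : PseudoMetricOn b d) (hR : Scales b L d R)
    {lev : ℕ → ℕ} {x₀ : ℕ} {c : ℕ → ℕ} (h : GreedyChain b L d R W lev x₀ (L + 1) c) {i j : ℕ}
    (hi : lev x₀ ≤ i) (hij : i ≤ j) (hj : j ≤ L + 1) : d (c i) (c j) ≤ 4 * R i := by
  suffices H : d (c i) (c j) ≤ 4 * (R i - R j) by linarith [hR.nonneg' hj]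
  induction j, hij using Nat.le_induction with
  | base => rw [hd.self _ (h.lt' hi hj)]; simp
  | succ j hij ih =>
    have h1 := hR.two_mul_succ_le (s := j) (by omega)
    have h2 := h.dist_le j (by omega) (by omega)
    have h3 := hd.tri _ (h.lt' hi (by omega)) _ (h.lt' (i := j) (by omega) (by omega)) _
      (h.lt' (i := j + 1) (by omega) hj)
    linarith [ih (by omega)]

/-- Comparison of two sums by a partial matching whose complement is unconstrained. -/
theorem sum_le_sum_of_matching {k : ℕ} (u v : Fin k → ℝ) (r : Fin k → Fin k → Prop)
    (h : ∀ i, (∀ e, u e ≤ v i) ∨ ∃ e, u e ≤ v i ∧ r i e)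
    (hr : ∀ i i' e, i < i' → r i e → r i' e → False) : ∑ e, u e ≤ ∑ i, v i := by
  classical
  have h' : ∀ i, ∃ e, (∀ e, u e ≤ v i) ∨ (u e ≤ v i ∧ r i e) := fun i => by
    rcases h i with h | ⟨e, h⟩
    · exact ⟨i, .inl h⟩
    · exact ⟨e, .inr h⟩
  choose f hf using h'
  -- On `s` the choice `f` is injective by `hr`, so it extends to a bijection. Indices outside `s`
  -- fall under the first alternative and tolerate any partner.
  let s : Finset (Fin k) := Finset.univ.filter fun i => r i (f i)
  obtain ⟨g, hg⟩ := Finset.exists_equiv_extend_of_card_eq (α := Fin k) (β := Fin k)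
    (t := Finset.univ) (s := s) (f := f) (by simp) (by simp) (by
      intro i hi i' hi' hii
      have h1 : r i (f i) := by simpa [s] using hi
      have h2 : r i' (f i') := by simpa [s] using hi'
      rcases lt_trichotomy i i' with hlt | heq | hlt
      · exact (hr i i' _ hlt h1 (hii ▸ h2)).elim
      · exact heq
      · exact (hr i' i _ hlt h2 (hii ▸ h1)).elim)
  have hle : ∀ i, u (g i) ≤ v i := fun i => by
    by_cases hi : i ∈ s
    · rw [hg i hi]
      rcases hf i with h | h
      · exact h _
      · exact h.1
    · rcases hf i with h | h
      · exact h _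
      · exact absurd (by simpa [s] using h.2) hi
  calc ∑ e, u e = ∑ i, u (g i) := by
        rw [← Equiv.sum_comp (g.trans (Equiv.subtypeUnivEquiv (by simp)))]
        rfl
    _ ≤ ∑ i, v i := Finset.sum_le_sum fun i _ => hle i

/-- The total value of the isolated balls around any `k` points is at most the cost of these
points. -/
theorem sum_ballValue_le (hd : PseudoMetricOn b d) (hR : Scales b L d R) (hW : ∀ x < b, 0 ≤ W x)
    {z : ℕ → ℕ} (hz : GreedyCenters b L d R W z k) {lev : ℕ → ℕ}
    (hlev : IsolationLevel b L d R z k lev) (X : Fin k → ℕ) (hX : ∀ e, X e < b)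
    (asg : ℕ → Fin k) :
    ∑ e, ballValue b d W (R (lev (X e))) (X e) ≤
      ∑ y ∈ Finset.range b, W y * d y (X (asg y)) := by
  classical
  choose levs x c hlevs hc hcz using fun i : Fin k => hz i i.2
  -- the first level of each chain
  set a : Fin k → ℕ := fun i => levs i (x i) with ha
  have haL : ∀ i, a i ≤ L + 1 := fun i => (hlevs i _ (hc i).start_lt).1
  have hca : ∀ i, c i (a i) = x i := fun i => (hc i).start
  have hlt : ∀ i j, a i ≤ j → j ≤ L + 1 → c i j < b := fun i j h h' => (hc i).lt' h h'
  have hzb : ∀ i : Fin k, z i < b := fun i => hcz i ▸ hlt i _ (haL i) le_rfl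
  have hcc : ∀ i j, a i ≤ j → j ≤ L + 1 → d (c i j) (z i) ≤ 4 * R j := fun i j h h' =>
    hcz i ▸ (hc i).dist_le_four_mul hd hR h h' le_rfl
  have hxc : ∀ i j, a i ≤ j → j ≤ L + 1 → d (x i) (c i j) ≤ 4 * R (a i) := fun i j h h' =>
    hca i ▸ (hc i).dist_le_four_mul hd hR le_rfl h h'
  have hfar : ∀ i i' : Fin k, i < i' → 30 * R (a i') ≤ d (x i') (z i) := fun i i' h =>
    (hlevs i' _ (hc i').start_lt).2.1 i h
  -- A ball of chain `i` is covered if it contains a competing center, or if a later chain starts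
  -- within twice its radius. The second condition makes the uncovered balls disjoint.
  let near : Fin k → ℕ → Fin k → Prop := fun i j i' => i < i' ∧ d (x i') (c i j) < 2 * R j
  let cov : Fin k → ℕ → Prop := fun i j =>
    (∃ e, d (X e) (c i j) < R j) ∨ ∃ i', near i j i'
  -- `p i` is the first level from which chain `i` is uncovered all the way down. It exists because
  -- a ball of radius 0, at level `L + 1`, is never covered.
  have hp : ∀ i, ∃ p, a i ≤ p ∧ p ≤ L + 1 ∧ (∀ j, p ≤ j → j ≤ L + 1 → ¬ cov i j) ∧
      (p = a i ∨ ∃ j, p = j + 1 ∧ a i ≤ j ∧ cov i j) := by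
    intro i
    have hex : ∃ p, a i ≤ p ∧ p ≤ L + 1 ∧ ∀ j, p ≤ j → j ≤ L + 1 → ¬ cov i j := by
      refine ⟨L + 1, haL i, le_rfl, fun j hj hj' => ?_⟩
      obtain rfl : j = L + 1 := by omega
      have hb := hlt i (L + 1) (haL i) le_rfl
      rintro (⟨e, he⟩ | ⟨i', -, hi'⟩)
      · rw [hR.last] at he
        exact absurd (hd.nonneg _ (hX e) _ hb) (not_le.2 he)
      · rw [hR.last, mul_zero] at hi'
        exact absurd (hd.nonneg _ (hc i').start_lt _ hb) (not_le.2 hi')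
    obtain ⟨h1, h2, h3⟩ := Nat.find_spec hex
    refine ⟨Nat.find hex, h1, h2, h3, ?_⟩
    by_contra! hne
    refine Nat.find_min hex (m := Nat.find hex - 1) (by omega)
      ⟨by omega, by omega, fun j hj hj' => ?_⟩
    rcases Nat.lt_or_ge j (Nat.find hex) with h | h
    · exact hne.2 j (by omega) (by omega)
    · exact h3 j h hj'
  choose p hap hpL hncov hpcov using hp
  have hpb : ∀ i, c i (p i) < b := fun i => hlt i _ (hap i) (hpL i)
  -- lower bounds for the levels of points close to a center
  have hlow : ∀ i : Fin k, ∀ y < b, ∀ j ≤ L, d y (z i) < 30 * R j → j + 1 ≤ lev y := by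
    intro i y hy j hj h
    have := (hlev y hy).2.1 i i.2
    by_contra! hlt'
    linarith [hR.anti (s := lev y) (s' := j) (by omega) (by omega)]
  have hlow' : ∀ i i' : Fin k, i < i' → ∀ j ≤ L, d (x i') (z i) < 30 * R j → j + 1 ≤ a i' := by
    intro i i' hi j hj h
    by_contra! hlt'
    linarith [hfar i i' hi, hR.anti (s := a i') (s' := j) (by omega) (by omega)]
  -- Isolated balls only shrink as centers are added. Hence the final isolated ball around `X e` is
  -- worth no more than the one that competed in round `i`, and the latter lost to the start of
  -- chain `i`.
  have hmono : ∀ (i : Fin k), ∀ y < b, levs i y ≤ lev y := by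
    intro i y hy
    obtain ⟨h1, h2, h3⟩ := hlevs i y hy
    rcases h3 with h3 | ⟨h, hh, h3⟩
    · omega
    · have h4 := hlow ⟨h, hh.trans i.2⟩ y hy (levs i y - 1)
      by_cases h0 : levs i y = 0
      · omega
      · have := h4 (by omega) h3
        omega
  have hstart : ∀ i e, ballValue b d W (R (lev (X e))) (X e) ≤
      ballValue b d W (R (a i)) (x i) := fun i e =>
    (ballValue_mono hW (hR.anti (hmono i _ (hX e)) (hlev _ (hX e)).1) _).trans
      ((hc i).start_max _ (hX e))
  -- The intermediate sum runs over the balls at the levels `p i`. It dominates the left side by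
  -- matching, and is at most the cost because these balls are disjoint and contain no competing
  -- center.
  refine (sum_le_sum_of_matching _ (fun i => ballValue b d W (R (p i)) (c i (p i)))
    (fun i e => ∃ j, p i = j + 1 ∧ a i ≤ j ∧ d (X e) (c i j) < R j ∧ ∀ i', ¬ near i j i')
    ?_ ?_).trans ?_
  · intro i
    rcases hpcov i with hpa | ⟨j, hpj, haj, hcov⟩
    · left
      intro e
      simp only [hpa, hca]
      exact hstart i e
    -- The ball of the chain at level `j = p i - 1` is covered. If a later start `x i'` is near, it
    -- was a candidate child at level `j + 1`, and its ball already dominates every `X e`. Otherwise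
    -- the covering center `X e` was itself a candidate child, which gives only the comparison with
    -- this `e`.
    have hjL : j ≤ L := by have := hpL i; omega
    have hjb := hlt i j haj (by omega)
    by_cases hnear : ∃ i', near i j i'
    · left
      obtain ⟨i', hi', hlt'⟩ := hnear
      intro e
      have h1 := hd.tri _ (hc i').start_lt _ hjb _ (hzb i)
      have h2 := hcc i j haj (by omega)
      have h3 := hR.nonneg j hjL
      have h0 := hd.nonneg _ (hc i').start_lt _ hjb
      have h4 : j + 1 ≤ a i' := hlow' i i' hi' j hjL (by linarith)
      calc ballValue b d W (R (lev (X e))) (X e)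
          ≤ ballValue b d W (R (a i')) (x i') := hstart i' e
        _ ≤ ballValue b d W (R (j + 1)) (x i') := ballValue_mono hW (hR.anti h4 (haL i')) _
        _ ≤ ballValue b d W (R (p i)) (c i (p i)) := by
          rw [hpj]
          refine (hc i).child_max j haj (by omega) _ (hc i').start_lt ?_
          rwa [hd.symm _ hjb _ (hc i').start_lt]
    · right
      rcases hcov with ⟨e, he⟩ | h
      · refine ⟨e, ?_, j, hpj, haj, he, not_exists.1 hnear⟩
        have h1 := hd.tri _ (hX e) _ hjb _ (hzb i)
        have h2 := hcc i j haj (by omega)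
        have h0 := hd.nonneg _ (hX e) _ hjb
        have h4 := hlow i _ (hX e) j hjL (by linarith)
        refine (ballValue_mono hW (hR.anti h4 (hlev _ (hX e)).1) _).trans ?_
        rw [hpj]
        refine (hc i).child_max j haj (by omega) _ (hX e) ?_
        rw [hd.symm _ hjb _ (hX e)]
        linarith
      · exact absurd h hnear
  -- If one `e` served two chains, the later start would be near the earlier chain, which was
  -- excluded. With `D = d (x i') (c i j)`, the chain bounds give `D < 5 * R (a i') + R j`, while
  -- isolation gives `30 * R (a i') ≤ D + 4 * R j`. Together `D < 2 * R j`; here the constant 30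
  -- gives exactly the factor 2.
  · rintro i i' e hi ⟨j, hpj, haj, hej, hnear⟩ ⟨j', hpj', haj', hej', -⟩
    have hjL : j ≤ L := by have := hpL i; omega
    have hjL' : j' ≤ L := by have := hpL i'; omega
    have hjb := hlt i j haj (by omega)
    have hjb' := hlt i' j' haj' (by omega)
    have hxb := (hc i').start_lt
    refine hnear i' ⟨hi, ?_⟩
    have e1 := hd.tri _ hxb _ hjb' _ (hX e)
    have e2 := hd.symm _ hjb' _ (hX e)
    have e3 := hxc i' j' haj' (by omega)
    have e4 := hR.anti haj' (by omega)
    have e5 := hd.tri _ hxb _ (hX e) _ hjb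
    have e6 := hd.tri _ hxb _ hjb _ (hzb i)
    have e7 := hcc i j haj (by omega)
    have e8 := hfar i i' hi
    linarith
  -- The same computation: a common point of two such balls would put the later start within `2 * R
  -- (p i)` of the earlier ball, which would then be covered.
  · have hdisj : ∀ i i' : Fin k, i < i' → ∀ y < b, d (c i (p i)) y < R (p i) →
        d (c i' (p i')) y < R (p i') → False := by
      intro i i' hi y hy h h'
      have hxb := (hc i').start_lt
      have e0 : ¬ d (x i') (c i (p i)) < 2 * R (p i) := fun hh =>
        hncov i (p i) le_rfl (hpL i) (.inr ⟨i', hi, hh⟩)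
      have e1 := hd.tri _ hxb _ (hpb i') _ hy
      have e2 := hd.tri _ hxb _ hy _ (hpb i)
      have e3 := hd.symm _ hy _ (hpb i)
      have e4 := hxc i' _ (hap i') (hpL i')
      have e5 := hR.anti (hap i') (hpL i')
      have e6 := hd.tri _ hxb _ (hpb i) _ (hzb i)
      have e7 := hcc i _ (hap i) (hpL i)
      have e8 := hfar i i' hi
      linarith
    unfold ballValue
    rw [Finset.sum_comm]
    refine Finset.sum_le_sum fun y hy => ?_
    rw [Finset.mem_range] at hy
    rw [← Finset.mul_sum]
    refine mul_le_mul_of_nonneg_left ?_ (hW y hy)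
    -- At most one ball contains `y`. Its center is at distance at least `R (p i)` from the center
    -- serving `y`, so the contribution of `y` to its value is paid for by the distance of `y` to
    -- the latter.
    by_cases hex : ∃ i, d (c i (p i)) y < R (p i)
    · obtain ⟨i, hi⟩ := hex
      rw [Finset.sum_eq_single i]
      · refine max_le ?_ (hd.nonneg _ hy _ (hX _))
        have h1 : ¬ d (X (asg y)) (c i (p i)) < R (p i) := fun hh =>
          hncov i (p i) le_rfl (hpL i) (.inl ⟨_, hh⟩)
        have h2 := hd.tri _ (hX (asg y)) _ hy _ (hpb i)
        have h3 := hd.symm _ hy _ (hpb i)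
        have h4 := hd.symm _ hy _ (hX (asg y))
        linarith
      · intro i' _ hne
        refine max_eq_right ?_
        by_contra! hh
        rcases lt_or_gt_of_ne hne with hl | hl
        · exact hdisj i' i hl y hy (by linarith) hi
        · exact hdisj i i' hl y hy hi (by linarith)
      · simp
    · push Not at hex
      rw [Finset.sum_eq_zero fun i _ => max_eq_right (by linarith [hex i])]
      exact hd.nonneg _ hy _ (hX _)

/-- The greedy algorithm computes a constant-factor approximation. -/
theorem greedyCenters_cost_le (hd : PseudoMetricOn b d) (hR : Scales b L d R)
    (hW : ∀ x < b, 0 ≤ W x) {z : ℕ → ℕ} (hz : GreedyCenters b L d R W z k) {lev : ℕ → ℕ}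
    (hlev : IsolationLevel b L d R z k lev) (hzb : ∀ i < k, z i < b) {near : ℕ → ℕ}
    (hnear : ∀ y < b, ∀ i < k, d y (z (near y)) ≤ d y (z i))
    (X : Fin k → ℕ) (hX : ∀ e, X e < b) (asg : ℕ → Fin k) :
    ∑ y ∈ Finset.range b, W y * d y (z (near y)) ≤
      121 * ∑ y ∈ Finset.range b, W y * d y (X (asg y)) := by
  -- Some center lies within `60 * R (lev x)` of `x`, because the ball one level up is not isolated.
  -- Then `60 * R + d = 60 * (R - d) + 61 * d`; the first term sums to at most 60 times the cost,
  -- whence `121 = 60 + 61`.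
  have hpt : ∀ y < b, d y (z (near y)) ≤
      60 * max (R (lev (X (asg y))) - d (X (asg y)) y) 0 + 61 * d y (X (asg y)) := by
    intro y hy
    set x := X (asg y)
    have hxb : x < b := hX _
    obtain ⟨i, hi, hxz⟩ : ∃ i < k, d x (z i) ≤ 60 * R (lev x) := by
      obtain ⟨h1, -, h3⟩ := hlev x hxb
      rcases Nat.eq_zero_or_pos (lev x) with h0 | h0
      · have hk : 0 < k := (asg y).pos
        refine ⟨0, hk, ?_⟩
        rw [h0]
        have h4 := hR.diam _ hxb _ (hzb 0 hk)
        have h5 := hR.nonneg 0 (by omega)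
        linarith
      · obtain ⟨h, hh, h4⟩ := h3.resolve_left (by omega)
        refine ⟨h, hh, ?_⟩
        -- The last radius is 0 and not half of its predecessor. There `sep` gives distance 0
        -- instead.
        rcases Nat.lt_or_ge L (lev x) with hL | hL
        · have hL' : lev x = L + 1 := by omega
          rw [hL', Nat.add_sub_cancel] at h4
          rw [hR.sep _ hxb _ (hzb h hh) h4, hL', hR.last, mul_zero]
        · have h5 := hR.half (lev x - 1) (by omega)
          rw [Nat.sub_add_cancel h0] at h5
          linarith
    have h1 := hnear y hy i hi
    have h2 := hd.tri _ hy _ hxb _ (hzb i hi)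
    have h3 := hd.symm _ hy _ hxb
    have h4 := le_max_left (R (lev x) - d x y) 0
    linarith
  have h1 := sum_ballValue_le hd hR hW hz hlev X hX asg
  calc ∑ y ∈ Finset.range b, W y * d y (z (near y))
      ≤ ∑ y ∈ Finset.range b, (60 * ∑ e, W y * max (R (lev (X e)) - d (X e) y) 0 +
          61 * (W y * d y (X (asg y)))) := by
        refine Finset.sum_le_sum fun y hy => ?_
        have hy' := Finset.mem_range.1 hy
        have h2 : W y * max (R (lev (X (asg y))) - d (X (asg y)) y) 0 ≤
            ∑ e, W y * max (R (lev (X e)) - d (X e) y) 0 :=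
          Finset.single_le_sum (f := fun e => W y * max (R (lev (X e)) - d (X e) y) 0)
            (fun e _ => mul_nonneg (hW y hy') (le_max_right _ _)) (Finset.mem_univ _)
        have h3 := mul_le_mul_of_nonneg_left (hpt y hy') (hW y hy')
        linarith
    _ = 60 * ∑ e, ballValue b d W (R (lev (X e))) (X e) +
          61 * ∑ y ∈ Finset.range b, W y * d y (X (asg y)) := by
        rw [Finset.sum_add_distrib, ← Finset.mul_sum, ← Finset.mul_sum, Finset.sum_comm]
        rfl
    _ ≤ _ := by linarith

end KMedian

/-! ## The program for one block -/

namespace KMedian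

open RealRAM

/-- The label of the point with index `i` in the current block. -/
abbrev ptE (i : NatExpr) : NatExpr := .get 2 (.add (nvar 5) i)

/-- The distance of two points of the current block. -/
abbrev distE (i j : NatExpr) : RealExpr := .query (ptE i) (ptE j)

/-- The diameter of the block. -/
def diamProg : Prog :=
  .seq (.setReal 3 (.lit 0) (.cast (.lit 0)))
    (forLoop 11 (nvar 6) (forLoop 12 (nvar 6)
      (.ite (realLT (rvar 3) (distE (nvar 11) (nvar 12)))
        (.setReal 3 (.lit 0) (distE (nvar 11) (nvar 12))) .skip)))

/-- The minimum positive distance in the block. -/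
def sepProg : Prog :=
  .seq (.setReal 4 (.lit 0) (rvar 3))
    (forLoop 11 (nvar 6) (forLoop 12 (nvar 6)
      (.ite (.conj (realLT (.cast (.lit 0)) (distE (nvar 11) (nvar 12)))
          (realLT (distE (nvar 11) (nvar 12)) (rvar 4)))
        (.setReal 4 (.lit 0) (distE (nvar 11) (nvar 12))) .skip)))

/-- The radii of all levels. -/
def radiiProg : Prog :=
  .seq (.setNat 8 (.lit 0) (.lit 0)) (.seq (.setReal 5 (.lit 0) (rvar 3))
    (.seq (.loop (realLT (rvar 4) (.mul (.cast (.lit 30)) (.get 5 (nvar 8))))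
        (.seq (.setReal 5 (.add (nvar 8) (.lit 1)) (.div (.get 5 (nvar 8)) (.cast (.lit 2))))
          (incrVar 8)))
      (.setReal 5 (.add (nvar 8) (.lit 1)) (.cast (.lit 0)))))

/-- The cell that holds the value of the ball of level `s` around the point `x`. -/
abbrev valE (s x : NatExpr) : RealExpr := .get 6 (.add (.mul s (nvar 6)) x)

/-- The values of all balls. -/
def valuesProg : Prog :=
  forLoop 13 (.add (nvar 8) (.lit 2)) (forLoop 11 (nvar 6)
    (.seq (.setReal 7 (.lit 0) (.cast (.lit 0)))
      (.seq
        (forLoop 12 (nvar 6)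
          (.ite (realLT (distE (nvar 11) (nvar 12)) (.get 5 (nvar 13)))
            (.setReal 7 (.lit 0) (.add (rvar 7) (.mul (.get 0 (.add (nvar 5) (nvar 12)))
              (.sub (.get 5 (nvar 13)) (distE (nvar 11) (nvar 12)))))) .skip))
        (.setReal 6 (.add (.mul (nvar 13) (nvar 6)) (nvar 11)) (rvar 7)))))

/-- Initially all points have level `0`. -/
def initProg : Prog := forLoop 11 (nvar 6) (.setNat 9 (nvar 11) (.lit 0))

/-- The isolated ball of largest value. -/
def startProg : Prog :=
  .seq (.setNat 15 (.lit 0) (.lit 0)) (forLoop 11 (nvar 6)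
    (.ite (realLT (valE (.get 9 (nvar 15)) (nvar 15)) (valE (.get 9 (nvar 11)) (nvar 11)))
      (.setNat 15 (.lit 0) (nvar 11)) .skip))

/-- The child of largest value of the ball with center `best`. -/
def childProg : Prog :=
  .seq (.setNat 16 (.lit 0) (nvar 15)) (forLoop 11 (nvar 6)
    (.ite (.conj (realLT (distE (nvar 16) (nvar 11)) (.mul (.cast (.lit 2)) (.get 5 (nvar 13))))
        (realLT (valE (.add (nvar 13) (.lit 1)) (nvar 15))
          (valE (.add (nvar 13) (.lit 1)) (nvar 11))))
      (.setNat 15 (.lit 0) (nvar 11)) .skip))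

/-- The descent from an isolated ball to a center. -/
def chainProg : Prog :=
  .seq (.setNat 13 (.lit 0) (.get 9 (nvar 15)))
    (.loop (.natLE (nvar 13) (nvar 8)) (.seq childProg (incrVar 13)))

/-- The update of the levels after the choice of a center. -/
def levelProg : Prog :=
  forLoop 11 (nvar 6)
    (.loop (.conj (.natLE (.get 9 (nvar 11)) (nvar 8))
        (realLT (distE (nvar 11) (nvar 15))
          (.mul (.cast (.lit 30)) (.get 5 (.get 9 (nvar 11))))))
      (.setNat 9 (nvar 11) (.add (.get 9 (nvar 11)) (.lit 1))))

/-- The greedy choice of `k` centers. -/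
def greedyProg : Prog :=
  forLoop 14 (.get 0 (.lit 1)) (.seq startProg (.seq chainProg
    (.seq (.setNat 10 (nvar 14) (nvar 15)) levelProg)))

/-- The center nearest to the point `x`. -/
def nearestProg : Prog :=
  .seq (.setNat 15 (.lit 0) (.lit 0)) (forLoop 14 (.get 0 (.lit 1))
    (.ite (realLT (distE (nvar 11) (.get 10 (nvar 14))) (distE (nvar 11) (.get 10 (nvar 15))))
      (.setNat 15 (.lit 0) (nvar 14)) .skip))

/-- The centers, weighted with the total weights of the points assigned to them, are appended to
the new list. -/
def collectProg : Prog :=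
  .seq
    (forLoop 14 (.get 0 (.lit 1))
      (.seq (.setNat 3 (.add (nvar 4) (nvar 14)) (ptE (.get 10 (nvar 14))))
        (.setReal 2 (.add (nvar 4) (nvar 14)) (.cast (.lit 0)))))
    (forLoop 11 (nvar 6) (.seq nearestProg
      (.setReal 2 (.add (nvar 4) (nvar 15))
        (.add (.get 2 (.add (nvar 4) (nvar 15))) (.get 0 (.add (nvar 5) (nvar 11)))))))

/-- The program for one block. -/
def blockProg : Prog :=
  .seq diamProg (.seq sepProg (.seq radiiProg (.seq valuesProg (.seq initProg
    (.seq greedyProg collectProg)))))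

/-- The description of the current block in the memory. -/
structure Block (pos b k : ℕ) (P : ℕ → ℕ) (W : ℕ → ℝ) (s : State) : Prop where
  pos : s.nats 5 0 = pos
  size : s.nats 6 0 = b
  centers : s.nats 0 1 = k
  labels : s.nats 2 = P
  weights : s.reals 0 = W

theorem Block.of_frame {pos b k : ℕ} {P : ℕ → ℕ} {W : ℕ → ℝ} {s s' : State} {Pr : Prog}
    (h : Block pos b k P W s) (hf : Pr.Frame s s')
    (hn : ∀ a ∈ [0, 2, 5, 6], a ∉ Pr.natArrays) (hr : 0 ∉ Pr.realArrays) :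
    Block pos b k P W s' := by
  constructor
  · rw [hf.nats 5 (hn 5 (by simp)), h.pos]
  · rw [hf.nats 6 (hn 6 (by simp)), h.size]
  · rw [hf.nats 0 (hn 0 (by simp)), h.centers]
  · rw [hf.nats 2 (hn 2 (by simp)), h.labels]
  · rw [hf.reals 0 hr, h.weights]

/-- The distances in the block. -/
abbrev blockDist (q : ℕ → ℕ → ℝ) (pos : ℕ) (P : ℕ → ℕ) (x y : ℕ) : ℝ :=
  q (P (pos + x)) (P (pos + y))

end KMedian

/-! ### Correctness of the distance scales and of the table of ball values -/

namespace KMedian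

open RealRAM

variable {q : ℕ → ℕ → ℝ} {pos b k : ℕ} {P : ℕ → ℕ} {W : ℕ → ℝ} {s : State}

theorem diamProg_spec (h : Block pos b k P W s) :
    Tri q diamProg s (1 + (b * (b * (1 + 1 + 2) + 2 + 2) + 2)) fun s' =>
      0 ≤ s'.reals 3 0 ∧ (∀ x < b, ∀ y < b, blockDist q pos P x y ≤ s'.reals 3 0) ∧
      (s'.reals 3 0 = 0 ∨ ∃ x < b, ∃ y < b, s'.reals 3 0 = blockDist q pos P x y) := by
  refine Tri.seq (Q := fun s' => s'.reals 3 0 = 0)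
    (Tri.setReal (by simp [RealExpr.val, NatExpr.val])) fun s1 hf1 h1 => ?_
  have hb1 := h.of_frame hf1 (by decide) (by decide)
  refine Tri.forLoop (I := fun x s' => 0 ≤ s'.reals 3 0 ∧
      (∀ x' < x, ∀ y < b, blockDist q pos P x' y ≤ s'.reals 3 0) ∧
      (s'.reals 3 0 = 0 ∨ ∃ x < b, ∃ y < b, s'.reals 3 0 = blockDist q pos P x y)) b
    (by decide) (by simp [h1])
    (fun s' hf => (hb1.of_frame hf (by decide) (by decide)).size) ?_
  intro x hx s2 hf2 hx2 h2
  have hb2 := hb1.of_frame hf2 (by decide) (by decide)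
  refine Tri.mono (Tri.forLoop (I := fun y s' => s'.nats 11 0 = x ∧ 0 ≤ s'.reals 3 0 ∧
      (∀ x' < x, ∀ y < b, blockDist q pos P x' y ≤ s'.reals 3 0) ∧
      (∀ y' < y, blockDist q pos P x y' ≤ s'.reals 3 0) ∧
      (s'.reals 3 0 = 0 ∨ ∃ x < b, ∃ y < b, s'.reals 3 0 = blockDist q pos P x y)) b
    (by decide) (by simpa [hx2] using h2)
    (fun s' hf => (hb2.of_frame hf (by decide) (by decide)).size) ?_) le_rfl ?_
  · intro y hy s3 hf3 hy3 ⟨hx3, h0, h1, h2, h3⟩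
    have hb3 := hb2.of_frame hf3 (by decide) (by decide)
    refine Tri.ite (N := 1) (fun hb => Tri.setReal ?_) (fun hb => Tri.skip ?_)
    all_goals
      simp only [Test.Holds, RealExpr.val, NatExpr.val, hb3.pos, hb3.labels, hx3, hy3, not_le,
        not_lt] at hb
    · simp only [RealExpr.val, NatExpr.val, hb3.pos, hb3.labels, hx3, hy3]
      refine ⟨by simpa using hx3, ?_⟩
      simp only [State.writeNat_reals, State.writeReal_reals_apply, and_self, if_true]
      refine ⟨h0.trans hb.le, fun x' hx' y' hy' => (h1 x' hx' y' hy').trans hb.le,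
        fun y' hy' => ?_, .inr ⟨x, hx, y, hy, rfl⟩⟩
      rcases Nat.lt_succ_iff_lt_or_eq.1 hy' with h | rfl
      · exact (h2 y' h).trans hb.le
      · exact le_rfl
    · refine ⟨by simpa using hx3, h0, h1, fun y' hy' => ?_, h3⟩
      rcases Nat.lt_succ_iff_lt_or_eq.1 hy' with h | rfl
      · exact h2 y' h
      · exact hb
  · rintro s3 hf3 ⟨hx3, h0, h1, h2, h3⟩
    refine ⟨h0, fun x' hx' => ?_, h3⟩
    rcases Nat.lt_succ_iff_lt_or_eq.1 hx' with h | rfl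
    · exact h1 x' h
    · exact h2

/-- The diameter serves as the default. In a block without positive distances it is 0, and the loop
for the radii then stops at once. -/
theorem sepProg_spec (h : Block pos b k P W s) :
    Tri q sepProg s (1 + (b * (b * (1 + 1 + 2) + 2 + 2) + 2)) fun s' =>
      (∀ x < b, ∀ y < b, 0 < blockDist q pos P x y → s'.reals 4 0 ≤ blockDist q pos P x y) ∧
      (s'.reals 4 0 = s.reals 3 0 ∨ ∃ x < b, ∃ y < b, 0 < blockDist q pos P x y ∧
        s'.reals 4 0 = blockDist q pos P x y) := by
  refine Tri.seq (Q := fun s' => s'.reals 4 0 = s.reals 3 0)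
    (Tri.setReal (by simp [RealExpr.val, NatExpr.val])) fun s1 hf1 h1 => ?_
  have hb1 := h.of_frame hf1 (by decide) (by decide)
  refine Tri.forLoop (I := fun x s' =>
      (∀ x' < x, ∀ y < b, 0 < blockDist q pos P x' y → s'.reals 4 0 ≤ blockDist q pos P x' y) ∧
      (s'.reals 4 0 = s.reals 3 0 ∨ ∃ x < b, ∃ y < b, 0 < blockDist q pos P x y ∧
        s'.reals 4 0 = blockDist q pos P x y)) b
    (by decide) (by simp [h1])
    (fun s' hf => (hb1.of_frame hf (by decide) (by decide)).size) ?_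
  intro x hx s2 hf2 hx2 h2
  have hb2 := hb1.of_frame hf2 (by decide) (by decide)
  refine Tri.mono (Tri.forLoop (I := fun y s' => s'.nats 11 0 = x ∧
      (∀ x' < x, ∀ y < b, 0 < blockDist q pos P x' y → s'.reals 4 0 ≤ blockDist q pos P x' y) ∧
      (∀ y' < y, 0 < blockDist q pos P x y' → s'.reals 4 0 ≤ blockDist q pos P x y') ∧
      (s'.reals 4 0 = s.reals 3 0 ∨ ∃ x < b, ∃ y < b, 0 < blockDist q pos P x y ∧
        s'.reals 4 0 = blockDist q pos P x y)) b
    (by decide) (by simpa [hx2] using h2)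
    (fun s' hf => (hb2.of_frame hf (by decide) (by decide)).size) ?_) le_rfl ?_
  · intro y hy s3 hf3 hy3 ⟨hx3, h1, h2, h3⟩
    have hb3 := hb2.of_frame hf3 (by decide) (by decide)
    refine Tri.ite (N := 1) (fun hb => Tri.setReal ?_) (fun hb => Tri.skip ?_)
    all_goals
      simp only [Test.Holds, RealExpr.val, NatExpr.val, hb3.pos, hb3.labels, hx3, hy3, not_le,
        Nat.cast_zero] at hb
    · simp only [RealExpr.val, NatExpr.val, hb3.pos, hb3.labels, hx3, hy3]
      refine ⟨by simpa using hx3, ?_⟩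
      simp only [State.writeNat_reals, State.writeReal_reals_apply, and_self, if_true]
      refine ⟨fun x' hx' y' hy' hp => hb.2.le.trans (h1 x' hx' y' hy' hp),
        fun y' hy' hp => ?_, .inr ⟨x, hx, y, hy, hb.1, rfl⟩⟩
      rcases Nat.lt_succ_iff_lt_or_eq.1 hy' with h | rfl
      · exact hb.2.le.trans (h2 y' h hp)
      · exact le_rfl
    · refine ⟨by simpa using hx3, h1, fun y' hy' hp => ?_, h3⟩
      rcases Nat.lt_succ_iff_lt_or_eq.1 hy' with h | rfl
      · exact h2 y' h hp
      · exact not_lt.1 fun hlt => hb ⟨hp, hlt⟩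
  · rintro s3 hf3 ⟨hx3, h1, h2, h3⟩
    refine ⟨fun x' hx' => ?_, h3⟩
    rcases Nat.lt_succ_iff_lt_or_eq.1 hx' with h | rfl
    · exact h1 x' h
    · exact h2

/-- After `i` halvings the radius is `D / 2 ^ i`, so the test `δ < 30 * (D / 2 ^ i)` fails by `i =
Lm`. The bound `hLm` is written without division because `δ` is 0 when all points of the block
coincide. -/
theorem radiiProg_spec {D δ : ℝ} {Lm : ℕ} (hD : s.reals 3 0 = D) (hδ : s.reals 4 0 = δ)
    (hD0 : 0 ≤ D) (hδ0 : 0 ≤ δ) (hLm : 30 * D ≤ 2 ^ Lm * δ) :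
    Tri q radiiProg s (1 + (1 + ((Lm * (1 + 1 + 1) + 1) + 1))) fun s' =>
      ∃ L ≤ Lm, s'.nats 8 0 = L ∧ s'.reals 5 0 = D ∧ (∀ i ≤ L, 0 ≤ s'.reals 5 i) ∧
        (∀ i < L, s'.reals 5 i = 2 * s'.reals 5 (i + 1)) ∧ s'.reals 5 (L + 1) = 0 ∧
        30 * s'.reals 5 L ≤ δ := by
  refine Tri.seq (Q := fun s' => s'.nats 8 0 = 0)
    (Tri.setNat (by simp [NatExpr.val])) fun s1 hf1 h1 => ?_
  refine Tri.seq (Q := fun s' => s'.nats 8 0 = 0 ∧ s'.reals 5 0 = D)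
    (Tri.setReal (by simp [h1, NatExpr.val, RealExpr.val, hf1.reals 3 (by decide), hD]))
    fun s2 hf2 h2 => ?_
  have hδ2 : s2.reals 4 0 = δ := by rw [hf2.reals 4 (by decide), hf1.reals 4 (by decide), hδ]
  refine Tri.seq (Q := fun s' => ∃ L ≤ Lm, s'.nats 8 0 = L ∧ s'.reals 5 0 = D ∧
      (∀ i ≤ L, s'.reals 5 i = D / 2 ^ i) ∧ 30 * s'.reals 5 L ≤ δ)
    (Tri.mono (Tri.loop (I := fun L s' => s'.nats 8 0 = L ∧ s'.reals 5 0 = D ∧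
      (∀ i ≤ L, s'.reals 5 i = D / 2 ^ i)) Lm ⟨h2.1, h2.2, by simp [h2.2]⟩ ?_) le_rfl ?_) ?_
  · rintro i s3 hf3 ⟨h8, h50, h5⟩ hb
    have hδ3 : s3.reals 4 0 = δ := by rw [hf3.reals 4 (by decide), hδ2]
    simp only [Test.Holds, RealExpr.val, NatExpr.val, h8, hδ3, not_le, h5 i le_rfl] at hb
    refine ⟨?_, ?_⟩
    · by_contra! hle
      have h3 : (2 : ℝ) ^ Lm ≤ 2 ^ i := pow_le_pow_right₀ (by norm_num) hle
      have h4 : 30 * D ≤ 2 ^ i * δ := hLm.trans (mul_le_mul_of_nonneg_right h3 hδ0)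
      have h5 : (30 : ℝ) * (D / 2 ^ i) ≤ δ := by
        rw [← mul_div_assoc, div_le_iff₀ (by positivity)]
        linarith
      push_cast at hb
      linarith
    · refine Tri.mono (Tri.seq (N := 1) (N' := 1) (Q := fun s' => s'.nats 8 0 = i ∧
        (∀ j ≤ i + 1, s'.reals 5 j = D / 2 ^ j)) (Tri.setReal ⟨by simpa using h8, ?_⟩)
        fun s4 hf4 h4 => Tri.setNat ?_) le_rfl fun _ _ h => h
      · intro j hj
        simp only [State.writeReal_reals_apply, RealExpr.val, NatExpr.val, h8, true_and,
          h5 i le_rfl]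
        split_ifs with hji
        · rw [hji, pow_succ]
          push_cast
          field_simp
        · exact h5 j (by omega)
      · refine ⟨by simp [NatExpr.val, h4.1], ?_, h4.2⟩
        simpa using h4.2 0 (by omega)
  · rintro s3 hf3 ⟨hb, i, hi, h8, h50, h5⟩
    have hδ3 : s3.reals 4 0 = δ := by rw [hf3.reals 4 (by decide), hδ2]
    refine ⟨i, hi, h8, h50, h5, ?_⟩
    simpa [Test.Holds, RealExpr.val, NatExpr.val, h8, hδ3] using hb
  · rintro s3 hf3 ⟨L, hL, h8, h50, h5, hle⟩
    refine Tri.setReal ⟨L, hL, by simpa using h8, ?_⟩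
    simp only [State.writeReal_reals_apply, RealExpr.val, NatExpr.val, h8, true_and]
    refine ⟨by simpa using h50, fun i hi => ?_, fun i hi => ?_, by simp, by simpa using hle⟩
    · rw [if_neg (by omega), h5 i hi]
      positivity
    · rw [if_neg (by omega), if_neg (by omega), h5 i (by omega), h5 (i + 1) (by omega), pow_succ]
      field_simp

theorem valuesProg_spec (h : Block pos b k P W s) {L : ℕ} (hL : s.nats 8 0 = L) {R : ℕ → ℝ}
    (hR : s.reals 5 = R) :
    Tri q valuesProg s ((L + 2) * (b * (1 + ((b * (1 + 1 + 2) + 2) + 1) + 2) + 2 + 2) + 2)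
      fun s' => ∀ i < L + 2, ∀ x < b, s'.reals 6 (i * b + x) =
        ballValue b (blockDist q pos P) (fun y => W (pos + y)) (R i) x := by
  refine Tri.forLoop (I := fun j s' => ∀ i < j, ∀ x < b, s'.reals 6 (i * b + x) =
        ballValue b (blockDist q pos P) (fun y => W (pos + y)) (R i) x) (L + 2)
    (by decide) (by simp)
    (fun s' hf => by simp [NatExpr.val, hf.nats 8 (by decide), hL]) ?_
  intro i hi s1 hf1 hi1 h1
  have hb1 := h.of_frame hf1 (by decide) (by decide)
  refine Tri.mono (Tri.forLoop (I := fun x s' => s'.nats 13 0 = i ∧ (∀ i' < i, ∀ x < b,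
      s'.reals 6 (i' * b + x) =
        ballValue b (blockDist q pos P) (fun y => W (pos + y)) (R i') x) ∧
      ∀ x' < x, s'.reals 6 (i * b + x') =
        ballValue b (blockDist q pos P) (fun y => W (pos + y)) (R i) x') b
    (by decide) (by simpa [hi1] using h1)
    (fun s' hf => (hb1.of_frame hf (by decide) (by decide)).size) ?_) le_rfl ?_
  swap
  · rintro s' hf ⟨-, h2, h3⟩ i' hi' x hx
    rcases Nat.lt_succ_iff_lt_or_eq.1 hi' with h | rfl
    · exact h2 i' h x hx
    · exact h3 x hx
  rintro x hx s2 hf2 hx2 ⟨hi2, h2, h2'⟩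
  have hb2 := hb1.of_frame hf2 (by decide) (by decide)
  have hR2 : s2.reals 5 = R := by rw [hf2.reals 5 (by decide), hf1.reals 5 (by decide), hR]
  refine Tri.seq (Q := fun s' => s'.reals 7 0 = 0)
    (Tri.setReal (by simp [RealExpr.val, NatExpr.val])) fun s3 hf3 h3 => ?_
  have hb3 := hb2.of_frame hf3 (by decide) (by decide)
  refine Tri.seq (Q := fun s' => s'.reals 7 0 = ∑ y' ∈ Finset.range b, W (pos + y') *
      max (R i - blockDist q pos P x y') 0) (Tri.forLoop (I := fun y s' =>
      s'.reals 7 0 = ∑ y' ∈ Finset.range y, W (pos + y') *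
        max (R i - blockDist q pos P x y') 0) b (by decide) (by simp [h3])
    (fun s' hf => (hb3.of_frame hf (by decide) (by decide)).size) ?_) ?_
  · intro y hy s4 hf4 hy4 h4
    have hb4 := hb3.of_frame hf4 (by decide) (by decide)
    have hx4 : s4.nats 11 0 = x := by
      rw [hf4.nats 11 (by decide), hf3.nats 11 (by decide), hx2]
    have hi4 : s4.nats 13 0 = i := by
      rw [hf4.nats 13 (by decide), hf3.nats 13 (by decide), hi2]
    have hR4 : s4.reals 5 = R := by rw [hf4.reals 5 (by decide), hf3.reals 5 (by decide), hR2]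
    refine Tri.ite (N := 1) (fun hb => Tri.setReal ?_) (fun hb => Tri.skip ?_)
    all_goals
      simp only [Test.Holds, RealExpr.val, NatExpr.val, hb4.pos, hb4.labels, hx4, hy4, hi4, hR4,
        not_le, not_lt] at hb
      rw [Finset.sum_range_succ]
    · simp only [RealExpr.val, NatExpr.val, hb4.pos, hb4.labels, hb4.weights, hx4, hy4, hi4, hR4,
        h4, State.writeNat_reals, State.writeReal_reals_apply, and_self, if_true]
      rw [max_eq_left]
      linarith
    · rw [max_eq_right (by linarith)]
      simpa using h4
  · intro s4 hf4 h4
    have hb4 := hb3.of_frame hf4 (by decide) (by decide)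
    have hx4 : s4.nats 11 0 = x := by
      rw [hf4.nats 11 (by decide), hf3.nats 11 (by decide), hx2]
    have hi4 : s4.nats 13 0 = i := by
      rw [hf4.nats 13 (by decide), hf3.nats 13 (by decide), hi2]
    have h64 : s4.reals 6 = s2.reals 6 := by
      rw [hf4.reals 6 (by decide), hf3.reals 6 (by decide)]
    refine Tri.setReal ?_
    refine ⟨by simpa using hi4, ?_⟩
    simp only [RealExpr.val, NatExpr.val, hb4.size, hx4, hi4, State.writeNat_reals,
      State.writeReal_reals_apply, true_and, h4, h64]
    refine ⟨fun i' hi' x' hx' => ?_, fun x' hx' => ?_⟩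
    · rw [if_neg, h2 i' hi' x' hx']
      -- The cells of the earlier levels all lie below `i * b`.
      have : (i' + 1) * b ≤ i * b := Nat.mul_le_mul_right _ hi'
      rw [Nat.succ_mul] at this
      omega
    · rcases Nat.lt_succ_iff_lt_or_eq.1 hx' with h | rfl
      · rw [if_neg (by omega), h2' x' h]
      · rw [if_pos rfl]
        rfl

theorem initProg_spec (h : Block pos b k P W s) :
    Tri q initProg s (b * (1 + 2) + 2) fun s' => ∀ x < b, s'.nats 9 x = 0 := by
  refine Tri.forLoop (I := fun x s' => ∀ x' < x, s'.nats 9 x' = 0) b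
    (by decide) (by simp) (fun s' hf => (h.of_frame hf (by decide) (by decide)).size) ?_
  intro x hx s1 hf1 hx1 h1
  refine Tri.setNat fun x' hx' => ?_
  simp only [State.writeNat_nats_apply, NatExpr.val, hx1]
  rcases Nat.lt_succ_iff_lt_or_eq.1 hx' with h | rfl
  · simp [h1 x' h]
  · simp

end KMedian

/-! ### Correctness of the greedy choice of centers -/

namespace KMedian

open RealRAM

/-- The radii and the ball values are stored in the memory. -/
structure Tables (b L : ℕ) (d : ℕ → ℕ → ℝ) (R W : ℕ → ℝ) (s : State) : Prop where
  levels : s.nats 8 0 = L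
  radii : s.reals 5 = R
  values : ∀ i < L + 2, ∀ x < b, s.reals 6 (i * b + x) = ballValue b d W (R i) x

theorem Tables.of_frame {b L : ℕ} {d : ℕ → ℕ → ℝ} {R W : ℕ → ℝ} {s s' : State} {Pr : Prog}
    (h : Tables b L d R W s) (hf : Pr.Frame s s')
    (hn : 8 ∉ Pr.natArrays) (hr : ∀ a ∈ [5, 6], a ∉ Pr.realArrays) :
    Tables b L d R W s' := by
  constructor
  · rw [hf.nats 8 hn, h.levels]
  · rw [hf.reals 5 (hr 5 (by simp)), h.radii]
  · rw [hf.reals 6 (hr 6 (by simp))]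
    exact h.values

variable {q : ℕ → ℕ → ℝ} {pos b k L : ℕ} {P : ℕ → ℕ} {W R V : ℕ → ℝ} {s : State}

theorem startProg_spec (h : Block pos b k P W s) (hb : 0 < b)
    (ht : Tables b L (blockDist q pos P) R V s) (hlev : ∀ x < b, s.nats 9 x ≤ L + 1) :
    Tri q startProg s (1 + (b * (1 + 1 + 2) + 2)) fun s' => s'.nats 15 0 < b ∧
      ∀ x < b, ballValue b (blockDist q pos P) V (R (s.nats 9 x)) x ≤
        ballValue b (blockDist q pos P) V (R (s.nats 9 (s'.nats 15 0))) (s'.nats 15 0) := by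
  refine Tri.seq (Q := fun s' => s'.nats 15 0 = 0)
    (Tri.setNat (by simp [NatExpr.val])) fun s1 hf1 h1 => ?_
  have hb1 := h.of_frame hf1 (by decide) (by decide)
  have ht1 := ht.of_frame hf1 (by decide) (by decide)
  refine Tri.forLoop (I := fun y s' => s'.nats 15 0 < b ∧
      ∀ x < y, ballValue b (blockDist q pos P) V (R (s.nats 9 x)) x ≤
        ballValue b (blockDist q pos P) V (R (s.nats 9 (s'.nats 15 0))) (s'.nats 15 0)) b
    (by decide) (by simp [h1, hb])
    (fun s' hf => (hb1.of_frame hf (by decide) (by decide)).size) ?_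
  rintro y hy s2 hf2 hy2 ⟨hlt, h2⟩
  have hb2 := hb1.of_frame hf2 (by decide) (by decide)
  have ht2 := ht1.of_frame hf2 (by decide) (by decide)
  have h9 : s2.nats 9 = s.nats 9 := by rw [hf2.nats 9 (by decide), hf1.nats 9 (by decide)]
  have e1 := ht2.values (s.nats 9 y) (by have := hlev y hy; omega) y hy
  have e2 := ht2.values (s.nats 9 (s2.nats 15 0)) (by have := hlev _ hlt; omega) _ hlt
  refine Tri.ite (N := 1) (fun hb => Tri.setNat ?_) (fun hb => Tri.skip ?_)
  all_goals
    simp only [Test.Holds, RealExpr.val, NatExpr.val, hb2.size, hy2, h9, e1, e2, not_le] at hb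
  · simp only [NatExpr.val, State.writeNat_nats_apply, hy2, and_true, if_true, reduceIte,
      Nat.reduceEqDiff]
    refine ⟨hy, fun x hx => ?_⟩
    rcases Nat.lt_succ_iff_lt_or_eq.1 hx with h | rfl
    · exact (h2 x h).trans hb.le
    · exact le_rfl
  · simp only [State.writeNat_nats_apply, Nat.reduceEqDiff, false_and, if_false]
    refine ⟨hlt, fun x hx => ?_⟩
    rcases Nat.lt_succ_iff_lt_or_eq.1 hx with h | rfl
    · exact h2 x h
    · exact not_lt.1 hb

/-- The search starts from the parent itself, whose distance 0 need not be strictly below `2 * R j`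
when the radius is 0. Hence the chosen child satisfies a weak inequality, whereas it competes only
with points satisfying the strict one. -/
theorem childProg_spec (h : Block pos b k P W s) (ht : Tables b L (blockDist q pos P) R V s)
    {c j : ℕ} (hc : c < b) (hcs : s.nats 15 0 = c) (hj : j ≤ L) (hjs : s.nats 13 0 = j)
    (hself : blockDist q pos P c c ≤ 2 * R j) :
    Tri q childProg s (1 + (b * (1 + 1 + 2) + 2)) fun s' => s'.nats 15 0 < b ∧
      blockDist q pos P c (s'.nats 15 0) ≤ 2 * R j ∧
      ∀ y < b, blockDist q pos P c y < 2 * R j → ballValue b (blockDist q pos P) V (R (j + 1)) y ≤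
        ballValue b (blockDist q pos P) V (R (j + 1)) (s'.nats 15 0) := by
  refine Tri.seq (Q := fun s' => s'.nats 15 0 = c ∧ s'.nats 16 0 = c)
    (Tri.setNat (by simp [NatExpr.val, hcs])) fun s1 hf1 h1 => ?_
  have hb1 := h.of_frame hf1 (by decide) (by decide)
  have ht1 := ht.of_frame hf1 (by decide) (by decide)
  refine Tri.forLoop (I := fun x s' => s'.nats 15 0 < b ∧
      blockDist q pos P c (s'.nats 15 0) ≤ 2 * R j ∧
      ∀ y < x, blockDist q pos P c y < 2 * R j → ballValue b (blockDist q pos P) V (R (j + 1)) y ≤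
        ballValue b (blockDist q pos P) V (R (j + 1)) (s'.nats 15 0)) b
    (by decide) (by simp [h1.1, hc, hself])
    (fun s' hf => (hb1.of_frame hf (by decide) (by decide)).size) ?_
  rintro y hy s2 hf2 hy2 ⟨hlt, hd2, h2⟩
  have hb2 := hb1.of_frame hf2 (by decide) (by decide)
  have ht2 := ht1.of_frame hf2 (by decide) (by decide)
  have h16 : s2.nats 16 0 = c := by rw [hf2.nats 16 (by decide), h1.2]
  have h13 : s2.nats 13 0 = j := by rw [hf2.nats 13 (by decide), hf1.nats 13 (by decide), hjs]
  have e1 := ht2.values (j + 1) (by omega) y hy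
  have e2 := ht2.values (j + 1) (by omega) _ hlt
  refine Tri.ite (N := 1) (fun hb => Tri.setNat ?_) (fun hb => Tri.skip ?_)
  all_goals
    simp only [Test.Holds, RealExpr.val, NatExpr.val, hb2.size, hb2.pos, hb2.labels, hy2, h16, h13,
      ht2.radii, e1, e2, not_le, Nat.cast_ofNat] at hb
  · simp only [NatExpr.val, State.writeNat_nats_apply, hy2, and_true, if_true, reduceIte,
      Nat.reduceEqDiff]
    refine ⟨hy, hb.1.le, fun x hx hxd => ?_⟩
    rcases Nat.lt_succ_iff_lt_or_eq.1 hx with h | rfl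
    · exact (h2 x h hxd).trans hb.2.le
    · exact le_rfl
  · simp only [State.writeNat_nats_apply, Nat.reduceEqDiff, false_and, if_false]
    refine ⟨hlt, hd2, fun x hx hxd => ?_⟩
    rcases Nat.lt_succ_iff_lt_or_eq.1 hx with h | rfl
    · exact h2 x h hxd
    · exact not_lt.1 fun hh => hb ⟨hxd, hh⟩

theorem GreedyChain.extend {d : ℕ → ℕ → ℝ} {lev : ℕ → ℕ} {x₀ j c' : ℕ} {c : ℕ → ℕ}
    (h : GreedyChain b L d R W lev x₀ j c) (hj : lev x₀ ≤ j) (hc' : c' < b)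
    (hd : d (c j) c' ≤ 2 * R j) (hmax : ∀ y < b, d (c j) y < 2 * R j →
      ballValue b d W (R (j + 1)) y ≤ ballValue b d W (R (j + 1)) c') :
    GreedyChain b L d R W lev x₀ (j + 1) (Function.update c (j + 1) c') where
  start_lt := h.start_lt
  start := by rw [Function.update_of_ne (by omega), h.start]
  start_max := h.start_max
  lt i hi hij := by
    rcases Nat.lt_succ_iff_lt_or_eq.1 hij with hlt | rfl
    · rw [Function.update_of_ne (by omega)]
      exact h.lt i hi hlt
    · rwa [Function.update_self]
  dist_le i hi hij := by
    rw [Function.update_of_ne (a := i) (by omega)]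
    rcases Nat.lt_succ_iff_lt_or_eq.1 hij with hlt | rfl
    · rw [Function.update_of_ne (by omega)]
      exact h.dist_le i hi hlt
    · rwa [Function.update_self]
  child_max i hi hij := by
    rw [Function.update_of_ne (a := i) (by omega)]
    rcases Nat.lt_succ_iff_lt_or_eq.1 hij with hlt | rfl
    · rw [Function.update_of_ne (by omega)]
      exact h.child_max i hi hlt
    · rwa [Function.update_self]

theorem chainProg_spec (h : Block pos b k P W s) (ht : Tables b L (blockDist q pos P) R V s)
    (hself : ∀ x < b, ∀ j ≤ L, blockDist q pos P x x ≤ 2 * R j)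
    {x₀ : ℕ} (hx₀ : x₀ < b) (hxs : s.nats 15 0 = x₀) (hlev : s.nats 9 x₀ ≤ L + 1)
    (hmax : ∀ x < b, ballValue b (blockDist q pos P) V (R (s.nats 9 x)) x ≤
        ballValue b (blockDist q pos P) V (R (s.nats 9 x₀)) x₀) :
    Tri q chainProg s (1 + ((L + 1) * (1 + (b * (1 + 1 + 2) + 2) + 1 + 1) + 1)) fun s' =>
      s'.nats 15 0 < b ∧ ∃ c, GreedyChain b L (blockDist q pos P) R V (s.nats 9) x₀ (L + 1) c ∧
        c (L + 1) = s'.nats 15 0 := by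
  refine Tri.seq (Q := fun s' => s'.nats 15 0 = x₀ ∧ s'.nats 13 0 = s.nats 9 x₀)
    (Tri.setNat (by simp [NatExpr.val, hxs])) fun s1 hf1 h1 => ?_
  have hb1 := h.of_frame hf1 (by decide) (by decide)
  have ht1 := ht.of_frame hf1 (by decide) (by decide)
  refine Tri.mono (Tri.loop (I := fun i s' => s'.nats 13 0 = s.nats 9 x₀ + i ∧
    s.nats 9 x₀ + i ≤ L + 1 ∧ s'.nats 15 0 < b ∧
    ∃ c, GreedyChain b L (blockDist q pos P) R V (s.nats 9) x₀ (s.nats 9 x₀ + i) c ∧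
        c (s.nats 9 x₀ + i) = s'.nats 15 0) (L + 1) ?_ ?_) le_rfl ?_
  -- A chain of one point satisfies its conditions on steps vacuously. If its level is already `L +
  -- 1`, the loop is skipped and the point becomes the center.
  · refine ⟨h1.2, hlev, h1.1 ▸ hx₀, fun _ => x₀, ⟨hx₀, rfl, hmax, ?_, ?_, ?_⟩, h1.1.symm⟩
    all_goals intros; omega
  · rintro i s2 hf2 ⟨h13, hi, h15, c, hc, hcz⟩ hb
    have hb2 := hb1.of_frame hf2 (by decide) (by decide)
    have ht2 := ht1.of_frame hf2 (by decide) (by decide)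
    simp only [Test.Holds, NatExpr.val, h13, ht2.levels] at hb
    refine ⟨by omega, Tri.seq (childProg_spec hb2 ht2 h15 rfl hb h13 (hself _ h15 _ hb))
      fun s3 hf3 h3 => Tri.setNat ?_⟩
    have h13' : s3.nats 13 0 = s.nats 9 x₀ + i := by rw [hf3.nats 13 (by decide), h13]
    simp only [NatExpr.val, h13', State.writeNat_nats_apply, and_self, if_true, Nat.reduceEqDiff,
      false_and, if_false]
    refine ⟨by omega, by omega, h3.1, Function.update c _ _,
      hc.extend (by omega) h3.1 (hcz ▸ h3.2.1) (hcz ▸ h3.2.2), Function.update_self ..⟩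
  · rintro s2 hf2 ⟨hb, i, hi, h13, hi', h15, c, hc, hcz⟩
    have ht2 := ht1.of_frame hf2 (by decide) (by decide)
    simp only [Test.Holds, NatExpr.val, h13, ht2.levels] at hb
    have : s.nats 9 x₀ + i = L + 1 := by omega
    rw [this] at hc hcz
    exact ⟨h15, c, hc, hcz⟩

/-- Levels rise one at a time, and the last raise was triggered because `z` was too close for the
previous level; this is the maximality of the isolated ball. At level `L + 1` the radius is 0, so
isolation needs only nonnegative distances. -/
theorem levelProg_spec (h : Block pos b k P W s) (ht : Tables b L (blockDist q pos P) R V s)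
    (hlev : ∀ x < b, s.nats 9 x ≤ L + 1) (hR : R (L + 1) = 0) {z : ℕ} (hz : s.nats 15 0 = z)
    (hd : ∀ x < b, 0 ≤ blockDist q pos P x z) :
    Tri q levelProg s (b * ((L + 1) * (1 + 1) + 1 + 2) + 2) fun s' => ∀ x < b,
      s.nats 9 x ≤ s'.nats 9 x ∧ s'.nats 9 x ≤ L + 1 ∧
      30 * R (s'.nats 9 x) ≤ blockDist q pos P x z ∧
      (s'.nats 9 x = s.nats 9 x ∨ blockDist q pos P x z < 30 * R (s'.nats 9 x - 1)) := by
  refine Tri.mono (Tri.forLoop (I := fun y s' => (∀ x < y,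
      s.nats 9 x ≤ s'.nats 9 x ∧ s'.nats 9 x ≤ L + 1 ∧
      30 * R (s'.nats 9 x) ≤ blockDist q pos P x z ∧
      (s'.nats 9 x = s.nats 9 x ∨ blockDist q pos P x z < 30 * R (s'.nats 9 x - 1))) ∧
      ∀ x, y ≤ x → s'.nats 9 x = s.nats 9 x) b
    (by decide) (by simp) (fun s' hf => (h.of_frame hf (by decide) (by decide)).size) ?_)
      le_rfl fun _ _ h => h.1
  rintro x hx s1 hf1 hx1 ⟨h1, h1'⟩
  refine Tri.mono (Tri.loop (I := fun i s' => s'.nats 9 x = s.nats 9 x + i ∧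
      s'.nats 9 x ≤ L + 1 ∧ (∀ y, y ≠ x → s'.nats 9 y = s1.nats 9 y) ∧
      (s'.nats 9 x = s.nats 9 x ∨ blockDist q pos P x z < 30 * R (s'.nats 9 x - 1))) (L + 1)
      ⟨by simp [h1' x le_rfl], by rw [h1' x le_rfl]; exact hlev x hx, fun _ _ => rfl,
        .inl (h1' x le_rfl)⟩ ?_) le_rfl ?_
  · rintro i s2 hf2 ⟨h9, hL, hne, hor⟩ hb
    have hf12 := hf1.trans (hf2.mono (Q := levelProg) (by decide) (by decide))
    have hb2 := h.of_frame hf12 (by decide) (by decide)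
    have ht2 := ht.of_frame hf12 (by decide) (by decide)
    have hx2 : s2.nats 11 0 = x := by rw [hf2.nats 11 (by decide), hx1]
    have hz2 : s2.nats 15 0 = z := by rw [hf12.nats 15 (by decide), hz]
    simp only [Test.Holds, RealExpr.val, NatExpr.val, hb2.pos, hb2.labels, hx2, hz2, ht2.levels,
      ht2.radii, not_le, Nat.cast_ofNat] at hb
    refine ⟨by omega, Tri.setNat ?_⟩
    simp only [NatExpr.val, hx2, State.writeNat_nats_apply, true_and, if_true]
    refine ⟨by omega, by omega, fun y hy => by rw [if_neg hy, hne y hy], .inr ?_⟩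
    exact hb.2
  · rintro s2 hf2 ⟨hb, i, hi, h9, hL, hne, hor⟩
    have hf12 := hf1.trans (hf2.mono (Q := levelProg) (by decide) (by decide))
    have hb2 := h.of_frame hf12 (by decide) (by decide)
    have ht2 := ht.of_frame hf12 (by decide) (by decide)
    have hx2 : s2.nats 11 0 = x := by rw [hf2.nats 11 (by decide), hx1]
    have hz2 : s2.nats 15 0 = z := by rw [hf12.nats 15 (by decide), hz]
    simp only [Test.Holds, RealExpr.val, NatExpr.val, hb2.pos, hb2.labels, hx2, hz2, ht2.levels,
      ht2.radii, not_le, Nat.cast_ofNat, not_and, not_lt] at hb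
    simp only [State.writeNat_nats_apply, Nat.reduceEqDiff, false_and, if_false]
    refine ⟨fun y hy => ?_, fun y hy => ?_⟩
    · rcases Nat.lt_succ_iff_lt_or_eq.1 hy with hlt | rfl
      · rw [hne y (by omega)]
        exact h1 y hlt
      · refine ⟨by omega, hL, ?_, hor⟩
        by_cases hle : s2.nats 9 y ≤ L
        · exact hb hle
        · rw [show s2.nats 9 y = L + 1 by omega, hR, mul_zero]
          exact hd y hx
    · rw [hne y (by omega), h1' y (by omega)]

theorem IsolationLevel.congr {d : ℕ → ℕ → ℝ} {z z' : ℕ → ℕ} {i : ℕ} {lev : ℕ → ℕ}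
    (h : IsolationLevel b L d R z i lev) (hz : ∀ h < i, z' h = z h) :
    IsolationLevel b L d R z' i lev := by
  intro x hx
  obtain ⟨h1, h2, h3⟩ := h x hx
  refine ⟨h1, fun j hj => hz j hj ▸ h2 j hj, h3.imp_right ?_⟩
  rintro ⟨j, hj, h⟩
  exact ⟨j, hj, (hz j hj).symm ▸ h⟩

/-- The incrementally maintained levels remain the isolation levels of the growing list of centers.
Isolation from older centers persists because levels only rise. The witness of maximality is the new
center if the level has changed, and the old witness otherwise. -/
theorem greedyProg_spec (h : Block pos b k P W s) (hb : 0 < b)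
    (ht : Tables b L (blockDist q pos P) R V s)
    (hd : PseudoMetricOn b (blockDist q pos P)) (hR : Scales b L (blockDist q pos P) R)
    (hlev : ∀ x < b, s.nats 9 x = 0) :
    Tri q greedyProg s (k * (1 + (b * (1 + 1 + 2) + 2) +
      (1 + ((L + 1) * (1 + (b * (1 + 1 + 2) + 2) + 1 + 1) + 1) +
      (1 + (b * ((L + 1) * (1 + 1) + 1 + 2) + 2))) + 2) + 2) fun s' =>
      GreedyCenters b L (blockDist q pos P) R V (s'.nats 10) k ∧
      (∀ i < k, s'.nats 10 i < b) ∧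
      ∃ lev, IsolationLevel b L (blockDist q pos P) R (s'.nats 10) k lev := by
  refine Tri.mono (Tri.forLoop (I := fun e s' =>
      GreedyCenters b L (blockDist q pos P) R V (s'.nats 10) e ∧ (∀ i < e, s'.nats 10 i < b) ∧
      IsolationLevel b L (blockDist q pos P) R (s'.nats 10) e (s'.nats 9)) k
    (by decide) ?_ (fun s' hf => (h.of_frame hf (by decide) (by decide)).centers) ?_)
    le_rfl fun s' _ h => ⟨h.1, h.2.1, _, h.2.2⟩
  · refine ⟨fun i hi => by omega, fun i hi => by omega, fun x hx => ?_⟩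
    simp only [State.writeNat_nats_apply, Nat.reduceEqDiff, false_and, if_false, hlev x hx]
    exact ⟨by omega, fun i hi => by omega, .inl trivial⟩
  rintro e he s1 hf1 he1 ⟨hc1, hz1, hl1⟩
  have hb1 := h.of_frame hf1 (by decide) (by decide)
  have ht1 := ht.of_frame hf1 (by decide) (by decide)
  refine Tri.seq (startProg_spec hb1 hb ht1 fun x hx => (hl1 x hx).1)
    fun s2 hf2 ⟨hx2, h2⟩ => ?_
  have hb2 := hb1.of_frame hf2 (by decide) (by decide)
  have ht2 := ht1.of_frame hf2 (by decide) (by decide)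
  have h92 : s2.nats 9 = s1.nats 9 := hf2.nats 9 (by decide)
  refine Tri.seq (chainProg_spec hb2 ht2 (fun x hx j hj => by
    rw [hd.self x hx]; exact mul_nonneg (by norm_num) (hR.nonneg j hj)) hx2 rfl
    (by rw [h92]; exact (hl1 _ hx2).1) (by rw [h92]; exact h2)) ?_
  rintro s3 hf3 ⟨hz3, c, hc, hcz⟩
  rw [h92] at hc
  have hb3 := hb2.of_frame hf3 (by decide) (by decide)
  have ht3 := ht2.of_frame hf3 (by decide) (by decide)
  have h93 : s3.nats 9 = s1.nats 9 := by rw [hf3.nats 9 (by decide), h92]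
  have h103 : s3.nats 10 = s1.nats 10 := by rw [hf3.nats 10 (by decide), hf2.nats 10 (by decide)]
  have h143 : s3.nats 14 0 = e := by
    rw [hf3.nats 14 (by decide), hf2.nats 14 (by decide), he1]
  refine Tri.seq (Q := fun s' => s'.nats 10 e = s3.nats 15 0 ∧
      (∀ i < e, s'.nats 10 i = s1.nats 10 i)) (Tri.setNat ?_) fun s4 hf4 h4 => ?_
  · simp only [NatExpr.val, State.writeNat_nats_apply, h143, true_and, if_true, h103]
    exact fun i hi => if_neg (by omega)
  have hb4 := hb3.of_frame hf4 (by decide) (by decide)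
  have ht4 := ht3.of_frame hf4 (by decide) (by decide)
  have h94 : s4.nats 9 = s1.nats 9 := by rw [hf4.nats 9 (by decide), h93]
  have h154 : s4.nats 15 0 = s3.nats 15 0 := by rw [hf4.nats 15 (by decide)]
  refine Tri.mono (levelProg_spec hb4 ht4 (by rw [h94]; exact fun x hx => (hl1 x hx).1)
    hR.last h154 fun x hx => hd.nonneg x hx _ hz3) le_rfl fun s5 hf5 h5 => ?_
  have h105 : s5.nats 10 = s4.nats 10 := hf5.nats 10 (by decide)
  rw [State.writeNat_nats_of_ne _ _ _ _ (by decide), State.writeNat_nats_of_ne _ _ _ _ (by decide),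
    h105]
  rw [h94] at h5
  refine ⟨fun i hi => ?_, fun i hi => ?_, fun x hx => ?_⟩
  · rcases Nat.lt_succ_iff_lt_or_eq.1 hi with hlt | rfl
    · obtain ⟨lev, x₀, c, h1, h2, h3⟩ := hc1 i hlt
      exact ⟨lev, x₀, c, h1.congr fun j hj => h4.2 j (by omega), h2, by rw [h3, h4.2 i hlt]⟩
    · exact ⟨_, _, c, hl1.congr h4.2, hc, by rw [hcz, h4.1]⟩
  · rcases Nat.lt_succ_iff_lt_or_eq.1 hi with hlt | rfl
    · rw [h4.2 i hlt]
      exact hz1 i hlt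
    · rw [h4.1]
      exact hz3
  · obtain ⟨h6, h7, h8, h9⟩ := h5 x hx
    obtain ⟨h10, h11, h12⟩ := hl1 x hx
    refine ⟨h7, fun i hi => ?_, ?_⟩
    · rcases Nat.lt_succ_iff_lt_or_eq.1 hi with hlt | rfl
      · rw [h4.2 i hlt]
        have := hR.anti h6 h7
        linarith [h11 i hlt]
      · rwa [h4.1]
    · rcases h9 with h9 | h9
      · rw [h9]
        refine h12.imp_right ?_
        rintro ⟨i, hi, h⟩
        exact ⟨i, by omega, by rwa [h4.2 i hi]⟩
      · exact .inr ⟨e, by omega, by rwa [h4.1]⟩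

end KMedian

/-! ### Assignment to nearest centers and the specification of a block -/

namespace KMedian

open RealRAM

variable {q : ℕ → ℕ → ℝ} {pos b k n : ℕ} {P : ℕ → ℕ} {W : ℕ → ℝ} {s : State}

theorem nearestProg_spec (h : Block pos b k P W s) (hk : 0 < k) {x : ℕ} (hx : s.nats 11 0 = x) :
    Tri q nearestProg s (1 + (k * (1 + 1 + 2) + 2)) fun s' => s'.nats 15 0 < k ∧
      ∀ e < k, blockDist q pos P x (s.nats 10 (s'.nats 15 0)) ≤
        blockDist q pos P x (s.nats 10 e) := by
  refine Tri.seq (Q := fun s' => s'.nats 15 0 = 0)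
    (Tri.setNat (by simp [NatExpr.val])) fun s1 hf1 h1 => ?_
  have hb1 := h.of_frame hf1 (by decide) (by decide)
  refine Tri.forLoop (I := fun e s' => s'.nats 15 0 < k ∧
      ∀ e' < e, blockDist q pos P x (s.nats 10 (s'.nats 15 0)) ≤
        blockDist q pos P x (s.nats 10 e')) k
    (by decide) (by simp [h1, hk])
    (fun s' hf => (hb1.of_frame hf (by decide) (by decide)).centers) ?_
  rintro e he s2 hf2 he2 ⟨hlt, h2⟩
  have hb2 := hb1.of_frame hf2 (by decide) (by decide)
  have h10 : s2.nats 10 = s.nats 10 := by rw [hf2.nats 10 (by decide), hf1.nats 10 (by decide)]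
  have hx2 : s2.nats 11 0 = x := by rw [hf2.nats 11 (by decide), hf1.nats 11 (by decide), hx]
  refine Tri.ite (N := 1) (fun hb => Tri.setNat ?_) (fun hb => Tri.skip ?_)
  all_goals
    simp only [Test.Holds, RealExpr.val, NatExpr.val, hb2.pos, hb2.labels, hx2, he2, h10,
      not_le] at hb
  · simp only [NatExpr.val, State.writeNat_nats_apply, he2, and_true, if_true, reduceIte,
      Nat.reduceEqDiff]
    refine ⟨he, fun e' he' => ?_⟩
    rcases Nat.lt_succ_iff_lt_or_eq.1 he' with h | rfl
    · exact hb.le.trans (h2 e' h)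
    · exact le_rfl
  · simp only [State.writeNat_nats_apply, Nat.reduceEqDiff, false_and, if_false]
    refine ⟨hlt, fun e' he' => ?_⟩
    rcases Nat.lt_succ_iff_lt_or_eq.1 he' with h | rfl
    · exact h2 e' h
    · exact not_lt.1 hb

theorem collectProg_spec (h : Block pos b k P W s) (hk : 0 < k) {out : ℕ}
    (hout : s.nats 4 0 = out) :
    Tri q collectProg s (k * (1 + 1 + 2) + 2 + (b * (1 + (k * (1 + 1 + 2) + 2) + 1 + 2) + 2))
      fun s' => ∃ asg : ℕ → ℕ, (∀ x < b, asg x < k ∧ ∀ e < k,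
        blockDist q pos P x (s.nats 10 (asg x)) ≤ blockDist q pos P x (s.nats 10 e)) ∧
      (∀ e < k, s'.nats 3 (out + e) = P (pos + s.nats 10 e)) ∧
      (∀ e < k, s'.reals 2 (out + e) =
        ∑ x ∈ Finset.range b, if asg x = e then W (pos + x) else 0) ∧
      ∀ i < out, s'.nats 3 i = s.nats 3 i ∧ s'.reals 2 i = s.reals 2 i := by
  refine Tri.seq (Q := fun s' => (∀ e < k, s'.nats 3 (out + e) = P (pos + s.nats 10 e)) ∧
    (∀ e < k, s'.reals 2 (out + e) = 0) ∧
    ∀ i < out, s'.nats 3 i = s.nats 3 i ∧ s'.reals 2 i = s.reals 2 i)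
    (Tri.forLoop (I := fun k s' => (∀ e < k, s'.nats 3 (out + e) = P (pos + s.nats 10 e)) ∧
      (∀ e < k, s'.reals 2 (out + e) = 0) ∧
      ∀ i < out, s'.nats 3 i = s.nats 3 i ∧ s'.reals 2 i = s.reals 2 i) k
    (by decide) (by simp) (fun s' hf => (h.of_frame hf (by decide) (by decide)).centers) ?_) ?_
  · rintro e he s1 hf1 he1 ⟨h1, h1', h1''⟩
    have hb1 := h.of_frame hf1 (by decide) (by decide)
    have h10 : s1.nats 10 = s.nats 10 := by rw [hf1.nats 10 (by decide)]
    have hout1 : s1.nats 4 0 = out := by rw [hf1.nats 4 (by decide), hout]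
    refine Tri.seq (Q := fun s' => (∀ e' < e + 1, s'.nats 3 (out + e') = P (pos + s.nats 10 e')) ∧
      ∀ i < out, s'.nats 3 i = s.nats 3 i) (Tri.setNat ?_) fun s2 hf2 h2 => Tri.setReal ?_
    · simp only [NatExpr.val, State.writeNat_nats_apply, hout1, he1, hb1.pos, hb1.labels, h10,
        true_and]
      refine ⟨fun e' he' => ?_, fun i hi => ?_⟩
      · rcases Nat.lt_succ_iff_lt_or_eq.1 he' with h | rfl
        · rw [if_neg (by omega), h1 e' h]
        · rw [if_pos rfl]
      · rw [if_neg (by omega), (h1'' i hi).1]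
    · have hout2 : s2.nats 4 0 = out := by rw [hf2.nats 4 (by decide), hout1]
      have he2 : s2.nats 14 0 = e := by rw [hf2.nats 14 (by decide), he1]
      have hr2 : s2.reals 2 = s1.reals 2 := hf2.reals 2 (by decide)
      simp only [NatExpr.val, RealExpr.val, State.writeNat_nats_apply, hout2, he2, true_and,
        State.writeReal_nats, State.writeNat_reals, State.writeReal_reals_apply, Nat.reduceEqDiff,
        false_and, if_false, hr2, Nat.cast_zero]
      refine ⟨h2.1, fun e' he' => ?_, fun i hi => ⟨h2.2 i hi, ?_⟩⟩
      · rcases Nat.lt_succ_iff_lt_or_eq.1 he' with h | rfl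
        · rw [if_neg (by omega), h1' e' h]
        · rw [if_pos rfl]
      · rw [if_neg (by omega), (h1'' i hi).2]
  rintro s1 hf1 ⟨h1, h1', h1''⟩
  have hb1 := h.of_frame hf1 (by decide) (by decide)
  refine Tri.mono (Tri.forLoop (I := fun y s' => ∃ asg : ℕ → ℕ, (∀ x < y, asg x < k ∧ ∀ e < k,
        blockDist q pos P x (s.nats 10 (asg x)) ≤ blockDist q pos P x (s.nats 10 e)) ∧
      (∀ e < k, s'.reals 2 (out + e) =
        ∑ x ∈ Finset.range y, if asg x = e then W (pos + x) else 0) ∧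
      ∀ i < out, s'.reals 2 i = s.reals 2 i) b (by decide)
    ⟨fun _ => 0, by simp, by simpa using h1', fun i hi => by simpa using (h1'' i hi).2⟩
    (fun s' hf => (hb1.of_frame hf (by decide) (by decide)).size) ?_) le_rfl ?_
  · rintro x hx s2 hf2 hx2 ⟨asg, h2, h2', h2''⟩
    have hb2 := hb1.of_frame hf2 (by decide) (by decide)
    have h10 : s2.nats 10 = s.nats 10 := by rw [hf2.nats 10 (by decide), hf1.nats 10 (by decide)]
    have hout2 : s2.nats 4 0 = out := by
      rw [hf2.nats 4 (by decide), hf1.nats 4 (by decide), hout]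
    refine Tri.seq (nearestProg_spec hb2 hk hx2) fun s3 hf3 ⟨h3, h3'⟩ => Tri.setReal ?_
    have hb3 := hb2.of_frame hf3 (by decide) (by decide)
    have hout3 : s3.nats 4 0 = out := by rw [hf3.nats 4 (by decide), hout2]
    have hx3 : s3.nats 11 0 = x := by rw [hf3.nats 11 (by decide), hx2]
    have hr3 : s3.reals 2 = s2.reals 2 := hf3.reals 2 (by decide)
    rw [h10] at h3'
    refine ⟨Function.update asg x (s3.nats 15 0), fun y hy => ?_, ?_⟩
    · rcases Nat.lt_succ_iff_lt_or_eq.1 hy with h | rfl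
      · rw [Function.update_of_ne (by omega)]
        exact h2 y h
      · rw [Function.update_self]
        exact ⟨h3, h3'⟩
    · simp only [NatExpr.val, RealExpr.val, hout3, hx3, hb3.pos, hb3.weights, true_and,
        State.writeNat_reals, State.writeReal_reals_apply, hr3]
      refine ⟨fun e he => ?_, fun i hi => by rw [if_neg (by omega), h2'' i hi]⟩
      have hsum : ∑ y ∈ Finset.range x,
          (if Function.update asg x (s3.nats 15 0) y = e then W (pos + y) else 0) =
          ∑ y ∈ Finset.range x, if asg y = e then W (pos + y) else 0 :=
        Finset.sum_congr rfl fun y hy => by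
          rw [Function.update_of_ne (by have := Finset.mem_range.1 hy; omega)]
      rw [Finset.sum_range_succ, hsum, Function.update_self]
      by_cases hee : s3.nats 15 0 = e
      · rw [if_pos (by omega), if_pos hee, ← h2' e he, hee]
      · rw [if_neg (by omega), if_neg hee, h2' e he, add_zero]
  · rintro s2 hf2 ⟨asg, h2, h2', h2''⟩
    have h3 : s2.nats 3 = s1.nats 3 := hf2.nats 3 (by decide)
    exact ⟨asg, h2, by rwa [h3], h2', fun i hi => ⟨by rw [h3, (h1'' i hi).1], h2'' i hi⟩⟩

/-- A bound for the number of steps of the program for one block. -/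
def blockSteps (b k Lm : ℕ) : ℕ :=
  (1 + (b * (b * (1 + 1 + 2) + 2 + 2) + 2)) + ((1 + (b * (b * (1 + 1 + 2) + 2 + 2) + 2)) +
  ((1 + (1 + ((Lm * (1 + 1 + 1) + 1) + 1))) +
  (((Lm + 2) * (b * (1 + ((b * (1 + 1 + 2) + 2) + 1) + 2) + 2 + 2) + 2) + ((b * (1 + 2) + 2) +
  ((k * (1 + (b * (1 + 1 + 2) + 2) +
      (1 + ((Lm + 1) * (1 + (b * (1 + 1 + 2) + 2) + 1 + 1) + 1) +
      (1 + (b * ((Lm + 1) * (1 + 1) + 1 + 2) + 2))) + 2) + 2) +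
  (k * (1 + 1 + 2) + 2 + (b * (1 + (k * (1 + 1 + 2) + 2) + 1 + 2) + 2)))))))

/-- No relation between `b` and `k` is assumed: in a short last block the centers simply repeat, and
the competitors `X` may repeat too. -/
theorem blockProg_spec (h : Block pos b k P W s) (hk : 0 < k) (hb : 0 < b) {out : ℕ}
    (hout : s.nats 4 0 = out) (hd : PseudoMetricOn b (blockDist q pos P))
    (hW : ∀ x < b, 0 ≤ W (pos + x)) {Lm : ℕ} (hLm : 30 ≤ 2 ^ Lm)
    (hLm' : ∀ x < b, ∀ y < b, ∀ x' < b, ∀ y' < b, 0 < blockDist q pos P x' y' →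
      30 * blockDist q pos P x y ≤ 2 ^ Lm * blockDist q pos P x' y') :
    Tri q blockProg s (blockSteps b k Lm) fun s' => ∃ z asg : ℕ → ℕ, (∀ e < k, z e < b) ∧
      (∀ x < b, asg x < k) ∧
      (∀ e < k, s'.nats 3 (out + e) = P (pos + z e)) ∧
      (∀ e < k, s'.reals 2 (out + e) =
        ∑ x ∈ Finset.range b, if asg x = e then W (pos + x) else 0) ∧
      (∀ (X : Fin k → ℕ) (asg' : ℕ → Fin k), (∀ e, X e < b) →
        ∑ x ∈ Finset.range b, W (pos + x) * blockDist q pos P x (z (asg x)) ≤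
          121 * ∑ x ∈ Finset.range b, W (pos + x) * blockDist q pos P x (X (asg' x))) ∧
      ∀ i < out, s'.nats 3 i = s.nats 3 i ∧ s'.reals 2 i = s.reals 2 i := by
  unfold blockSteps
  refine Tri.seq (diamProg_spec h) fun s1 hf1 ⟨hD0, hD, hD'⟩ => ?_
  have hb1 := h.of_frame hf1 (by decide) (by decide)
  refine Tri.seq (sepProg_spec hb1) fun s2 hf2 ⟨hδ, hδ'⟩ => ?_
  have hb2 := hb1.of_frame hf2 (by decide) (by decide)
  have h32 : s2.reals 3 0 = s1.reals 3 0 := by rw [hf2.reals 3 (by decide)]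
  have hpow : (0 : ℝ) < 2 ^ Lm := by positivity
  have hδ0 : 0 ≤ s2.reals 4 0 := by
    rcases hδ' with h | ⟨x, -, y, -, hp, h⟩
    · rw [h]; exact hD0
    · rw [h]; exact hp.le
  -- If the minimum distance is still the default, it equals the diameter and `30 ≤ 2 ^ Lm`
  -- suffices. Otherwise it is a positive distance and the aspect ratio bound applies.
  have hDδ : 30 * s1.reals 3 0 ≤ 2 ^ Lm * s2.reals 4 0 := by
    rcases hδ' with h | ⟨x, hx, y, hy, hp, h⟩
    · rw [h]
      exact mul_le_mul_of_nonneg_right (by exact_mod_cast hLm) hD0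
    · rw [h]
      rcases hD' with h' | ⟨x', hx', y', hy', h'⟩
      · rw [h']; nlinarith
      · rw [h']; exact hLm' _ hx' _ hy' _ hx _ hy hp
  refine Tri.seq (radiiProg_spec h32 rfl hD0 hδ0 hDδ) ?_
  rintro s3 hf3 ⟨L, hL, h83, hR0, hRn, hRh, hRl, hRs⟩
  have hb3 := hb2.of_frame hf3 (by decide) (by decide)
  have hR : Scales b L (blockDist q pos P) (s3.reals 5) :=
    ⟨hRn, hRh, hRl, by rwa [hR0], fun x hx y hy hlt => by
      by_contra hne
      have h1 := lt_of_le_of_ne (hd.nonneg x hx y hy) (Ne.symm hne)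
      linarith [hδ x hx y hy h1]⟩
  -- The number `L` of levels is found at run time; step counts are monotone in it and are stated
  -- with `Lm`.
  refine Tri.seq (Tri.mono (valuesProg_spec hb3 h83 rfl) (by gcongr) fun _ _ h => h)
    fun s4 hf4 h4 => ?_
  refine Tri.seq (initProg_spec (hb3.of_frame hf4 (by decide) (by decide))) fun s5 hf5 h5 => ?_
  have hb5 := (hb3.of_frame hf4 (by decide) (by decide)).of_frame hf5 (by decide) (by decide)
  have ht5 : Tables b L (blockDist q pos P) (s3.reals 5) (fun y => W (pos + y)) s5 :=
    ⟨by rw [hf5.nats 8 (by decide), hf4.nats 8 (by decide), h83],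
      by rw [hf5.reals 5 (by decide), hf4.reals 5 (by decide)],
      by rw [hf5.reals 6 (by decide)]; exact h4⟩
  refine Tri.seq (Tri.mono (greedyProg_spec hb5 hb ht5 hd hR h5) (by gcongr) fun _ _ h => h)
    fun s6 hf6 ⟨hc, hz, lev, hlev⟩ => ?_
  have hb6 := hb5.of_frame hf6 (by decide) (by decide)
  have hout6 : s6.nats 4 0 = out := by
    rw [hf6.nats 4 (by decide), hf5.nats 4 (by decide), hf4.nats 4 (by decide),
      hf3.nats 4 (by decide), hf2.nats 4 (by decide), hf1.nats 4 (by decide), hout]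
  refine Tri.mono (collectProg_spec hb6 hk hout6) le_rfl ?_
  rintro s7 hf7 ⟨asg, h7, h8, h9, h10⟩
  refine ⟨s6.nats 10, asg, hz, fun x hx => (h7 x hx).1, h8, h9, fun X asg' hX => ?_,
    fun i hi => ?_⟩
  · exact greedyCenters_cost_le hd hR hW hc hlev hz (near := asg)
      (fun y hy i hi => (h7 y hy).2 i hi) X hX asg'
  · rw [(h10 i hi).1, (h10 i hi).2, hf6.nats 3 (by decide), hf5.nats 3 (by decide),
      hf4.nats 3 (by decide), hf3.nats 3 (by decide), hf2.nats 3 (by decide),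
      hf1.nats 3 (by decide), hf6.reals 2 (by decide), hf5.reals 2 (by decide),
      hf4.reals 2 (by decide), hf3.reals 2 (by decide), hf2.reals 2 (by decide),
      hf1.reals 2 (by decide)]
    exact ⟨rfl, rfl⟩

end KMedian

/-! ## The rounds of the algorithm -/

namespace KMedian

open RealRAM

/-! ### Compression of weighted lists, tested on 1-Lipschitz functions -/

section Pairing

variable {V : Type*}

/-- The sum of `f` over the first `N` points of a weighted list of points. -/
noncomputable def pairing (lab : ℕ → V) (P : ℕ → ℕ) (W : ℕ → ℝ) (N : ℕ) (f : V → ℝ) : ℝ :=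
  ∑ i ∈ Finset.range N, W i * f (lab (P i))

theorem pairing_add (lab : ℕ → V) (P : ℕ → ℕ) (W : ℕ → ℝ) (N M : ℕ) (f : V → ℝ) :
    pairing lab P W (N + M) f = pairing lab P W N f +
      pairing lab (fun i => P (N + i)) (fun i => W (N + i)) M f :=
  Finset.sum_range_add _ _ _

theorem pairing_congr {lab : ℕ → V} {N : ℕ} {P P' : ℕ → ℕ} {W W' : ℕ → ℝ}
    (hP : ∀ i < N, P' i = P i) (hW : ∀ i < N, W' i = W i) (f : V → ℝ) :
    pairing lab P' W' N f = pairing lab P W N f :=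
  Finset.sum_congr rfl fun i hi => by
    rw [hP i (Finset.mem_range.1 hi), hW i (Finset.mem_range.1 hi)]

/-- A finite set of at most `k` points is the range of a function on `Fin k`. -/
theorem exists_enumeration {k : ℕ} {S : Finset V} (hS : S.Nonempty) (hk : S.card ≤ k) :
    ∃ g : Fin k → V, ∀ y ∈ S, ∃ e, g e = y := by
  classical
  obtain ⟨ι⟩ : Nonempty (S ↪ Fin k) :=
    Function.Embedding.nonempty_of_card_le (by simpa using hk)
  obtain ⟨y₀, hy₀⟩ := hS
  have : Nonempty S := ⟨⟨y₀, hy₀⟩⟩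
  exact ⟨fun e => (Function.invFun ι e : S), fun y hy =>
    ⟨ι ⟨y, hy⟩, by
      simp only [Function.leftInverse_invFun ι.injective ⟨y, hy⟩]⟩⟩

variable [MetricSpace V]

/-- Passing from one weighted list of points to another one changes the sums of all `1`-Lipschitz
functions by at most `c` times the cost of any solution of the `k`-median problem. -/
def Approximates (lab : ℕ → V) (k : ℕ) (c : ℝ) (P : ℕ → ℕ) (W : ℕ → ℝ) (N : ℕ) (P' : ℕ → ℕ)
    (W' : ℕ → ℝ) (N' : ℕ) : Prop :=
  ∀ S : Finset V, S.Nonempty → S.card ≤ k → ∀ f : V → ℝ, (∀ x y, |f x - f y| ≤ dist x y) →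
    |pairing lab P W N f - pairing lab P' W' N' f| ≤
      c * pairing lab P W N fun x => Metric.infDist x S

theorem abs_infDist_sub_infDist_le (S : Set V) (x y : V) :
    |Metric.infDist x S - Metric.infDist y S| ≤ dist x y := by
  rw [abs_sub_le_iff]
  have h1 := Metric.infDist_le_infDist_add_dist (s := S) (x := x) (y := y)
  have h2 := Metric.infDist_le_infDist_add_dist (s := S) (x := y) (y := x)
  rw [dist_comm y x] at h2
  constructor <;> linarith

variable {lab : ℕ → V} {k N N' N'' : ℕ} {P P' P'' : ℕ → ℕ} {W W' W'' : ℕ → ℝ} {c c' : ℝ}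

/-- The cost of `S` on the intermediate list is the sum of a 1-Lipschitz function, hence at most `1
+ c` times its cost on the first list. This is the reason for testing all 1-Lipschitz functions. The
new constant satisfies `1 + (c + c' * (1 + c)) = (1 + c) * (1 + c')`. -/
theorem Approximates.trans (h : Approximates lab k c P W N P' W' N')
    (h' : Approximates lab k c' P' W' N' P'' W'' N'') (hc' : 0 ≤ c') :
    Approximates lab k (c + c' * (1 + c)) P W N P'' W'' N'' := by
  intro S hS hSk f hf
  have h1 := h S hS hSk f hf
  have h2 := h' S hS hSk f hf
  have h3 := (abs_sub_le_iff.1 (h S hS hSk _ (abs_infDist_sub_infDist_le S))).2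
  have h4 := abs_sub_le (pairing lab P W N f) (pairing lab P' W' N' f)
    (pairing lab P'' W'' N'' f)
  have h5 := mul_le_mul_of_nonneg_left h3 hc'
  linarith

/-- Sums over lists are additive and the same `S` is used on both parts, so handling the blocks
separately does not worsen the constant. -/
theorem Approximates.append {M M' : ℕ} (h : Approximates lab k c P W N P' W' N')
    (h' : Approximates lab k c (fun i => P (N + i)) (fun i => W (N + i)) M
      (fun i => P' (N' + i)) (fun i => W' (N' + i)) M') :
    Approximates lab k c P W (N + M) P' W' (N' + M') := by
  intro S hS hSk f hf
  have h1 := h S hS hSk f hf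
  have h2 := h' S hS hSk f hf
  simp only [pairing_add]
  rw [abs_le] at *
  constructor <;> linarith [h1.1, h1.2, h2.1, h2.2]

/-- Moving all points of a list to the centers of an approximate solution. -/
theorem approximates_of_clustering {b : ℕ} (hb : 0 < b) (hW : ∀ x < b, 0 ≤ W x)
    {z asg : ℕ → ℕ} (hasg : ∀ x < b, asg x < k) (hP' : ∀ e < k, P' e = P (z e))
    (hW' : ∀ e < k, W' e = ∑ x ∈ Finset.range b, if asg x = e then W x else 0)
    (h : ∀ (X : Fin k → ℕ) (asg' : ℕ → Fin k), (∀ e, X e < b) →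
      ∑ x ∈ Finset.range b, W x * dist (lab (P x)) (lab (P (z (asg x)))) ≤
        121 * ∑ x ∈ Finset.range b, W x * dist (lab (P x)) (lab (P (X (asg' x))))) :
    Approximates lab k 242 P W b P' W' k := by
  intro S hS hSk f hf
  have hsum : pairing lab P' W' k f =
      ∑ x ∈ Finset.range b, W x * f (lab (P (z (asg x)))) := by
    unfold pairing
    calc ∑ e ∈ Finset.range k, W' e * f (lab (P' e))
        = ∑ e ∈ Finset.range k, ∑ x ∈ Finset.range b,
            if asg x = e then W x * f (lab (P (z (asg x)))) else 0 := by
          refine Finset.sum_congr rfl fun e he => ?_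
          rw [hW' e (Finset.mem_range.1 he), hP' e (Finset.mem_range.1 he), Finset.sum_mul]
          refine Finset.sum_congr rfl fun x _ => ?_
          split_ifs with hx
          · rw [hx]
          · rw [zero_mul]
      _ = _ := by
          rw [Finset.sum_comm]
          refine Finset.sum_congr rfl fun x hx => ?_
          rw [Finset.sum_ite_eq, if_pos (Finset.mem_range.2 (hasg x (Finset.mem_range.1 hx)))]
  obtain ⟨g, hg⟩ := exists_enumeration hS hSk
  -- A solution may use points outside the block. Replacing each by the nearest point of the block
  -- at most doubles distances, which gives `242 = 2 * 121`.
  have hX : ∀ e, ∃ x < b, ∀ x' < b, dist (lab (P x)) (g e) ≤ dist (lab (P x')) (g e) := by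
    intro e
    obtain ⟨x, hx, hmin⟩ := Finset.exists_min_image (Finset.range b)
      (fun x => dist (lab (P x)) (g e)) ⟨0, Finset.mem_range.2 hb⟩
    exact ⟨x, Finset.mem_range.1 hx, fun x' hx' => hmin x' (Finset.mem_range.2 hx')⟩
  choose X hXb hXmin using hX
  have hnear : ∀ x, ∃ e, dist (lab (P x)) (g e) = Metric.infDist (lab (P x)) S := by
    intro x
    obtain ⟨y, hy, hxy⟩ := S.finite_toSet.isCompact.exists_infDist_eq_dist hS (lab (P x))
    obtain ⟨e, rfl⟩ := hg y hy
    exact ⟨e, hxy.symm⟩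
  choose asg' hasg' using hnear
  have h1 : |pairing lab P W b f - pairing lab P' W' k f| ≤
      ∑ x ∈ Finset.range b, W x * dist (lab (P x)) (lab (P (z (asg x)))) := by
    rw [hsum, pairing, ← Finset.sum_sub_distrib]
    refine (Finset.abs_sum_le_sum_abs _ _).trans (Finset.sum_le_sum fun x hx => ?_)
    have hx' := hW x (Finset.mem_range.1 hx)
    rw [← mul_sub, abs_mul, abs_of_nonneg hx']
    exact mul_le_mul_of_nonneg_left (hf _ _) hx'
  have h2 : ∑ x ∈ Finset.range b, W x * dist (lab (P x)) (lab (P (X (asg' x)))) ≤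
      2 * pairing lab P W b fun x => Metric.infDist x S := by
    rw [pairing, Finset.mul_sum]
    refine Finset.sum_le_sum fun x hx => ?_
    have hx' := Finset.mem_range.1 hx
    have e1 := dist_triangle_right (lab (P x)) (lab (P (X (asg' x)))) (g (asg' x))
    have e2 := hXmin (asg' x) x hx'
    have e3 := hasg' x
    have e4 : dist (lab (P x)) (lab (P (X (asg' x)))) ≤ 2 * Metric.infDist (lab (P x)) S := by
      linarith
    have := mul_le_mul_of_nonneg_left e4 (hW x hx')
    linarith
  linarith [h X asg' hXb]

end Pairing

/-! ### One round: blocks, block size and replacement of the list -/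

variable {V : Type*} [MetricSpace V] {lab : ℕ → V}
variable {q : ℕ → ℕ → ℝ} {pos b k n Lm : ℕ} {P : ℕ → ℕ} {W : ℕ → ℝ} {s : State}

/-- The distances are those of the points with labels `0, …, n - 1` in a metric space, and `2 ^ Lm`
bounds the aspect ratio. -/
structure Labels (n Lm : ℕ) (q : ℕ → ℕ → ℝ) (lab : ℕ → V) : Prop where
  dist_eq : ∀ x < n, ∀ y < n, q x y = dist (lab x) (lab y)
  le_pow : 30 ≤ 2 ^ Lm
  aspect : ∀ x < n, ∀ y < n, ∀ x' < n, ∀ y' < n, 0 < q x' y' → 30 * q x y ≤ 2 ^ Lm * q x' y'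

/-- The first `N` entries of the lists are labels of points and nonnegative weights. -/
def IsWeighted (n N : ℕ) (P : ℕ → ℕ) (W : ℕ → ℝ) : Prop := ∀ i < N, P i < n ∧ 0 ≤ W i

theorem blockProg_approximates (hq : Labels n Lm q lab) (h : Block pos b k P W s) (hk : 0 < k)
    (hb : 0 < b) {out : ℕ} (hout : s.nats 4 0 = out)
    (hPW : ∀ x < b, P (pos + x) < n ∧ 0 ≤ W (pos + x))
    (hold : IsWeighted n out (s.nats 3) (s.reals 2))
    (happ : Approximates lab k 242 P W pos (s.nats 3) (s.reals 2) out) :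
    Tri q blockProg s (blockSteps b k Lm) fun s' =>
      IsWeighted n (out + k) (s'.nats 3) (s'.reals 2) ∧
      Approximates lab k 242 P W (pos + b) (s'.nats 3) (s'.reals 2) (out + k) := by
  have hdd : ∀ x < b, ∀ y < b, blockDist q pos P x y =
      dist (lab (P (pos + x))) (lab (P (pos + y))) := fun x hx y hy =>
    hq.dist_eq _ (hPW x hx).1 _ (hPW y hy).1
  have hd : PseudoMetricOn b (blockDist q pos P) := by
    constructor
    · intro x hx y hy; rw [hdd x hx y hy]; exact dist_nonneg
    · intro x hx; rw [hdd x hx x hx, dist_self]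
    · intro x hx y hy; rw [hdd x hx y hy, hdd y hy x hx, dist_comm]
    · intro x hx y hy z hz
      rw [hdd x hx y hy, hdd y hy z hz, hdd x hx z hz]
      exact dist_triangle _ _ _
  refine Tri.mono (blockProg_spec h hk hb hout hd (fun x hx => (hPW x hx).2) hq.le_pow
    (fun x hx y hy x' hx' y' hy' => hq.aspect _ (hPW x hx).1 _ (hPW y hy).1 _ (hPW x' hx').1 _
      (hPW y' hy').1)) le_rfl ?_
  rintro s' - ⟨z, asg, hz, hasg, hP', hW', happr, hpre⟩
  refine ⟨fun i hi => ?_, ?_⟩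
  · rcases Nat.lt_or_ge i out with hlt | hge
    · rw [(hpre i hlt).1, (hpre i hlt).2]
      exact hold i hlt
    · obtain ⟨e, rfl⟩ := Nat.exists_eq_add_of_le hge
      rw [hP' e (by omega), hW' e (by omega)]
      refine ⟨(hPW _ (hz e (by omega))).1, Finset.sum_nonneg fun x hx => ?_⟩
      split_ifs
      · exact (hPW x (Finset.mem_range.1 hx)).2
      · exact le_rfl
  · refine Approximates.append ?_ ?_
    · intro S hS hSk f hf
      rw [pairing_congr (fun i hi => (hpre i hi).1) (fun i hi => (hpre i hi).2)]
      exact happ S hS hSk f hf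
    · refine approximates_of_clustering (z := z) (asg := asg) hb (fun x hx => (hPW x hx).2) hasg
        hP' hW' fun X asg' hX => ?_
      have e1 : ∀ c : ℕ → ℕ, (∀ x < b, c x < b) →
          ∑ x ∈ Finset.range b, W (pos + x) * dist (lab (P (pos + x))) (lab (P (pos + c x))) =
          ∑ x ∈ Finset.range b, W (pos + x) * blockDist q pos P x (c x) := fun c hc =>
        Finset.sum_congr rfl fun x hx => by
          rw [hdd x (Finset.mem_range.1 hx) _ (hc x (Finset.mem_range.1 hx))]
      rw [e1 (fun x => z (asg x)) fun x hx => hz _ (hasg x hx),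
        e1 (fun x => X (asg' x)) fun x _ => hX _]
      exact happr X asg' hX

/-- The size of the next block. -/
def sizeProg : Prog :=
  .ite (.natLE (.sub (nvar 1) (nvar 5)) (nvar 7)) (.setNat 6 (.lit 0) (.sub (nvar 1) (nvar 5)))
    (.setNat 6 (.lit 0) (nvar 7))

/-- Advance to the next block. -/
def advanceProg : Prog :=
  -- The two counters are advanced by unit increments because the sum of two stored integers is not
  -- tame.
  .seq (forLoop 14 (.get 0 (.lit 1)) (incrVar 4)) (forLoop 11 (nvar 6) (incrVar 5))

/-- All blocks of one round. -/
def blocksProg : Prog :=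
  .seq (.setNat 5 (.lit 0) (.lit 0)) (.seq (.setNat 4 (.lit 0) (.lit 0))
    (.loop (natLT (nvar 5) (nvar 1)) (.seq sizeProg (.seq blockProg advanceProg))))

/-- The new list replaces the old one. -/
def copyProg : Prog :=
  .seq (forLoop 11 (nvar 4) (.seq (.setNat 2 (nvar 11) (.get 3 (nvar 11)))
    (.setReal 0 (nvar 11) (.get 2 (nvar 11))))) (.setNat 1 (.lit 0) (nvar 4))

/-- The block size of one round. -/
def blockSizeProg : Prog :=
  -- With `m = ⌊Q / N⌋ + 1` one has `Q < N * m ≤ Q + N`. The lower bound limits the length of the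
  -- next list, the upper one the work of the round.
  .seq (.setNat 7 (.lit 0) (.add (.div (nvar 18) (nvar 1)) (.lit 1)))
    (.ite (.natLE (nvar 1) (nvar 7))
      (.seq (.setNat 19 (.lit 0) (.lit 1)) (.setNat 7 (.lit 0) (nvar 1))) .skip)

/-- One round. -/
def roundProg : Prog := .seq blockSizeProg (.seq blocksProg copyProg)

theorem advanceProg_spec {out : ℕ} (hk : s.nats 0 1 = k) (hb : s.nats 6 0 = b)
    (hout : s.nats 4 0 = out) (hpos : s.nats 5 0 = pos) :
    Tri q advanceProg s (k * (1 + 2) + 2 + (b * (1 + 2) + 2)) fun s' =>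
      s'.nats 4 0 = out + k ∧ s'.nats 5 0 = pos + b := by
  refine Tri.seq (Q := fun s' => s'.nats 4 0 = out + k)
    (Tri.forLoop (I := fun i s' => s'.nats 4 0 = out + i) k (by decide) (by simp [hout])
      (fun s' hf => by rw [← hk, ← hf.nats 0 (by decide)]; rfl) ?_) ?_
  · intro i hi s1 hf1 hi1 h1
    exact Tri.setNat (by simp [NatExpr.val, h1, add_assoc])
  · intro s1 hf1 h1
    refine Tri.mono (Tri.forLoop (I := fun i s' => s'.nats 5 0 = pos + i) b (by decide)
      (by simp [hf1.nats 5 (by decide), hpos]) (fun s' hf => by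
        rw [← hb, ← hf1.nats 6 (by decide), ← hf.nats 6 (by decide)]; rfl) ?_) le_rfl ?_
    · intro i hi s1 hf1 hi1 h1
      exact Tri.setNat (by simp [NatExpr.val, h1, add_assoc])
    · intro s2 hf2 h2
      exact ⟨by rw [hf2.nats 4 (by decide), h1], h2⟩

theorem blockSteps_mono {b b' : ℕ} (h : b ≤ b') : blockSteps b k Lm ≤ blockSteps b' k Lm := by
  unfold blockSteps
  gcongr

/-- The two inequalities on `i` say that it is `N / m` rounded up; the upper one later bounds the
length `i * k` of the new list. -/
theorem blocksProg_spec (hq : Labels n Lm q lab) {N m : ℕ} (hk : 0 < k) (hm : 0 < m)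
    (hks : s.nats 0 1 = k) (hNs : s.nats 1 0 = N) (hms : s.nats 7 0 = m)
    (hP : s.nats 2 = P) (hW : s.reals 0 = W) (hPW : IsWeighted n N P W) :
    Tri q blocksProg s (1 + (1 + ((N / m + 1) * (1 + 1 + (blockSteps m k Lm +
      (k * (1 + 2) + 2 + (m * (1 + 2) + 2))) + 1) + 1))) fun s' =>
      ∃ i, N ≤ i * m ∧ (i = 0 ∨ (i - 1) * m < N) ∧ s'.nats 4 0 = i * k ∧
        IsWeighted n (i * k) (s'.nats 3) (s'.reals 2) ∧
        Approximates lab k 242 P W N (s'.nats 3) (s'.reals 2) (i * k) := by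
  refine Tri.seq (Q := fun s' => s'.nats 5 0 = 0) (Tri.setNat (by simp [NatExpr.val]))
    fun s1 hf1 h1 => ?_
  refine Tri.seq (Q := fun s' => s'.nats 5 0 = 0 ∧ s'.nats 4 0 = 0)
    (Tri.setNat (by simp [NatExpr.val, h1])) fun s2 hf2 h2 => ?_
  refine Tri.mono (Tri.loop (I := fun i s' => s'.nats 5 0 = min (i * m) N ∧
      (i = 0 ∨ (i - 1) * m < N) ∧ s'.nats 4 0 = i * k ∧
      IsWeighted n (i * k) (s'.nats 3) (s'.reals 2) ∧
      Approximates lab k 242 P W (min (i * m) N) (s'.nats 3) (s'.reals 2) (i * k))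
      (N / m + 1) ?_ ?_) le_rfl ?_
  · refine ⟨by simp [h2.1], .inl rfl, by simp [h2.2], fun i hi => by omega, ?_⟩
    intro S hS hSk f hf
    simp [pairing]
  · rintro i s3 hf3 ⟨hpos, -, hout, hwt, happ⟩ hb
    have hN3 : s3.nats 1 0 = N := by
      rw [hf3.nats 1 (by decide), hf2.nats 1 (by decide), hf1.nats 1 (by decide), hNs]
    have hm3 : s3.nats 7 0 = m := by
      rw [hf3.nats 7 (by decide), hf2.nats 7 (by decide), hf1.nats 7 (by decide), hms]
    have hk3 : s3.nats 0 1 = k := by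
      rw [hf3.nats 0 (by decide), hf2.nats 0 (by decide), hf1.nats 0 (by decide), hks]
    have hP3 : s3.nats 2 = P := by
      rw [hf3.nats 2 (by decide), hf2.nats 2 (by decide), hf1.nats 2 (by decide), hP]
    have hW3 : s3.reals 0 = W := by
      rw [hf3.reals 0 (by decide), hf2.reals 0 (by decide), hf1.reals 0 (by decide), hW]
    simp only [Test.Holds, NatExpr.val, hpos, hN3, not_le] at hb
    have him : i * m < N := by omega
    rw [min_eq_left him.le] at hpos happ
    have hi : i ≤ N / m := (Nat.le_div_iff_mul_le hm).2 him.le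
    refine ⟨by omega, ?_⟩
    have hsize : Tri q sizeProg s3 (1 + 1) fun s' => s'.nats 6 0 = min m (N - i * m) := by
      refine Tri.ite (fun hb => Tri.setNat ?_) (fun hb => Tri.setNat ?_)
      all_goals
        simp only [Test.Holds, NatExpr.val, hN3, hpos, hm3, not_le] at hb
        simp only [NatExpr.val, State.writeNat_nats_apply, and_self, if_true, hN3, hpos, hm3]
        omega
    refine Tri.seq hsize fun s4 hf4 h4 => ?_
    have hb4 : Block (i * m) (min m (N - i * m)) k P W s4 :=
      ⟨by rw [hf4.nats 5 (by decide), hpos], h4, by rw [hf4.nats 0 (by decide), hk3],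
        by rw [hf4.nats 2 (by decide), hP3], by rw [hf4.reals 0 (by decide), hW3]⟩
    have hout4 : s4.nats 4 0 = i * k := by rw [hf4.nats 4 (by decide), hout]
    refine Tri.seq (Tri.mono (blockProg_approximates hq hb4 hk (by omega) hout4
      (fun x hx => hPW _ (by omega))
      (by rw [hf4.nats 3 (by decide), hf4.reals 2 (by decide)]; exact hwt)
      (by rw [hf4.nats 3 (by decide), hf4.reals 2 (by decide)]; exact happ))
      (blockSteps_mono (min_le_left _ _)) fun _ _ h => h) fun s5 hf5 ⟨h5, h5'⟩ => ?_
    have hb5 := hb4.of_frame hf5 (by decide) (by decide)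
    refine Tri.mono (advanceProg_spec hb5.centers hb5.size
      (out := i * k) (by rw [hf5.nats 4 (by decide), hout4]) hb5.pos) (by
        gcongr; exact min_le_left _ _) fun s6 hf6 ⟨h6, h6'⟩ => ?_
    have e1 : i * m + min m (N - i * m) = min ((i + 1) * m) N := by
      rw [Nat.succ_mul]; omega
    have e2 : i * k + k = (i + 1) * k := by ring
    rw [e1] at h5' h6'
    rw [e2] at h5 h5' h6
    refine ⟨h6', .inr (by simpa using him), h6, ?_, ?_⟩
    · rw [hf6.nats 3 (by decide), hf6.reals 2 (by decide)]; exact h5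
    · rw [hf6.nats 3 (by decide), hf6.reals 2 (by decide)]; exact h5'
  · rintro s3 hf3 ⟨hb, i, hi, hpos, hor, hout, hwt, happ⟩
    have hN3 : s3.nats 1 0 = N := by
      rw [hf3.nats 1 (by decide), hf2.nats 1 (by decide), hf1.nats 1 (by decide), hNs]
    simp only [Test.Holds, NatExpr.val, hpos, hN3, not_not] at hb
    have him : N ≤ i * m := by omega
    rw [min_eq_right him] at happ
    exact ⟨i, him, hor, hout, hwt, happ⟩

theorem copyProg_spec {N : ℕ} (hN : s.nats 4 0 = N) :
    Tri q copyProg s (N * (1 + 1 + 2) + 2 + 1) fun s' => s'.nats 1 0 = N ∧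
      ∀ i < N, s'.nats 2 i = s.nats 3 i ∧ s'.reals 0 i = s.reals 2 i := by
  refine Tri.seq (Tri.forLoop (I := fun j s' => ∀ i < j, s'.nats 2 i = s.nats 3 i ∧
    s'.reals 0 i = s.reals 2 i) N (by decide) (by simp)
    (fun s' hf => by rw [← hN, ← hf.nats 4 (by decide)]; rfl) ?_) ?_
  · intro j hj s1 hf1 hj1 h1
    have h3 : s1.nats 3 = s.nats 3 := hf1.nats 3 (by decide)
    have h2 : s1.reals 2 = s.reals 2 := hf1.reals 2 (by decide)
    refine Tri.seq (Q := fun s' => (∀ i < j + 1, s'.nats 2 i = s.nats 3 i) ∧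
      ∀ i < j, s'.reals 0 i = s.reals 2 i) (Tri.setNat ?_) fun s2 hf2 h2' => Tri.setReal ?_
    · simp only [NatExpr.val, State.writeNat_nats_apply, hj1, true_and, h3, State.writeNat_reals]
      refine ⟨fun i hi => ?_, fun i hi => (h1 i hi).2⟩
      split_ifs with hij
      · rw [hij]
      · exact (h1 i (by omega)).1
    · have hj2 : s2.nats 11 0 = j := by rw [hf2.nats 11 (by decide), hj1]
      have h22 : s2.reals 2 = s.reals 2 := by rw [hf2.reals 2 (by decide), h2]
      simp only [NatExpr.val, RealExpr.val, State.writeNat_nats_apply, hj2, true_and, h22,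
        State.writeNat_reals, State.writeReal_nats, State.writeReal_reals_apply,
        Nat.reduceEqDiff, false_and, if_false]
      refine fun i hi => ⟨h2'.1 i hi, ?_⟩
      split_ifs with hij
      · rw [hij]
      · exact h2'.2 i (by omega)
  · intro s1 hf1 h1
    refine Tri.setNat ⟨by simp [NatExpr.val, hf1.nats 4 (by decide), hN], fun i hi => ?_⟩
    simpa using h1 i hi

theorem blockSizeProg_spec {N Q : ℕ} (hNs : s.nats 1 0 = N) (hQ : s.nats 18 0 = Q) :
    Tri q blockSizeProg s (1 + (1 + (1 + 1))) fun s' =>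
      s'.nats 7 0 = min (Q / N + 1) N ∧
      s'.nats 19 0 = if N ≤ Q / N + 1 then 1 else s.nats 19 0 := by
  refine Tri.seq (Q := fun s' => s'.nats 7 0 = Q / N + 1)
    (Tri.setNat (by simp [NatExpr.val, hNs, hQ])) fun s1 hf1 h1 => ?_
  have hN1 : s1.nats 1 0 = N := by rw [hf1.nats 1 (by decide), hNs]
  refine Tri.ite (fun hb => ?_) (fun hb => ?_)
  · simp only [Test.Holds, NatExpr.val, hN1, h1] at hb
    refine Tri.seq (Q := fun s' => s'.nats 19 0 = 1) (Tri.setNat (by simp [NatExpr.val]))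
      fun s2 hf2 h2 => Tri.setNat ?_
    have hN2 : s2.nats 1 0 = N := by rw [hf2.nats 1 (by decide), hN1]
    simp [NatExpr.val, h2, hN2, hb]
  · simp only [Test.Holds, NatExpr.val, hN1, h1] at hb
    refine Tri.mono (Tri.skip (Q := fun s' => s' = s1) rfl) (by omega) ?_
    rintro s2 - rfl
    rw [h1, hf1.nats 19 (by decide), if_neg hb]
    exact ⟨by omega, rfl⟩

end KMedian

/-! ### Doubly exponential shrinking of the list and the whole program -/

namespace KMedian

open RealRAM

variable {V : Type*} [MetricSpace V] {lab : ℕ → V}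
variable {q : ℕ → ℕ → ℝ} {k n Lm : ℕ} {P : ℕ → ℕ} {W : ℕ → ℝ} {s : State}

/-- Since `k ≤ m`, the greedy rounds, of order `k * m * (Lm + 1)`, cost no more than the table of
ball values, of order `m ^ 2 * (Lm + 1)`. -/
theorem blockSteps_le {m : ℕ} (hk : k ≤ m) (hm : 1 ≤ m) :
    blockSteps m k Lm ≤ 200 * ((Lm + 1) * m ^ 2) := by
  have h1 : blockSteps m k Lm ≤ blockSteps m m Lm := by
    unfold blockSteps
    gcongr
  have h2 : m ≤ m ^ 2 := Nat.le_self_pow (by norm_num) m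
  have h3 : Lm * m ≤ Lm * m ^ 2 := Nat.mul_le_mul_left _ h2
  have h4 : Lm ≤ Lm * m := Nat.le_mul_of_pos_right _ hm
  refine h1.trans ?_
  unfold blockSteps
  ring_nf at *
  omega

/-- A bound for the number of steps of one round. -/
theorem roundSteps_le {N m i Q : ℕ} (hk : 0 < k) (hkm : k ≤ m) (hmN : m ≤ N) (hNm : N * m ≤ 2 * Q)
    (hi : i = 0 ∨ (i - 1) * m < N) :
    1 + (1 + (1 + 1)) + (1 + (1 + ((N / m + 1) * (1 + 1 + (blockSteps m k Lm +
      (k * (1 + 2) + 2 + (m * (1 + 2) + 2))) + 1) + 1)) + (i * k * (1 + 1 + 2) + 2 + 1)) ≤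
      1000 * ((Lm + 1) * Q) := by
  have hm : 1 ≤ m := by omega
  have h1 := blockSteps_le (Lm := Lm) hkm hm
  have h2 : m ≤ m ^ 2 := Nat.le_self_pow (by norm_num) m
  have h3 : m ^ 2 ≤ (Lm + 1) * m ^ 2 := Nat.le_mul_of_pos_left _ (by omega)
  have h4 : 1 + 1 + (blockSteps m k Lm + (k * (1 + 2) + 2 + (m * (1 + 2) + 2))) + 1 ≤
      213 * ((Lm + 1) * m ^ 2) := by omega
  have h5 : (N / m + 1) * m ≤ 2 * N := by
    have := Nat.div_mul_le_self N m
    rw [Nat.succ_mul]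
    omega
  have h6 : (N / m + 1) * (213 * ((Lm + 1) * m ^ 2)) ≤ 852 * ((Lm + 1) * Q) :=
    calc (N / m + 1) * (213 * ((Lm + 1) * m ^ 2))
        = 213 * (Lm + 1) * (((N / m + 1) * m) * m) := by ring
      _ ≤ 213 * (Lm + 1) * ((2 * N) * m) := by gcongr
      _ = 213 * (Lm + 1) * (2 * (N * m)) := by ring
      _ ≤ 213 * (Lm + 1) * (2 * (2 * Q)) := by gcongr
      _ = _ := by ring
  have h7 : i * k ≤ 2 * N := by
    rcases hi with rfl | hi
    · omega
    · have h8 : (i - 1) * k ≤ (i - 1) * m := Nat.mul_le_mul_left _ hkm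
      rcases i with _ | i
      · omega
      · rw [Nat.succ_mul]
        simp only [Nat.add_sub_cancel] at h8 hi
        omega
  have h8 : N ≤ N * m := Nat.le_mul_of_pos_right _ hm
  have h9 : Q ≤ (Lm + 1) * Q := Nat.le_mul_of_pos_left _ (by omega)
  have h10 := Nat.mul_le_mul_left (N / m + 1) h4
  omega

/-- The hypothesis `k * N ≤ Q` makes blocks at least as large as `k`. If several blocks are used,
their number `i` satisfies `i * m < N + m < 2 * N`, and with `Q < N * m` the new length `i * k`
obeys `N' * Q < 2 * k * N ^ 2`. -/
theorem roundProg_spec (hq : Labels n Lm q lab) {N Q : ℕ} (hk : 0 < k) (hkN : k ≤ N)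
    (hNQ : k * N ≤ Q) (hNQ' : N ≤ Q) (hks : s.nats 0 1 = k) (hNs : s.nats 1 0 = N)
    (hQ : s.nats 18 0 = Q) (hdone : s.nats 19 0 = 0) (hP : s.nats 2 = P) (hW : s.reals 0 = W)
    (hPW : IsWeighted n N P W) :
    Tri q roundProg s (1000 * ((Lm + 1) * Q)) fun s' => ∃ N', k ≤ N' ∧ s'.nats 1 0 = N' ∧
      IsWeighted n N' (s'.nats 2) (s'.reals 0) ∧
      Approximates lab k 242 P W N (s'.nats 2) (s'.reals 0) N' ∧
      (s'.nats 19 0 = 1 ∧ N' = k ∨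
        s'.nats 19 0 = 0 ∧ Q / N + 1 < N ∧ N' * Q < 2 * k * N ^ 2) := by
  have hN : 0 < N := by omega
  have hm : 0 < min (Q / N + 1) N := lt_min (Nat.succ_pos _) hN
  have hkm : k ≤ min (Q / N + 1) N := by
    have := (Nat.le_div_iff_mul_le hN).2 hNQ
    omega
  have hNm : N * min (Q / N + 1) N ≤ 2 * Q := by
    have h1 := Nat.mul_le_mul_left N (min_le_left (Q / N + 1) N)
    have h2 := Nat.mul_div_le Q N
    rw [Nat.mul_succ] at h1
    omega
  obtain ⟨n1, s1, hs1, hn1, h1, h1'⟩ := blockSizeProg_spec (q := q) hNs hQ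
  have hf1 := hs1.frame
  have hP1 : s1.nats 2 = P := by rw [hf1.nats 2 (by decide), hP]
  have hW1 : s1.reals 0 = W := by rw [hf1.reals 0 (by decide), hW]
  obtain ⟨n2, s2, hs2, hn2, i, hi, hi', h4, hwt, happ⟩ := blocksProg_spec hq hk hm
    (by rw [hf1.nats 0 (by decide), hks]) (by rw [hf1.nats 1 (by decide), hNs]) h1 hP1 hW1 hPW
  have hf2 := hs2.frame
  obtain ⟨n3, s3, hs3, hn3, h3, h3'⟩ := copyProg_spec (q := q) h4
  have hf3 := hs3.frame
  have hi0 : 1 ≤ i := by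
    by_contra! hlt
    obtain rfl : i = 0 := by omega
    omega
  refine ⟨_, s3, .seq hs1 (.seq hs2 hs3), ?_, i * k, Nat.le_mul_of_pos_left _ hi0, h3,
    fun j hj => ?_, ?_, ?_⟩
  · exact le_trans (by omega) (roundSteps_le hk hkm (min_le_right _ _) hNm hi')
  · rw [(h3' j hj).1, (h3' j hj).2]
    exact hwt j hj
  · intro S hS hSk f hf
    rw [pairing_congr (fun j hj => (h3' j hj).1) (fun j hj => (h3' j hj).2)]
    exact happ S hS hSk f hf
  · rw [hf3.nats 19 (by decide), hf2.nats 19 (by decide), h1']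
    rcases hi' with rfl | hi'
    · omega
    obtain ⟨j, rfl⟩ : ∃ j, i = j + 1 := ⟨i - 1, by omega⟩
    rw [Nat.add_sub_cancel] at hi'
    split_ifs with hle
    · left
      rw [min_eq_right hle] at hi'
      refine ⟨rfl, ?_⟩
      rcases j with _ | j
      · simp
      · rw [Nat.succ_mul] at hi'
        omega
    · right
      push Not at hle
      refine ⟨hdone, hle, ?_⟩
      rw [min_eq_left hle.le] at hi'
      set m := Q / N + 1
      have h5 : Q < N * m := Nat.lt_mul_div_succ Q hN
      calc (j + 1) * k * Q ≤ (j + 1) * k * (N * m) := by gcongr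
        _ = k * N * (j * m + m) := by ring
        _ < k * N * (N + N) := by
          refine Nat.mul_lt_mul_of_pos_left (by omega) (by positivity)
        _ = 2 * k * N ^ 2 := by ring

/-- The rounds of the algorithm. -/
def roundsProg : Prog := .loop (.natLE (nvar 19) (.lit 0)) roundProg

/-- With `Q = 2nkg` a round gives `N' ≤ N ^ 2 / (n * g)`, so a lower bound `G` for `n / N` becomes
`g * G ^ 2`. -/
theorem mul_sq_le_of_round {N N' g G : ℕ} (h : N' * (n * (k * (g * 2))) < 2 * k * N ^ 2)
    (hNG : N * G ≤ n) (hn : 0 < n) : N' * (g * G ^ 2) ≤ n := by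
  have h1 : N' * (n * g) ≤ N ^ 2 := by
    by_contra! hh
    refine absurd h (not_lt.2 ?_)
    calc 2 * k * N ^ 2 ≤ 2 * k * (N' * (n * g)) := Nat.mul_le_mul_left _ hh.le
      _ = N' * (n * (k * (g * 2))) := by ring
  refine Nat.le_of_mul_le_mul_left ?_ hn
  calc n * (N' * (g * G ^ 2)) = N' * (n * g) * G ^ 2 := by ring
    _ ≤ N ^ 2 * G ^ 2 := Nat.mul_le_mul_right _ h1
    _ = (N * G) ^ 2 := by ring
    _ ≤ n ^ 2 := Nat.pow_le_pow_left hNG 2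
    _ = n * n := sq n

/-- Once `g * G ^ 2` reaches `n / k`, the whole list fits into one block: `N ^ 2 ≤ Q`. -/
theorem sq_le_of_last_round {N g G : ℕ} (h : n ≤ k * (g * G ^ 2)) (hNG : N * G ≤ n) (hG : 0 < G) :
    N ^ 2 ≤ n * (k * (g * 2)) := by
  refine Nat.le_of_mul_le_mul_right (c := G ^ 2) ?_ (by positivity)
  calc N ^ 2 * G ^ 2 = (N * G) ^ 2 := by ring
    _ ≤ n ^ 2 := Nat.pow_le_pow_left hNG 2
    _ = n * n := sq n
    _ ≤ n * (k * (g * G ^ 2)) := Nat.mul_le_mul_left _ h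
    _ ≤ n * (k * (g * G ^ 2)) * 2 := Nat.le_mul_of_pos_right _ two_pos
    _ = n * (k * (g * 2)) * G ^ 2 := by ring

/-- The invariant `N * g ^ (2 ^ t - 1) ≤ n` comes from iterating `G ↦ g * G ^ 2`, and the error `243
^ t - 1` from composing `t` rounds of error 242. The number `l` occurs only in the analysis; the
program stops when it finds that one block suffices. -/
theorem roundsProg_spec (hq : Labels n Lm q lab) {g l : ℕ} (hk : 0 < k) (hkn : k ≤ n) (hg : 1 ≤ g)
    (hl : n ≤ k * g ^ 2 ^ l) (hks : s.nats 0 1 = k) (hns : s.nats 1 0 = n)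
    (hQ : s.nats 18 0 = n * (k * (g * 2))) (hdone : s.nats 19 0 = 0) (hP : s.nats 2 = P)
    (hW : s.reals 0 = W) (hPW : IsWeighted n n P W) :
    Tri q roundsProg s ((l + 1) * (1000 * ((Lm + 1) * (n * (k * (g * 2)))) + 1) + 1) fun s' =>
      s'.nats 1 0 = k ∧ IsWeighted n k (s'.nats 2) (s'.reals 0) ∧
      Approximates lab k (243 ^ (l + 1) - 1) P W n (s'.nats 2) (s'.reals 0) k := by
  refine Tri.mono (Tri.loop (I := fun t s' => ∃ N, k ≤ N ∧ N ≤ n ∧ s'.nats 1 0 = N ∧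
    IsWeighted n N (s'.nats 2) (s'.reals 0) ∧
    Approximates lab k (243 ^ t - 1) P W n (s'.nats 2) (s'.reals 0) N ∧
    (s'.nats 19 0 = 1 ∧ N = k ∨ s'.nats 19 0 = 0 ∧ t ≤ l ∧ N * g ^ (2 ^ t - 1) ≤ n)) (l + 1)
    ⟨n, hkn, le_rfl, hns, by rwa [hP, hW], ?_, .inr ⟨hdone, by omega, by simp⟩⟩ ?_) le_rfl ?_
  · intro S hS hSk f hf
    simp [hP, hW]
  · rintro t s1 hf1 ⟨N, hkN, hNn, hN, hwt, happ, hor⟩ hb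
    simp only [Test.Holds, NatExpr.val] at hb
    rcases hor with ⟨h, -⟩ | ⟨hd, htl, hNg⟩
    · omega
    refine ⟨by omega, ?_⟩
    have hNQ : k * N ≤ n * (k * (g * 2)) :=
      calc k * N ≤ k * n * (g * 2) :=
            (Nat.mul_le_mul_left _ hNn).trans (Nat.le_mul_of_pos_right _ (by positivity))
        _ = n * (k * (g * 2)) := by ring
    have hNQ' : N ≤ n * (k * (g * 2)) :=
      hNn.trans (Nat.le_mul_of_pos_right _ (by positivity))
    refine Tri.mono (roundProg_spec hq hk hkN hNQ hNQ' (by rw [hf1.nats 0 (by decide), hks]) hN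
      (by rw [hf1.nats 18 (by decide), hQ]) hd rfl rfl hwt) le_rfl ?_
    rintro s2 - ⟨N', hkN', hN', hwt', happ', hor'⟩
    have hpow : g ^ (2 ^ (t + 1) - 1) = g * (g ^ (2 ^ t - 1)) ^ 2 := by
      rw [← pow_mul, ← pow_succ']
      congr 1
      have : 1 ≤ 2 ^ t := Nat.one_le_two_pow
      omega
    set G := g ^ (2 ^ t - 1)
    have hn0 : 0 < n := by omega
    have hG0 : 0 < G := by positivity
    have hNn' : N' * (n * (k * (g * 2))) < 2 * k * N ^ 2 → N' * (g * G ^ 2) ≤ n := fun h =>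
      mul_sq_le_of_round h hNg hn0
    refine ⟨N', hkN', ?_, hN', hwt', ?_, ?_⟩
    · rcases hor' with ⟨-, h⟩ | h
      · omega
      · exact (Nat.le_mul_of_pos_right _ (by positivity)).trans (hNn' h.2.2)
    · have := happ.trans happ' (by norm_num)
      convert this using 1
      ring
    · refine hor'.imp_right fun h => ⟨h.1, ?_, by rw [hpow]; exact hNn' h.2.2⟩
      rcases Nat.lt_or_ge t l with hlt | hge
      · exact hlt
      exfalso
      obtain rfl : t = l := by omega
      -- An unfinished round with `t = l` is impossible: `g * G ^ 2 = g ^ (2 ^ (l + 1) - 1)` is at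
      -- least `g ^ 2 ^ l`, so the list would have fitted into one block, against `Q / N + 1 < N`.
      have h3 : g ^ 2 ^ t ≤ g * G ^ 2 := by
        rw [← hpow]
        refine Nat.pow_le_pow_right hg ?_
        have : 1 ≤ 2 ^ t := Nat.one_le_two_pow
        omega
      have h4 : n ≤ k * (g * G ^ 2) := hl.trans (Nat.mul_le_mul_left _ h3)
      have h5 := sq_le_of_last_round h4 hNg hG0
      have h6 : N ≤ n * (k * (g * 2)) / N :=
        (Nat.le_div_iff_mul_le (by omega)).2 (by rwa [← sq])
      omega
  · rintro s1 hf1 ⟨hb, t, ht, N, hkN, hNn, hN, hwt, happ, hor⟩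
    simp only [Test.Holds, NatExpr.val] at hb
    rcases hor with ⟨-, rfl⟩ | ⟨h, -⟩
    · refine ⟨hN, hwt, fun S hS hSk f hf => (happ S hS hSk f hf).trans ?_⟩
      refine mul_le_mul_of_nonneg_right ?_ ?_
      · have : (243 : ℝ) ^ t ≤ 243 ^ (l + 1) := pow_le_pow_right₀ (by norm_num) ht
        linarith
      · exact Finset.sum_nonneg fun i hi =>
          mul_nonneg (hPW i (Finset.mem_range.1 hi)).2 Metric.infDist_nonneg
    · omega

/-- The initial list consists of all points. -/
def listProg : Prog :=
  .seq (forLoop 11 (nvar 0) (.setNat 2 (nvar 11) (nvar 11))) (.setNat 1 (.lit 0) (nvar 0))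

/-- The parameter `δ` is rounded up to an integer. -/
def ceilProg : Prog :=
  -- The machine has no rounding operation, so `⌈δ⌉` is found by counting; the time for this is
  -- within the bound.
  .seq (.setNat 17 (.lit 0) (.lit 0)) (.loop (realLT (.cast (nvar 17)) (rvar 1)) (incrVar 17))

/-- The number `2 n k ⌈δ⌉`, which the block sizes depend on. -/
def productProg : Prog :=
  -- The product is accumulated in increments of 2, since storing a product would not be tame. The
  -- loops take about `nk⌈δ⌉` steps, which is affordable.
  .seq (.setNat 18 (.lit 0) (.lit 0)) (forLoop 11 (nvar 0) (forLoop 12 (.get 0 (.lit 1))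
    (forLoop 13 (nvar 17) (.setNat 18 (.lit 0) (.add (nvar 18) (.lit 2))))))

/-- The algorithm. -/
def medianProg : Prog :=
  .seq listProg (.seq ceilProg (.seq productProg (.seq (.setNat 19 (.lit 0) (.lit 0)) roundsProg)))

theorem listProg_spec (hn : s.nats 0 0 = n) :
    Tri q listProg s (n * (1 + 2) + 2 + 1) fun s' => s'.nats 1 0 = n ∧ ∀ i < n, s'.nats 2 i = i := by
  refine Tri.seq (Tri.forLoop (I := fun j s' => ∀ i < j, s'.nats 2 i = i) n (by decide) (by simp)
    (fun s' hf => by rw [← hn, ← hf.nats 0 (by decide)]; rfl) ?_) ?_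
  · intro j hj s1 hf1 hj1 h1
    refine Tri.setNat fun i hi => ?_
    simp only [NatExpr.val, State.writeNat_nats_apply, hj1, true_and, Nat.reduceEqDiff, false_and,
      if_false]
    split_ifs with hij
    · exact hij.symm
    · exact h1 i (by omega)
  · intro s1 hf1 h1
    refine Tri.setNat ⟨by simp [NatExpr.val, hf1.nats 0 (by decide), hn], fun i hi => ?_⟩
    simpa using h1 i hi

theorem ceilProg_spec {δ : ℝ} (hδ : s.reals 1 0 = δ) :
    Tri q ceilProg s (1 + (⌈δ⌉₊ * (1 + 1) + 1)) fun s' => s'.nats 17 0 = ⌈δ⌉₊ := by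
  refine Tri.seq (Q := fun s' => s'.nats 17 0 = 0) (Tri.setNat (by simp [NatExpr.val]))
    fun s1 hf1 h1 => ?_
  refine Tri.mono (Tri.loop (I := fun i s' => s'.nats 17 0 = i) ⌈δ⌉₊ h1 ?_) le_rfl ?_
  · intro i s2 hf2 h2 hb
    simp only [Test.Holds, RealExpr.val, NatExpr.val, h2, hf2.reals 1 (by decide),
      hf1.reals 1 (by decide), hδ, not_le] at hb
    exact ⟨Nat.lt_ceil.2 hb, Tri.setNat (by simp [NatExpr.val, h2])⟩
  · rintro s2 hf2 ⟨hb, i, hi, h2⟩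
    simp only [Test.Holds, RealExpr.val, NatExpr.val, h2, hf2.reals 1 (by decide),
      hf1.reals 1 (by decide), hδ, not_le, not_lt] at hb
    rw [h2]
    exact le_antisymm hi (Nat.ceil_le.2 hb)

theorem productProg_spec {g : ℕ} (hn : s.nats 0 0 = n) (hk : s.nats 0 1 = k)
    (hg : s.nats 17 0 = g) :
    Tri q productProg s (1 + (n * (k * (g * (1 + 2) + 2 + 2) + 2 + 2) + 2)) fun s' =>
      s'.nats 18 0 = n * (k * (g * 2)) := by
  refine Tri.seq (Q := fun s' => s'.nats 18 0 = 0) (Tri.setNat (by simp [NatExpr.val]))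
    fun s1 hf1 h1 => ?_
  refine Tri.forLoop (I := fun x s' => s'.nats 18 0 = x * (k * (g * 2))) n (by decide)
    (by simp [h1]) (fun s' hf => by
      rw [← hn, ← hf1.nats 0 (by decide), ← hf.nats 0 (by decide)]; rfl) ?_
  intro x hx s2 hf2 hx2 h2
  refine Tri.mono (Tri.forLoop (I := fun y s' => s'.nats 18 0 = x * (k * (g * 2)) + y * (g * 2)) k
    (by decide) (by simp [h2]) (fun s' hf => by
      rw [← hk, ← hf1.nats 0 (by decide), ← hf2.nats 0 (by decide), ← hf.nats 0 (by decide)]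
      rfl) ?_) le_rfl fun s' _ h => ?_
  · intro y hy s3 hf3 hy3 h3
    refine Tri.mono (Tri.forLoop (I := fun z s' =>
      s'.nats 18 0 = x * (k * (g * 2)) + y * (g * 2) + z * 2) g
      (by decide) (by simp [h3]) (fun s' hf => by
        rw [← hg, ← hf1.nats 17 (by decide), ← hf2.nats 17 (by decide), ← hf3.nats 17 (by decide),
          ← hf.nats 17 (by decide)]
        rfl) ?_) le_rfl fun s' _ h => ?_
    · intro z hz s4 hf4 hz4 h4
      refine Tri.setNat ?_
      simp only [NatExpr.val, State.writeNat_nats_apply, Nat.reduceEqDiff, false_and, if_false,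
        and_self, if_true, h4]
      ring
    · simp only [State.writeNat_nats_apply, Nat.reduceEqDiff, false_and, if_false, h]
      ring
  · simp only [State.writeNat_nats_apply, Nat.reduceEqDiff, false_and, if_false, h]
    ring

/-- A bound for the number of steps of the algorithm. -/
def medianSteps (n k g l Lm : ℕ) : ℕ :=
  (n * (1 + 2) + 2 + 1) + ((1 + (g * (1 + 1) + 1)) +
    ((1 + (n * (k * (g * (1 + 2) + 2 + 2) + 2 + 2) + 2)) +
    (1 + ((l + 1) * (1000 * ((Lm + 1) * (n * (k * (g * 2)))) + 1) + 1))))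

theorem medianProg_spec (hq : Labels n Lm q lab) {δ : ℝ} {l : ℕ} (hk : 0 < k) (hkn : k ≤ n)
    (hδ : 0 < δ) (hl : n ≤ k * ⌈δ⌉₊ ^ 2 ^ l) (hns : s.nats 0 0 = n) (hks : s.nats 0 1 = k)
    (hδs : s.reals 1 0 = δ) (hW : ∀ i < n, 0 ≤ s.reals 0 i) :
    Tri q medianProg s (medianSteps n k ⌈δ⌉₊ l Lm) fun s' =>
      s'.nats 1 0 = k ∧ IsWeighted n k (s'.nats 2) (s'.reals 0) ∧
      Approximates lab k (243 ^ (l + 1) - 1) id (s.reals 0) n (s'.nats 2) (s'.reals 0) k := by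
  unfold medianSteps
  refine Tri.seq (listProg_spec hns) fun s1 hf1 ⟨h1, h1'⟩ => ?_
  refine Tri.seq (ceilProg_spec (hf1.reals 1 (by decide) ▸ hδs)) fun s2 hf2 h2 => ?_
  have hk2 : s2.nats 0 1 = k := by rw [hf2.nats 0 (by decide), hf1.nats 0 (by decide), hks]
  refine Tri.seq (productProg_spec (n := n) (k := k)
    (by rw [hf2.nats 0 (by decide), hf1.nats 0 (by decide), hns]) hk2 h2) fun s3 hf3 h3 => ?_
  refine Tri.seq (Q := fun s' => s'.nats 19 0 = 0) (Tri.setNat (by simp [NatExpr.val]))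
    fun s4 hf4 h4 => ?_
  have hW4 : s4.reals 0 = s.reals 0 := by
    rw [hf4.reals 0 (by decide), hf3.reals 0 (by decide), hf2.reals 0 (by decide),
      hf1.reals 0 (by decide)]
  have hP4 : ∀ i < n, s4.nats 2 i = i := by
    rw [hf4.nats 2 (by decide), hf3.nats 2 (by decide), hf2.nats 2 (by decide)]
    exact h1'
  refine Tri.mono (roundsProg_spec hq hk hkn (Nat.ceil_pos.2 hδ) hl
    (by rw [hf4.nats 0 (by decide), hf3.nats 0 (by decide), hk2])
    (by rw [hf4.nats 1 (by decide), hf3.nats 1 (by decide), hf2.nats 1 (by decide), h1])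
    (by rw [hf4.nats 18 (by decide), h3]) h4 rfl hW4
    fun i hi => ⟨by rw [hP4 i hi]; exact hi, hW i hi⟩) le_rfl ?_
  rintro s5 - ⟨h5, hwt, happ⟩
  refine ⟨h5, hwt, fun S hS hSk f hf => ?_⟩
  have e : ∀ f, pairing lab id (s.reals 0) n f = pairing lab (s4.nats 2) (s.reals 0) n f :=
    fun f => pairing_congr (fun i hi => (hP4 i hi).symm) (fun _ _ => rfl) f
  rw [e, e]
  exact happ S hS hSk f hf

/-- Products occur in addresses only, which tameness does not restrict; differences and quotients of
stored integers are harmless because they do not exceed the first operand. -/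
theorem medianProg_tame : medianProg.Tame := by
  simp [medianProg, listProg, ceilProg, productProg, roundsProg, roundProg, blockSizeProg,
    blocksProg, sizeProg, blockProg, diamProg, sepProg, radiiProg, valuesProg, initProg, greedyProg,
    startProg, chainProg, childProg, levelProg, collectProg, nearestProg, advanceProg, copyProg,
    Prog.Tame, NatExpr.Tame]

end KMedian

/-! ## Resource bounds and the main theorem -/

namespace KMedian

open RealRAM

theorem medianSteps_le {n k g l Lm : ℕ} (hn : 1 ≤ n) (hk : 1 ≤ k) (hg : 1 ≤ g) :
    medianSteps n k g l Lm ≤ 2100 * ((l + 1) * (Lm + 1) * (n * k * g)) := by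
  have h1 : n ≤ n * k := Nat.le_mul_of_pos_right _ hk
  have h2 : n * k ≤ n * k * g := Nat.le_mul_of_pos_right _ hg
  have h3 : g ≤ n * k * g := Nat.le_mul_of_pos_left _ (by positivity)
  have h4 : n * k * g ≤ (l + 1) * (Lm + 1) * (n * k * g) :=
    Nat.le_mul_of_pos_left _ (by positivity)
  have h5 : l + 1 ≤ (l + 1) * (Lm + 1) * (n * k * g) := by
    rw [mul_assoc]
    exact Nat.le_mul_of_pos_right _ (by positivity)
  have h6 : medianSteps n k g l Lm = 3 * n + 3 + (2 + 2 * g) +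
      (3 + 3 * (n * k * g) + 4 * (n * k) + 4 * n) +
      (2 + 2000 * ((l + 1) * (Lm + 1) * (n * k * g)) + (l + 1)) := by
    unfold medianSteps
    ring
  omega

theorem size_le_logb_add_one {m : ℕ} (hm : 1 ≤ m) {z : ℝ} (hz : (m : ℝ) ≤ z) :
    (m.size : ℝ) ≤ Real.logb 2 z + 1 := by
  have h1 : 0 < m.size := Nat.size_pos.2 hm
  have h2 : 2 ^ (m.size - 1) ≤ m := Nat.lt_size.1 (by omega)
  have hm' : (1 : ℝ) ≤ m := by exact_mod_cast hm
  have h3 : ((m.size - 1 : ℕ) : ℝ) ≤ Real.logb 2 z := by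
    rw [Real.le_logb_iff_rpow_le (by norm_num) (by linarith), Real.rpow_natCast]
    exact le_trans (by exact_mod_cast h2) hz
  rw [Nat.cast_sub h1] at h3
  push_cast at h3
  linarith

theorem one_le_logb_two {z : ℝ} (hz : 2 ≤ z) : 1 ≤ Real.logb 2 z := by
  rw [Real.le_logb_iff_rpow_le (by norm_num) (by linarith), Real.rpow_one]
  exact hz

theorem logb_two_le {z : ℝ} (hz : 2 ≤ z) : Real.logb 2 z ≤ 2 * z := by
  have h1 := Real.log_le_self (x := z) (by linarith)
  have h2 := Real.log_two_gt_d9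
  rw [Real.logb, div_le_iff₀ (by linarith)]
  nlinarith

/-- The constant in the bound for the running time. -/
noncomputable def timeConst (r a : ℕ) : ℝ :=
  (r + 1) * 100800 * (Real.logb 2 (4 * (1 + 100800 * a)) + 5) / Real.log 2 ^ 3

theorem logb_timeConst_nonneg (a : ℕ) : 0 ≤ Real.logb 2 (4 * (1 + 100800 * (a : ℝ))) := by
  refine Real.logb_nonneg (by norm_num) ?_
  have : (0 : ℝ) ≤ a := by positivity
  linarith

theorem timeConst_pos (r a : ℕ) : 0 < timeConst r a := by
  have h1 := logb_timeConst_nonneg a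
  have h2 : 0 < Real.log 2 := Real.log_pos (by norm_num)
  unfold timeConst
  positivity

/-- Steps are converted into time. -/
theorem time_le {r a n k l Lm N t : ℕ} {δ z : ℝ} (hn : 2 ≤ n) (hk : 1 ≤ k) (hδ : 2 ≤ δ)
    (hkδ : k * δ ≤ n) (hz : (n : ℝ) ≤ z) (hl : (l : ℝ) ≤ 2 * Real.logb 2 z)
    (hLm : (Lm : ℝ) + 1 ≤ 8 * Real.logb 2 z) (hN : N ≤ medianSteps n k ⌈δ⌉₊ l Lm)
    (ht : t ≤ r * N * (n + a * N).size) :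
    (t : ℝ) ≤ timeConst r a * (n * k * δ) * Real.log z ^ 3 := by
  have hn' : (2 : ℝ) ≤ n := by exact_mod_cast hn
  have hk' : (1 : ℝ) ≤ k := by exact_mod_cast hk
  have hz2 : 2 ≤ z := by linarith
  have hY1 := one_le_logb_two hz2
  have hY2 := logb_two_le hz2
  set Y := Real.logb 2 z with hY
  have hg : (⌈δ⌉₊ : ℝ) ≤ 2 * δ := by
    have := Nat.ceil_lt_add_one (a := δ) (by linarith)
    linarith
  -- The constant is `2100 * 3 * 8 * 2`, from `l + 1 ≤ 3 * Y`, `Lm + 1 ≤ 8 * Y` and `⌈δ⌉ ≤ 2 * δ`.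
  have hNr : (N : ℝ) ≤ 100800 * (n * k * δ) * Y ^ 2 := by
    have h1 : (N : ℝ) ≤ 2100 * ((l + 1) * (Lm + 1) * (n * k * ⌈δ⌉₊)) := by
      exact_mod_cast hN.trans (medianSteps_le (by omega) hk (Nat.ceil_pos.2 (by linarith)))
    calc (N : ℝ) ≤ 2100 * ((l + 1) * (Lm + 1) * (n * k * ⌈δ⌉₊)) := h1
      _ ≤ 2100 * ((3 * Y) * (8 * Y) * (n * k * (2 * δ))) := by
        gcongr
        linarith
      _ = _ := by ring
  -- As `k * δ ≤ n`, the step count is polynomial in `z`, so bit lengths are of order `log z`. This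
  -- is the third logarithmic factor.
  have hA : ((n + a * N : ℕ) : ℝ) ≤ 4 * (1 + 100800 * a) * z ^ 4 := by
    have h1 : (n : ℝ) * k * δ ≤ z ^ 2 := by
      rw [mul_assoc, sq]
      exact mul_le_mul hz (hkδ.trans hz) (by positivity) (by linarith)
    have h2 : (N : ℝ) ≤ 100800 * 4 * z ^ 4 :=
      calc (N : ℝ) ≤ 100800 * (n * k * δ) * Y ^ 2 := hNr
        _ ≤ 100800 * z ^ 2 * (2 * z) ^ 2 := by gcongr
        _ = _ := by ring
    have h3 : (n : ℝ) ≤ z ^ 4 := hz.trans (le_self_pow₀ (by linarith) (by norm_num))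
    have h4 : (0 : ℝ) ≤ z ^ 4 := by positivity
    push_cast
    have := mul_le_mul_of_nonneg_left h2 (Nat.cast_nonneg (α := ℝ) a)
    linarith
  have hsize : ((n + a * N).size : ℝ) ≤ (Real.logb 2 (4 * (1 + 100800 * a)) + 5) * Y := by
    have h1 := size_le_logb_add_one (by omega) hA
    have h0 := logb_timeConst_nonneg a
    rw [Real.logb_mul (by positivity) (by positivity), Real.logb_pow, ← hY] at h1
    push_cast at h1
    nlinarith
  have hlog : 0 < Real.log 2 := Real.log_pos (by norm_num)
  have hYlog : Y ^ 3 = Real.log z ^ 3 / Real.log 2 ^ 3 := by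
    rw [hY, Real.logb, div_pow]
  have h0 := logb_timeConst_nonneg a
  calc (t : ℝ) ≤ r * N * (n + a * N).size := by exact_mod_cast ht
    _ ≤ (r + 1) * (100800 * (n * k * δ) * Y ^ 2) *
        ((Real.logb 2 (4 * (1 + 100800 * a)) + 5) * Y) := by
      gcongr
      linarith
    _ = (r + 1) * 100800 * (Real.logb 2 (4 * (1 + 100800 * a)) + 5) * (n * k * δ) * Y ^ 3 := by
      ring
    _ = _ := by
      rw [hYlog, timeConst]
      ring

/-- The number of rounds. -/
theorem two_pow_ceil_logb_bounds {x : ℝ} (hx : 1 ≤ x) :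
    x ≤ 2 ^ ⌈Real.logb 2 x⌉₊ ∧ (2 : ℝ) ^ ⌈Real.logb 2 x⌉₊ ≤ 2 * x := by
  have h0 : 0 ≤ Real.logb 2 x := Real.logb_nonneg (by norm_num) hx
  constructor
  · have h1 := Nat.le_ceil (Real.logb 2 x)
    rwa [Real.logb_le_iff_le_rpow (by norm_num) (by linarith), Real.rpow_natCast] at h1
  · have h1 := (Nat.ceil_lt_add_one h0).le
    calc (2 : ℝ) ^ ⌈Real.logb 2 x⌉₊ = (2 : ℝ) ^ ((⌈Real.logb 2 x⌉₊ : ℕ) : ℝ) :=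
          (Real.rpow_natCast _ _).symm
      _ ≤ 2 ^ (Real.logb 2 x + 1) := Real.rpow_le_rpow_of_exponent_le (by norm_num) h1
      _ = 2 * x := by
        rw [Real.rpow_add (by norm_num), Real.rpow_logb (by norm_num) (by norm_num) (by linarith),
          Real.rpow_one, mul_comm]

theorem natCast_le_of_two_pow_le {l : ℕ} {x : ℝ} (h : (2 : ℝ) ^ l ≤ x) : (l : ℝ) ≤ x :=
  le_trans (by exact_mod_cast Nat.lt_two_pow_self.le) h

/-! ### Transfer to labelled metric spaces -/

section Spaces

variable {V : Type*} {n : ℕ} (label : Fin n ≃ V)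

/-- The point with a given label. -/
def point (hn : 0 < n) (i : ℕ) : V := if h : i < n then label ⟨i, h⟩ else label ⟨0, hn⟩

theorem point_of_lt (hn : 0 < n) {i : ℕ} (hi : i < n) : point label hn i = label ⟨i, hi⟩ :=
  dif_pos hi

variable [MetricSpace V]

theorem answer_eq (hn : 0 < n) {x y : ℕ} (hx : x < n) (hy : y < n) :
    answer label x y = dist (point label hn x) (point label hn y) := by
  rw [answer, dif_pos ⟨hx, hy⟩, point_of_lt label hn hx, point_of_lt label hn hy]

variable [Fintype V]

theorem dist_le_aspectRatio_mul {x' y' : V} (h : x' ≠ y') (x y : V) :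
    dist x y ≤ aspectRatio V * dist x' y' := by
  have h1 : dist x y ≤ Metric.diam (Set.univ : Set V) :=
    Metric.dist_le_diam_of_mem Set.finite_univ.isBounded (Set.mem_univ _) (Set.mem_univ _)
  have hnt : (Set.univ : Set V).Nontrivial := ⟨x', trivial, y', trivial, h⟩
  have h2 : 0 < Set.infsep (Set.univ : Set V) := Set.finite_univ.infsep_pos_iff_nontrivial.2 hnt
  have h3 : Set.infsep (Set.univ : Set V) ≤ dist x' y' :=
    Set.infsep_le_dist_of_mem (Set.mem_univ _) (Set.mem_univ _) h
  calc dist x y ≤ Metric.diam (Set.univ : Set V) := h1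
    _ = aspectRatio V * Set.infsep (Set.univ : Set V) := by
      rw [aspectRatio, div_mul_cancel₀ _ h2.ne']
    _ ≤ _ := mul_le_mul_of_nonneg_left h3 (div_nonneg Metric.diam_nonneg h2.le)

theorem one_le_aspectRatio {x y : V} (h : x ≠ y) : 1 ≤ aspectRatio V := by
  have h1 := dist_le_aspectRatio_mul h x y
  have h2 : 0 < dist x y := dist_pos.2 h
  by_contra! hlt
  nlinarith

theorem cost_eq_pairing (hn : 0 < n) (w : V → ℝ) (S : Finset V) {W : ℕ → ℝ}
    (hW : ∀ i (hi : i < n), W i = w (label ⟨i, hi⟩)) :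
    cost w S = pairing (point label hn) id W n fun x => Metric.infDist x S := by
  rw [cost, pairing, ← Equiv.sum_comp label, Finset.sum_range]
  refine Finset.sum_congr rfl fun i _ => ?_
  rw [hW i i.2, id, point_of_lt label hn i.2]

theorem le_mul_opt {w : V → ℝ} {k : ℕ} {c F : ℝ} (hk : k ≤ Fintype.card V) (hF : 0 < F)
    (h : ∀ S : Finset V, S.card = k → c ≤ F * cost w S) : c ≤ F * opt w k := by
  rw [← div_le_iff₀' hF]
  refine le_csInf ?_ ?_
  · obtain ⟨S, -, hS⟩ := Finset.exists_subset_card_eq (s := (Finset.univ : Finset V)) (n := k)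
      (by rwa [Finset.card_univ])
    exact ⟨_, S, hS, rfl⟩
  · rintro _ ⟨S, hS, rfl⟩
    rw [div_le_iff₀' hF]
    exact h S hS

/-- The algorithm is correct and meets its time bound. -/
theorem medianProg_correct (w : V → ℝ) (k : ℕ) (δ : ℝ) (hw : ∀ x, 0 ≤ w x) (hk : 1 ≤ k)
    (hδ : 2 ≤ δ) (hδn : δ ≤ (n : ℝ) / k) :
    ∃ (t : ℕ) (S : Finset V), Returns medianProg label w k δ t S ∧ S.Nonempty ∧ S.card ≤ k ∧
      cost w S ≤ (9 * 27) ^ (⌈Real.logb 2 (Real.log ((n : ℝ) / k) / Real.log δ)⌉₊ + 1) *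
        opt w k ∧
      cost w S ≤ 4 ^ 8 * (Real.log ((n : ℝ) / k) / Real.log δ) ^ 8 * opt w k ∧
      (t : ℝ) ≤ timeConst medianProg.rate medianProg.incr * (n * k * δ) *
        Real.log (n * aspectRatio V) ^ 3 := by
  classical
  have hk' : (1 : ℝ) ≤ k := by exact_mod_cast hk
  have hkδ : k * δ ≤ n := by rwa [le_div_iff₀ (by linarith), mul_comm] at hδn
  have hn2 : (2 : ℝ) ≤ n := by nlinarith
  have hn : 2 ≤ n := by exact_mod_cast hn2
  have hn0 : 0 < n := by omega
  have hkn : k ≤ n := by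
    have : (k : ℝ) ≤ n := by nlinarith
    exact_mod_cast this
  have hcard : Fintype.card V = n := by rw [← Fintype.card_congr label, Fintype.card_fin]
  have hne : label ⟨0, by omega⟩ ≠ label ⟨1, by omega⟩ := by simp
  have hΔ := one_le_aspectRatio hne
  set Δ := aspectRatio V with hΔdef
  -- the number of rounds
  have hlogδ : 0 < Real.log δ := Real.log_pos (by linarith)
  set ρ := Real.log ((n : ℝ) / k) / Real.log δ with hρdef
  have hρ1 : 1 ≤ ρ := by
    rw [hρdef, one_le_div hlogδ]
    exact Real.log_le_log (by linarith) hδn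
  obtain ⟨hρl, hρu⟩ := two_pow_ceil_logb_bounds hρ1
  set l := ⌈Real.logb 2 ρ⌉₊ with hl
  have hnk : (n : ℝ) ≤ k * δ ^ 2 ^ l := by
    have h1 : Real.log ((n : ℝ) / k) ≤ ((2 ^ l : ℕ) : ℝ) * Real.log δ := by
      rw [← div_le_iff₀ hlogδ]
      exact_mod_cast hρl
    rw [← Real.log_pow, Real.log_le_log_iff (by positivity) (by positivity),
      div_le_iff₀ (by linarith)] at h1
    linarith
  have hnk' : n ≤ k * ⌈δ⌉₊ ^ 2 ^ l := by
    have h1 : (n : ℝ) ≤ k * (⌈δ⌉₊ : ℝ) ^ 2 ^ l :=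
      hnk.trans (by gcongr; exact Nat.le_ceil δ)
    exact_mod_cast h1
  -- the number of levels
  set Lm := ⌈Real.logb 2 (30 * Δ)⌉₊ with hLm
  obtain ⟨hLl, -⟩ := two_pow_ceil_logb_bounds (x := 30 * Δ) (by linarith)
  have hlabels : Labels n Lm (answer label) (point label hn0) := by
    refine ⟨fun x hx y hy => answer_eq label hn0 hx hy, ?_, ?_⟩
    · have : (30 : ℝ) ≤ 2 ^ Lm := by linarith
      exact_mod_cast this
    · intro x hx y hy x' hx' y' hy' hpos
      rw [answer_eq label hn0 hx hy, answer_eq label hn0 hx' hy'] at *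
      have h1 := dist_le_aspectRatio_mul (dist_pos.1 hpos) (point label hn0 x) (point label hn0 y)
      have h2 := mul_le_mul_of_nonneg_right hLl hpos.le
      linarith
  -- the run
  have hinW : ∀ i (hi : i < n), (input label w k δ).reals 0 i = w (label ⟨i, hi⟩) := by
    intro i hi
    simp [input, hi]
  obtain ⟨N, s', hsteps, hN, h1, hwt, happ⟩ := medianProg_spec (s := input label w k δ) hlabels hk
    hkn (by linarith) hnk' (by simp [input]) (by simp [input]) (by simp [input])
    (fun i hi => by rw [hinW i hi]; exact hw _)
  have hmem : ∀ a i, (input label w k δ).nats a i ≤ n := by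
    intro a i
    simp only [input]
    split_ifs <;> omega
  obtain ⟨t, ht, htle, -⟩ := hsteps.exists_runs medianProg_tame hn hmem
  set S : Finset V := (Finset.range k).image fun i => point label hn0 (s'.nats 2 i) with hS
  have hF : (0 : ℝ) < 243 ^ (l + 1) := by positivity
  have hcost : cost w S ≤ 243 ^ (l + 1) * opt w k := by
    refine le_mul_opt (by omega) hF fun T hT => ?_
    have hTne : T.Nonempty := Finset.card_pos.1 (by omega)
    -- The test function is the distance to the output. It vanishes on the final list, whose points
    -- form `S`, so the error bound controls all of `cost w S`.
    have h2 := happ T hTne hT.le (fun x => Metric.infDist x S) (abs_infDist_sub_infDist_le _)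
    rw [← cost_eq_pairing label hn0 w S hinW, ← cost_eq_pairing label hn0 w T hinW] at h2
    have h3 : pairing (point label hn0) (s'.nats 2) (s'.reals 0) k
        (fun x => Metric.infDist x S) = 0 :=
      Finset.sum_eq_zero fun i hi => by
        change _ * Metric.infDist _ _ = 0
        rw [Metric.infDist_zero_of_mem, mul_zero]
        exact Finset.mem_coe.2 (Finset.mem_image_of_mem _ hi)
    rw [h3, sub_zero] at h2
    have h4 := (le_abs_self _).trans h2
    have h5 : 0 ≤ cost w T :=
      Finset.sum_nonneg fun x _ => mul_nonneg (hw x) Metric.infDist_nonneg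
    linarith
  have hopt : 0 ≤ opt w k := by
    refine Real.sInf_nonneg ?_
    rintro _ ⟨T, -, rfl⟩
    exact Finset.sum_nonneg fun x _ => mul_nonneg (hw x) Metric.infDist_nonneg
  refine ⟨t, S, ⟨s', ht, ?_⟩, ?_, ?_, ?_, ?_, ?_⟩
  · rw [output, h1, hS, Finset.image_image]
    refine Finset.image_congr fun i hi => ?_
    have hi' := (hwt i (Finset.mem_range.1 hi)).1
    simp [point_of_lt label hn0 hi']
  · exact ⟨_, Finset.mem_image_of_mem _ (Finset.mem_range.2 hk)⟩
  · exact Finset.card_image_le.trans (by simp)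
  · norm_num
    exact hcost
  · refine hcost.trans (mul_le_mul_of_nonneg_right ?_ hopt)
    -- As `243 ≤ 2 ^ 8`, the factor is at most the eighth power of `2 * 2 ^ l ≤ 4 * ρ`; hence the
    -- exponent 8 and the constant `4 ^ 8`.
    calc (243 : ℝ) ^ (l + 1) ≤ 256 ^ (l + 1) := pow_le_pow_left₀ (by norm_num) (by norm_num) _
      _ = (2 * 2 ^ l) ^ 8 := by
        rw [← pow_succ', ← pow_mul, mul_comm, pow_mul]
        norm_num
      _ ≤ (2 * (2 * ρ)) ^ 8 := by gcongr
      _ = 4 ^ 8 * ρ ^ 8 := by ring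
  · have hnz : (n : ℝ) ≤ n * Δ := le_mul_of_one_le_right (by positivity) hΔ
    have hY1 := one_le_logb_two (hn2.trans hnz)
    have hlog2 : 0 < Real.log 2 := Real.log_pos (by norm_num)
    refine time_le hn hk hδ hkδ hnz ?_ ?_ hN htle
    -- Here `l ≤ 2 ^ l ≤ 2 * ρ`, and `ρ` is at most the binary logarithm of `n * Δ` because `δ ≥ 2`.
    · refine (natCast_le_of_two_pow_le hρu).trans (mul_le_mul_of_nonneg_left ?_ (by norm_num))
      rw [hρdef, Real.logb]
      refine div_le_div₀ (Real.log_nonneg (by linarith)) ?_ hlog2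
        (Real.log_le_log (by norm_num) hδ)
      refine Real.log_le_log (by positivity) (le_trans ?_ hnz)
      exact div_le_self (by positivity) hk'
    · have h2 := (Nat.ceil_lt_add_one (a := Real.logb 2 (30 * Δ))
        (Real.logb_nonneg (by norm_num) (by linarith))).le
      -- From `30 ≤ 2 ^ 5`, with two units for the rounding and the extra 1, `Lm + 1 ≤ 7 + Y ≤ 8 *
      -- Y`.
      have h3 : Real.logb 2 (30 * Δ) ≤ Real.logb 2 (2 ^ 5 * (n * Δ)) := by
        refine Real.logb_le_logb_of_le (by norm_num) (by linarith) ?_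
        nlinarith
      have h4 : Real.logb 2 (2 ^ 5 * (n * Δ)) = 5 + Real.logb 2 (n * Δ) := by
        rw [Real.logb_mul (by norm_num) (by positivity), Real.logb_pow,
          Real.logb_self_eq_one (by norm_num)]
        norm_num
      linarith

end Spaces

end KMedian

theorem mainTheorem6 :
    ∃ (P : RealRAM.Prog) (α C₁ C₂ : ℝ) (c₁ c₂ : ℕ), 1 ≤ α ∧ 0 < C₁ ∧ 0 < C₂ ∧
      ∀ (V : Type*) [Fintype V] [MetricSpace V] (n : ℕ) (label : Fin n ≃ V)
        (w : V → ℝ) (k : ℕ) (δ : ℝ),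
        (∀ x, 0 ≤ w x) → 1 ≤ k → 2 ≤ δ → δ ≤ (n : ℝ) / k →
        ∃ (t : ℕ) (S : Finset V),
          KMedian.Returns P label w k δ t S ∧
          S.Nonempty ∧ S.card ≤ k ∧
          KMedian.cost w S ≤
            (9 * α) ^ (⌈Real.logb 2 (Real.log ((n : ℝ) / k) / Real.log δ)⌉₊ + 1) *
              KMedian.opt w k ∧
          KMedian.cost w S ≤
            C₁ * (Real.log ((n : ℝ) / k) / Real.log δ) ^ c₁ * KMedian.opt w k ∧
          (t : ℝ) ≤
            C₂ * (n * k * δ) * Real.log (n * KMedian.aspectRatio V) ^ c₂ := by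
  -- The value `α = 27` makes `9 * α = 243 = 1 + 242`, the factor lost in one round.
  exact ⟨KMedian.medianProg, 27, 4 ^ 8,
    KMedian.timeConst KMedian.medianProg.rate KMedian.medianProg.incr, 8, 3, by norm_num,
    by norm_num, KMedian.timeConst_pos _ _, fun V _ _ n label w k δ =>
      KMedian.medianProg_correct label w k δ⟩
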